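/- **Setting.** Let $S_q=\{x_1,\dots,x_N\}\subset\mathbb R^d$ ($N\ge 1$ distinct points) and let $C=\{c_1,\dots,c_k\}\subset\mathbb R^d$ ($k\ge1$ distinct centroids), with the Euclidean metric. For a finite set $S$ put $B_S(p,\Delta)=\{r\in S: d(p,r)\le\Delta\}$; the expansion constant of $S$ is the smallest $c\ge 2$ with $|B_S(p,2\Delta)|\le c\,|B_S(p,\Delta)|$ for all $p\in S$, $\Delta>0$. Let $c_k$ be the expansion constant of $C$, let $c_{qk}$ be the maximum of $c_k$ and of the expansion constants of the sets $C\cup\{x_i\}$, $1\le i\le N$, and let $c_k'$ be the expansion constant of the set $C'$ of updated centroids that the iteration produces. A cover tree is a rooted tree whose nodes hold one point each and have a scale in $\mathbb Z\cup\{-\infty\}$ (leaves: $-\infty$; each point is held by exactly one leaf). It is stored explicitly: a non-leaf node of scale $s$ has at least two children, one of them holding its own point, and all children have scale less than $s$. In the implicit leveled tree a child of a node of scale $s$ is present on all levels $\le s-1$ and the root on all levels; a child of a node of scale $s$ has distance at most $2^{s}$ from it, and distinct points present on level $i$ have distance greater than $2^i$. Let $\mathscr T$ be a cover tree on $S_q$,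 and let $s_{\min}$ be the smallest scale of a non-leaf node. The imbalance of a non-root node with parent scale $s_p$ is $s_p-s-1$ if it is a non-leaf of scale $s$, and $\max(s_p-s_{\min}-1,0)$ if it is a leaf; the root has imbalance $0$. The sum of these numbers over all nodes is $i_t(\mathscr T)$. One iteration of dual-tree $k$-means, started with the centroids $C$, the tree $\mathscr T$, and for every node $\mathscr N$ of $\mathscr T$ a stored number $\mathrm{ub}(\mathscr N)\le\infty$ that is an upper bound for the distance of every descendant point of $\mathscr N$ to its nearest centroid (all other stored data being arbitrary), performs the following steps: coalesce $\mathscr T$ by removing the nodes marked as unable to change owner; build a cover tree on $C$ by successive insertion; run the standard pruning dual-tree traversal for cover trees on the two trees with the $k$-means functions `Score()` (a pair of nodes is pruned if the minimum distance between their bounding balls exceeds $\mathrm{ub}$ of the query node, or if all but one centroid have been pruned for the query node) and `BaseCase()` (which updates the bounds and the closest centroid of a point); restore $\mathscr T$; replace the centroids by the means of the points they own; compute the movement of the centroids and, by a monochromatic cover-tree nearest-neighbour search on the updated centroids, the distance of each to its nearest other centroid; and update all bounds and marks in one pass over $\mathscr T$. **Theorem.** There is an absolute constant $K$ such that, for all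 $d,N,k$ and all data as above, such an iteration takes at most $$K\Bigl(c_k^4\,c_{qk}^5\,\bigl(N+i_t(\mathscr T)\bigr)+\max(c_k,c_k')^9\,k\log k\Bigr)$$ elementary steps, where a distance evaluation, an arithmetic operation on numbers or points, a comparison, a power of two or rounded base-2 logarithm, and the access to a node, list entry or table entry each count as one step. -/

import Mathlib

/-!
  One iteration of dual-tree `k`-means with cover trees, written as an explicit program
  that returns its result together with its running time.

  Time is counted in elementary steps.  Constant-size blocks of work cost one step each: following a
  link of a tree, handling one entry of a list, reading or writing one table entry, one
  arithmetic operation on scalars or on points, one comparison, one distance evaluation,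
  one power of two or one rounded base-two logarithm.  Every loop and every recursion is
  charged for each element that it handles.
-/

noncomputable section

namespace DualTree

/-- The data space. -/
abbrev Pt (d : ℕ) := EuclideanSpace ℝ (Fin d)

/-! ### Expansion constants -/

open scoped Classical in
/-- `|B_S(p, r)|`, for the closed ball. -/
def ballCount {d : ℕ} (S : Finset (Pt d)) (p : Pt d) (r : ℝ) : ℕ :=
  (S.filter fun y => dist p y ≤ r).card

/-- The smallest `a ≥ 2` with `|B_S(p, 2Δ)| ≤ a |B_S(p, Δ)|` for all `p ∈ S`, `Δ > 0`. -/
def expansionConstant {d : ℕ} (S : Finset (Pt d)) : ℝ :=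
  sInf {a : ℝ | 2 ≤ a ∧ ∀ p ∈ S, ∀ Δ : ℝ, 0 < Δ →
    (ballCount S p (2 * Δ) : ℝ) ≤ a * (ballCount S p Δ : ℝ)}

open scoped Classical in
/-- The expansion constant `c_k` of a family of centroids. -/
def centroidExpansion {d k : ℕ} (c : Fin k → Pt d) : ℝ :=
  expansionConstant (Finset.univ.image c)

open scoped Classical in
/-- `c_{qk}`: the largest of `c_k` and the expansion constants of the centroids plus one
  data point. -/
def jointExpansion {d N k : ℕ} (x : Fin N → Pt d) (c : Fin k → Pt d) : ℝ :=
  max (⨆ i : Fin N, expansionConstant (insert (x i) (Finset.univ.image c)))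
    (centroidExpansion c)

/-! ### Trees -/

/-- Explicit leveled trees whose nodes hold one point each, given by its index.  A `leaf`
  has scale `-∞`, a `node` has an integer scale. -/
inductive CTree (α : Type) where
  | leaf (p : α) : CTree α
  | node (p : α) (s : ℤ) (children : List (CTree α)) : CTree α

namespace CTree

variable {α : Type}

/-- The point held by the root of a tree. -/
def pt : CTree α → α
  | leaf p => p
  | node p _ _ => p

/-- The scale of the root of a tree; `⊥` stands for `-∞`. -/
def scale : CTree α → WithBot ℤ
  | leaf _ => ⊥
  | node _ s _ => (s : WithBot ℤ)

/-- The children of the root of a tree. -/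
def children : CTree α → List (CTree α)
  | leaf _ => []
  | node _ _ cs => cs

/-- The name under which data about a node is stored.  In a cover tree, a point is held by
  at most one node of each scale. -/
def key (t : CTree α) : α × WithBot ℤ := (t.pt, t.scale)

/-- Radius of a ball around the point of a node that contains all descendant points. -/
def radius : CTree α → ℝ
  | leaf _ => 0
  | node _ s _ => (2 : ℝ) ^ (s + 1)

mutual
/-- All nodes of a tree, each as the subtree below it. -/
def subtrees : CTree α → List (CTree α)
  | leaf p => [leaf p]
  | node p s cs => node p s cs :: subtreesList cs
/-- All nodes of a list of trees. -/
def subtreesList : List (CTree α) → List (CTree α)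
  | [] => []
  | t :: ts => subtrees t ++ subtreesList ts
end

mutual
/-- The points held by the leaves of a tree, that is, its descendant points. -/
def leaves : CTree α → List α
  | leaf p => [p]
  | node _ _ cs => leavesList cs
/-- The descendant points of a list of trees. -/
def leavesList : List (CTree α) → List α
  | [] => []
  | t :: ts => leaves t ++ leavesList ts
end

mutual
/-- All non-root nodes of a tree, each with the scale of its parent. -/
def links : CTree α → List (ℤ × CTree α)
  | leaf _ => []
  | node _ s cs => linksList s cs
/-- The nodes of a list of trees whose roots have a parent of scale `s`. -/
def linksList (s : ℤ) : List (CTree α) → List (ℤ × CTree α)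
  | [] => []
  | t :: ts => (s, t) :: (links t ++ linksList s ts)
end

mutual
/-- The number of nodes of a tree. -/
def numNodes : CTree α → ℕ
  | leaf _ => 1
  | node _ _ cs => 1 + numNodesList cs
/-- The number of nodes of a list of trees. -/
def numNodesList : List (CTree α) → ℕ
  | [] => 0
  | t :: ts => numNodes t + numNodesList ts
end

/-- The point `p` belongs to level `i` of the implicit tree, in which a node is repeated
  on all levels below the level of its parent; the root point belongs to every level. -/
def OnLevel (T : CTree α) (i : ℤ) (p : α) : Prop :=
  p = T.pt ∨ ∃ l ∈ T.links, l.2.pt = p ∧ i < l.1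

/-- `T` is the explicit form of a cover tree on the points `x`: in the implicit leveled tree,
  the nodes whose only child is their own copy are left out. -/
structure IsCoverTree {d : ℕ} (x : α → Pt d) (T : CTree α) : Prop where
  /-- each point is held by exactly one leaf -/
  leaves_nodup : T.leaves.Nodup
  mem_leaves : ∀ p, p ∈ T.leaves
  /-- nesting: a non-leaf node has a child with the same point -/
  nesting : ∀ p s cs, node p s cs ∈ T.subtrees → ∃ t ∈ cs, t.pt = p
  /-- the tree is explicit: a non-leaf node has at least one other child -/
  two_le : ∀ p s cs, node p s cs ∈ T.subtrees → 2 ≤ cs.length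
  /-- scales decrease from parents to children -/
  scale_lt : ∀ l ∈ T.links, l.2.scale < (l.1 : WithBot ℤ)
  /-- covering: a child of a node of scale `s` has level `s - 1` in the implicit tree -/
  covering : ∀ p s cs, node p s cs ∈ T.subtrees → ∀ t ∈ cs,
    dist (x t.pt) (x p) ≤ (2 : ℝ) ^ s
  /-- separation, on every level of the implicit tree -/
  separation : ∀ (i : ℤ) (p q : α), T.OnLevel i p → T.OnLevel i q → p ≠ q →
    (2 : ℝ) ^ i < dist (x p) (x q)

/-- The smallest scale of a non-leaf node. -/
def minScale (T : CTree α) : ℤ := sInf {s : ℤ | ∃ p cs, node p s cs ∈ T.subtrees}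

/-- Cover node imbalance of a non-root node `t` of `T` whose parent has scale `sp`. -/
def nodeImbalance (T : CTree α) (sp : ℤ) : CTree α → ℕ
  | leaf _ => (max (sp - T.minScale - 1) 0).toNat
  | node _ s _ => (sp - s - 1).toNat

/-- Cover tree imbalance; the root contributes `0`. -/
def imbalance (T : CTree α) : ℕ := (T.links.map fun l => T.nodeImbalance l.1 l.2).sum

/-! ### Sets of nodes, handled from the largest scale downwards -/

/-- The largest scale in a list of nodes. -/
def maxScale : List (CTree α) → WithBot ℤ
  | [] => ⊥
  | t :: ts => max t.scale (maxScale ts)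

/-- Replace the nodes of scale `s` by their children. -/
def expand (s : WithBot ℤ) : List (CTree α) → List (CTree α)
  | [] => []
  | t :: ts => if t.scale = s then t.children ++ expand s ts else t :: expand s ts

theorem numNodesList_append (a b : List (CTree α)) :
    numNodesList (a ++ b) = numNodesList a + numNodesList b := by
  induction a with
  | nil => simp [numNodesList]
  | cons t ts ih => simp [numNodesList, ih, add_assoc]

theorem numNodesList_filter_le (f : CTree α → Bool) (a : List (CTree α)) :
    numNodesList (a.filter f) ≤ numNodesList a := by
  induction a with
  | nil => simp [numNodesList]
  | cons t ts ih =>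
    by_cases h : f t
    · simp [h, numNodesList, ih]
    · simp [h, numNodesList]; omega

theorem numNodes_children_le (t : CTree α) : numNodesList t.children ≤ t.numNodes := by
  cases t <;> simp [children, numNodes, numNodesList]

theorem numNodesList_expand_le (s : WithBot ℤ) (a : List (CTree α)) :
    numNodesList (expand s a) ≤ numNodesList a := by
  induction a with
  | nil => simp [expand]
  | cons t ts ih =>
    have := numNodes_children_le t
    unfold expand
    split_ifs
    · simp only [numNodesList_append, numNodesList]; omega
    · simp only [numNodesList]; omega

theorem numNodesList_expand_lt (a : List (CTree α)) (h : maxScale a ≠ ⊥) :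
    numNodesList (expand (maxScale a) a) < numNodesList a := by
  have key : ∀ (s : WithBot ℤ) (b : List (CTree α)), s ≠ ⊥ → (∃ t ∈ b, t.scale = s) →
      numNodesList (expand s b) < numNodesList b := by
    intro s b hs
    induction b with
    | nil => simp
    | cons t ts ih =>
      rintro ⟨u, hu, hus⟩
      unfold expand
      split_ifs with hts
      · have h1 := numNodesList_expand_le s ts
        have h2 : numNodesList t.children < t.numNodes := by
          cases t with
          | leaf p => exact absurd hts.symm hs
          | node p z cs => simp [children, numNodes]
        simp only [numNodesList_append, numNodesList]; omega
      · rcases List.mem_cons.1 hu with rfl | hu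
        · exact absurd hus hts
        · have := ih ⟨u, hu, hus⟩
          simp only [numNodesList]; omega
  refine key _ a h ?_
  induction a with
  | nil => simp [maxScale] at h
  | cons t ts ih =>
    by_cases hle : maxScale ts ≤ t.scale
    · exact ⟨t, by simp, by simp [maxScale, hle]⟩
    · have hm : maxScale (t :: ts) = maxScale ts := by
        simp [maxScale, le_of_not_ge hle]
      rw [hm] at h ⊢
      obtain ⟨u, hu, hus⟩ := ih h
      exact ⟨u, List.mem_cons_of_mem _ hu, hus⟩

end CTree

open CTree

/-! ### Building a cover tree on the centroids, by insertion -/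

section Build

variable {d k : ℕ}

/-- Smallest integer `i` with `r ≤ 2 ^ i`, for `r > 0`. -/
def ceilLog (r : ℝ) : ℤ := Int.clog 2 r

/-- What the search for a parent has found: the best parent, with its level, and a point
  of the tree that coincides with the new point, if one was met. -/
structure Found (k : ℕ) where
  par : Fin k
  level : ℤ
  twin : Option (Fin k)

/-- Consider the point of a node whose highest level in the implicit tree is `top` as a parent of
  `p`: it can be the parent on each level `i ≤ top` with `dist ≤ 2 ^ i`. -/
def consider (c : Fin k → Pt d) (p : Fin k) (top : ℤ) (t : CTree (Fin k)) (b : Found k) :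
    Found k :=
  if dist (c p) (c t.pt) = 0 then { b with twin := some t.pt }
  else if ceilLog (dist (c p) (c t.pt)) ≤ top ∧ ceilLog (dist (c p) (c t.pt)) < b.level then
    { b with par := t.pt, level := ceilLog (dist (c p) (c t.pt)) }
  else b

mutual
/-- Search for the lowest level on which `p` can get a parent.  Below a node of scale `s`, no
  parent can be found if the node is farther than `2 ^ (s + 1)`. -/
def search (c : Fin k → Pt d) (p : Fin k) : CTree (Fin k) → Found k → Found k × ℕ
  | leaf _, b => (b, 1)
  | node q s cs, b =>
    if dist (c p) (c q) ≤ (2 : ℝ) ^ (s + 1) then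
      let r := searchList c p s cs b
      (r.1, r.2 + 1)
    else (b, 1)
/-- Search among the children of a node of scale `s`. -/
def searchList (c : Fin k → Pt d) (p : Fin k) (s : ℤ) :
    List (CTree (Fin k)) → Found k → Found k × ℕ
  | [], b => (b, 0)
  | t :: ts, b =>
    let r := search c p t (consider c p (s - 1) t b)
    let r' := searchList c p s ts r.1
    (r'.1, r.2 + r'.2 + 1)
end

mutual
/-- Make `p` a child of the point `q` on level `i`, splitting a link of the explicit
  tree if `q` has no explicit node of scale `i`. -/
def graft (c : Fin k → Pt d) (p q : Fin k) (i : ℤ) : CTree (Fin k) → CTree (Fin k) × ℕ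
  | leaf y => if y = q then (node q i [leaf y, leaf p], 1) else (leaf y, 1)
  | node y s cs =>
    if y = q ∧ s = i then (node y s (leaf p :: cs), 1)
    else if y = q ∧ s < i then (node q i [node y s cs, leaf p], 1)
    else if dist (c p) (c y) ≤ (2 : ℝ) ^ (s + 1) then
      let r := graftList c p q i cs
      (node y s r.1, r.2 + 1)
    else (node y s cs, 1)
/-- Grafting below a list of siblings. -/
def graftList (c : Fin k → Pt d) (p q : Fin k) (i : ℤ) :
    List (CTree (Fin k)) → List (CTree (Fin k)) × ℕ
  | [] => ([], 0)
  | t :: ts =>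
    let r := graft c p q i t
    let r' := graftList c p q i ts
    (r.1 :: r'.1, r.2 + r'.2 + 1)
end

/-- A tree on (representatives of) the centroids, and the marks of those
  centroids that are known to coincide with another one. -/
structure Built (k : ℕ) where
  tree : CTree (Fin k)
  twins : Fin k → Bool

/-- Insert the centroid `p`. -/
def insertPoint (c : Fin k → Pt d) (B : Built k) (p : Fin k) : Built k × ℕ :=
  let D := dist (c p) (c B.tree.pt)
  let r := search c p B.tree
    { par := B.tree.pt, level := ceilLog D,
      twin := if D = 0 then some B.tree.pt else none }
  match r.1.twin with
  | some q =>
    ({ B with twins := Function.update (Function.update B.twins q true) p true }, r.2 + 1)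
  | none =>
    let g := graft c p r.1.par r.1.level B.tree
    ({ B with tree := g.1 }, r.2 + g.2 + 1)

/-- Insert a list of centroids, one after the other. -/
def insertList (c : Fin k → Pt d) : List (Fin k) → Built k → Built k × ℕ
  | [], B => (B, 0)
  | p :: ps, B =>
    let r := insertPoint c B p
    let r' := insertList c ps r.1
    (r'.1, r.2 + r'.2)

/-- Build a cover tree on the centroids. -/
def buildTree [NeZero k] (c : Fin k → Pt d) : Built k × ℕ :=
  let r := insertList c (List.finRange k).tail { tree := leaf 0, twins := fun _ => false }
  (r.1, r.2 + k)

/-! ### Monochromatic nearest neighbour search on the centroids -/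

/-- An upper bound for the distance from centroid `j` to the nearest other centroid
  that can be read off from one node. -/
def neighborBound (c : Fin k → Pt d) (j : Fin k) (t : CTree (Fin k)) : EReal :=
  if t.pt ≠ j then ((dist (c j) (c t.pt) : ℝ) : EReal)
  else if t.scale = ⊥ then ⊤ else ((t.radius : ℝ) : EReal)

/-- Improve a bound by looking at a list of nodes. -/
def improve (c : Fin k → Pt d) (j : Fin k) : List (CTree (Fin k)) → EReal → EReal
  | [], B => B
  | t :: ts, B => improve c j ts (min B (neighborBound c j t))

open scoped Classical in
/-- Descend through the tree, from the largest scale downwards, with a set `Q` of nodes that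
  may hold the nearest neighbour of `j`, and an upper bound `B` for its distance. -/
def nearest (c : Fin k → Pt d) (j : Fin k) (Q : List (CTree (Fin k))) (B : EReal) :
    EReal × ℕ :=
  if _h : maxScale Q = ⊥ then (B, Q.length + 1)
  else
    let R := expand (maxScale Q) Q
    let B' := improve c j R B
    let r := nearest c j
      (R.filter fun t => decide (t.scale ≠ ⊥ ∧
        ((dist (c j) (c t.pt) : ℝ) : EReal) ≤ B' + ((t.radius : ℝ) : EReal))) B'
    (r.1, r.2 + Q.length + 2 * R.length + 1)
termination_by numNodesList Q
decreasing_by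
  exact lt_of_le_of_lt (numNodesList_filter_le _ _) (numNodesList_expand_lt Q _h)

/-- Nearest neighbour distances for a list of centroids, written into a table. -/
def nearestList (c : Fin k → Pt d) (B : Built k) :
    List (Fin k) → (Fin k → EReal) → (Fin k → EReal) × ℕ
  | [], f => (f, 0)
  | j :: js, f =>
    let r := if B.twins j then ((0 : EReal), 1)
      else nearest c j [B.tree] (neighborBound c j B.tree)
    let r' := nearestList c B js (Function.update f j r.1)
    (r'.1, r.2 + r'.2 + 1)

/-- `min_{i ≠ j} d(c_i, c_j)` for every `j` (`⊤` if there is only one centroid): build a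
  cover tree on the centroids and search it for every centroid. -/
def allNearest [NeZero k] (c : Fin k → Pt d) : (Fin k → EReal) × ℕ :=
  let b := buildTree c
  let r := nearestList c b.1 (List.finRange k) fun _ => ⊤
  (r.1, b.2 + r.2)

end Build

/-! ### The data kept by dual-tree `k`-means -/

/-- Names of the nodes of the query tree. -/
abbrev Key (N : ℕ) := Fin N × WithBot ℤ

/-- The bounds and marks of the nodes and the points. -/
structure State (N k : ℕ) where
  /-- for a node: upper bound for the distance of its descendant points to their nearest
    centroids -/
  ub : Key N → EReal
  /-- for a node: lower bound for the distance of its descendant points to pruned centroids -/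
  lb : Key N → EReal
  /-- for a node: number of pruned centroids -/
  pruned : Key N → ℕ
  /-- for a node: a centroid, which owns all descendant points if all others are pruned -/
  closest : Key N → Option (Fin k)
  /-- for a node: can an owner of a descendant point change -/
  canchange : Key N → Bool
  /-- for a node: has it been visited by the current traversal -/
  visited : Key N → Bool
  /-- for a point: upper bound for the distance to the nearest centroid -/
  pub : Fin N → EReal
  /-- for a point: lower bound for the distance to the second nearest centroid -/
  plb : Fin N → EReal
  /-- for a point: the nearest centroid met so far -/
  pclosest : Fin N → Option (Fin k)
  /-- for a point: can its owner change -/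
  pcanchange : Fin N → Bool

/-- The values `ub` of the nodes are what they stand for: upper bounds for the distance
  of every descendant point to its nearest centroid. -/
def UpperBoundsValid {d N k : ℕ} (x : Fin N → Pt d) (c : Fin k → Pt d) (T : CTree (Fin N))
    (σ : State N k) : Prop :=
  ∀ t ∈ T.subtrees, ∀ p ∈ t.leaves, ∃ j, ((dist (x p) (c j) : ℝ) : EReal) ≤ σ.ub t.key

section Iteration

variable {d N k : ℕ}

/-! ### Coalescing the tree -/

mutual
/-- Coalesce the tree below a node that is not the root: remove the nodes that cannot change;
  if only one child is left, it takes the place of the node. -/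
def coalesce (σ : State N k) : CTree (Fin N) → CTree (Fin N) × ℕ
  | leaf p => (leaf p, 1)
  | node p s cs =>
    let r := coalesceList σ cs
    match r.1 with
    | [t] => (t, r.2 + 1)
    | ts => (node p s ts, r.2 + 1)
/-- Coalesce a list of siblings. -/
def coalesceList (σ : State N k) : List (CTree (Fin N)) → List (CTree (Fin N)) × ℕ
  | [] => ([], 0)
  | t :: ts =>
    let r' := coalesceList σ ts
    if σ.canchange t.key = false then (r'.1, r'.2 + 1)
    else
      let r := coalesce σ t
      (r.1 :: r'.1, r.2 + r'.2 + 1)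
end

/-- Coalesce a tree; the root stays. -/
def coalesceTree (σ : State N k) : CTree (Fin N) → CTree (Fin N) × ℕ
  | leaf p => (leaf p, 1)
  | node p s cs =>
    let r := coalesceList σ cs
    (node p s r.1, r.2 + 1)

/-! ### The dual-tree pass -/

/-- Smallest possible distance between points below `tq` and centroids below `tr`. -/
def dMin (x : Fin N → Pt d) (c : Fin k → Pt d) (tq : CTree (Fin N)) (tr : CTree (Fin k)) : ℝ :=
  max 0 (dist (x tq.pt) (c tr.pt) - tq.radius - tr.radius)

/-- Largest possible distance between points below `tq` and the centroid `j`. -/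
def dMax (x : Fin N → Pt d) (c : Fin k → Pt d) (tq : CTree (Fin N)) (j : Fin k) : ℝ :=
  dist (x tq.pt) (c j) + tq.radius

/-- The point-to-point function. -/
def baseCase (x : Fin N → Pt d) (c : Fin k → Pt d) (p : Fin N) (j : Fin k) (σ : State N k) :
    State N k :=
  let D : EReal := ((dist (x p) (c j) : ℝ) : EReal)
  if D < σ.pub p then
    { σ with
      plb := Function.update σ.plb p (σ.pub p)
      pub := Function.update σ.pub p D
      pclosest := Function.update σ.pclosest p (some j) }
  else if D < σ.plb p then { σ with plb := Function.update σ.plb p D }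
  else σ

/-- The first part of the node-to-node function: on its first visit, a node that is not the
  root takes over the number of pruned centroids and the lower bound of its parent. -/
def inherit (par : Option (Key N)) (tq : CTree (Fin N)) (σ : State N k) : State N k :=
  if σ.visited tq.key then σ
  else
    match par with
    | none => { σ with visited := Function.update σ.visited tq.key true }
    | some a =>
      { σ with
        visited := Function.update σ.visited tq.key true
        pruned := Function.update σ.pruned tq.key (σ.pruned a)
        lb := Function.update σ.lb tq.key (σ.lb a) }

/-- The node-to-node function; `⊤` means that the combination is pruned.  Its descendant
  centroid of `tr` is the one held by `tr`.  In the traversal below, the reference nodes that are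
  handled together have disjoint descendants and a pruned node never comes back, so that all
  `tr.leaves.length` centroids of a pruned node are newly pruned (the number of descendants of a node
  is stored when a tree is built). -/
def score (x : Fin N → Pt d) (c : Fin k → Pt d) (par : Option (Key N)) (tq : CTree (Fin N))
    (tr : CTree (Fin k)) (σ₀ : State N k) : EReal × State N k :=
  let σ := inherit par tq σ₀
  if σ.pruned tq.key + 1 = k then (⊤, σ)
  else
    let m : EReal := ((dMin x c tq tr : ℝ) : EReal)
    if σ.ub tq.key < m then
      (⊤, { σ with
        lb := Function.update σ.lb tq.key (min (σ.lb tq.key) m)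
        pruned := Function.update σ.pruned tq.key (σ.pruned tq.key + tr.leaves.length) })
    else if ((dMax x c tq tr.pt : ℝ) : EReal) < σ.ub tq.key then
      (m, { σ with
        ub := Function.update σ.ub tq.key ((dMax x c tq tr.pt : ℝ) : EReal)
        closest := Function.update σ.closest tq.key (some tr.pt) })
    else (m, σ)

/-- What one round of visits returns: the surviving reference nodes, the state, the time. -/
structure Visited (N k : ℕ) where
  kept : List (CTree (Fin k))
  state : State N k
  time : ℕ

/-- Visit the combinations of `tq` with a list of reference nodes: call the
  node-to-node function for each, and the point-to-point function for those not pruned. -/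
def visit (x : Fin N → Pt d) (c : Fin k → Pt d) (par : Option (Key N)) (tq : CTree (Fin N)) :
    List (CTree (Fin k)) → State N k → Visited N k
  | [], σ => { kept := [], state := σ, time := 0 }
  | tr :: trs, σ =>
    let r := score x c par tq tr σ
    if r.1 = ⊤ then
      let v := visit x c par tq trs r.2
      { kept := v.kept, state := v.state, time := v.time + 1 }
    else
      let v := visit x c par tq trs (baseCase x c tq.pt tr.pt r.2)
      { kept := tr :: v.kept, state := v.state, time := v.time + 2 }

theorem numNodesList_visit_le (x : Fin N → Pt d) (c : Fin k → Pt d) (par : Option (Key N))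
    (tq : CTree (Fin N)) (R : List (CTree (Fin k))) (σ : State N k) :
    numNodesList (visit x c par tq R σ).kept ≤ numNodesList R := by
  induction R generalizing σ with
  | nil => simp [visit]
  | cons t ts ih =>
    unfold visit
    simp only
    split_ifs
    · exact (ih _).trans (by simp [numNodesList])
    · simp only [numNodesList]
      exact Nat.add_le_add_left (ih _) _

mutual
/-- The standard pruning dual-tree traversal for cover trees, with a query node `tq` and a
  set `R` of reference nodes: a reference recursion while `R` contains a node of larger scale than
  `tq`, and a query recursion otherwise. -/
def traverse (x : Fin N → Pt d) (c : Fin k → Pt d) (par : Option (Key N)) (tq : CTree (Fin N))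
    (R : List (CTree (Fin k))) (σ : State N k) : State N k × ℕ :=
  if R.isEmpty then (σ, 1)
  else if _h : tq.scale < maxScale R then
    let E := expand (maxScale R) R
    let v := visit x c par tq E σ
    let r := traverse x c par tq v.kept v.state
    (r.1, r.2 + v.time + R.length + E.length + 1)
  else
    match tq with
    | leaf _ => (σ, R.length + 1)
    | node p s cs =>
      let r := traverseList x c (p, (s : WithBot ℤ)) cs R σ
      (r.1, r.2 + R.length + 1)
termination_by (sizeOf tq, numNodesList R)
decreasing_by
  · apply Prod.Lex.right
    exact lt_of_le_of_lt (numNodesList_visit_le _ _ _ _ _ _)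
      (numNodesList_expand_lt R (ne_bot_of_gt _h))
  · apply Prod.Lex.left
    simp
/-- The query recursion, over the children of a query node. -/
def traverseList (x : Fin N → Pt d) (c : Fin k → Pt d) (par : Key N) :
    List (CTree (Fin N)) → List (CTree (Fin k)) → State N k → State N k × ℕ
  | [], _, σ => (σ, 0)
  | tq :: tqs, R, σ =>
    let v := visit x c (some par) tq R σ
    let r := traverse x c (some par) tq v.kept v.state
    let r' := traverseList x c par tqs R r.1
    (r'.1, v.time + r.2 + r'.2 + 1)
termination_by tqs => (sizeOf tqs, 0)
decreasing_by
  · apply Prod.Lex.left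
    simp; omega
  · apply Prod.Lex.left
    simp
end

/-- The dual-tree pass on a query tree and a reference tree. -/
def dualTree (x : Fin N → Pt d) (c : Fin k → Pt d) (T : CTree (Fin N)) (Tc : CTree (Fin k))
    (σ : State N k) : State N k × ℕ :=
  let v := visit x c none T [Tc] { σ with visited := fun _ => false }
  let r := traverse x c none T v.kept v.state
  (r.1, r.2 + v.time + T.numNodes)

/-! ### Updating the centroids -/

/-- Sums and numbers of the points owned by the centroids. -/
structure Sums (d k : ℕ) where
  sum : Fin k → Pt d
  num : Fin k → ℕ

/-- Add `n` points with sum `v` to those owned by `o`. -/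
def Sums.add (S : Sums d k) (o : Option (Fin k)) (v : Pt d) (n : ℕ) : Sums d k :=
  match o with
  | none => S
  | some j =>
    { sum := Function.update S.sum j (S.sum j + v)
      num := Function.update S.num j (S.num j + n) }

mutual
/-- Sum up the points below a node by their owners; a node that is owned by one
  centroid is not descended into (the sum of the descendant points of a node and their number
  are stored when the tree is built). -/
def gather (x : Fin N → Pt d) (σ : State N k) : CTree (Fin N) → Sums d k → Sums d k × ℕ
  | leaf p, S =>
    if σ.pruned (p, ⊥) + 1 = k then (S.add (σ.closest (p, ⊥)) (x p) 1, 1)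
    else (S.add (σ.pclosest p) (x p) 1, 1)
  | node p s cs, S =>
    if σ.pruned (p, (s : WithBot ℤ)) + 1 = k then
      (S.add (σ.closest (p, (s : WithBot ℤ)))
        (((node p s cs).leaves.map x).sum) (node p s cs).leaves.length, 1)
    else
      let r := gatherList x σ cs S
      (r.1, r.2 + 1)
/-- Sum up the points below a list of siblings. -/
def gatherList (x : Fin N → Pt d) (σ : State N k) :
    List (CTree (Fin N)) → Sums d k → Sums d k × ℕ
  | [], S => (S, 0)
  | t :: ts, S =>
    let r := gather x σ t S
    let r' := gatherList x σ ts r.1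
    (r'.1, r.2 + r'.2 + 1)
end

/-- The new centroids: the means of the points owned by the old ones. -/
def updateCentroids (x : Fin N → Pt d) (T : CTree (Fin N)) (σ : State N k) :
    (Fin k → Pt d) × ℕ :=
  let r := gather x σ T { sum := fun _ => 0, num := fun _ => 0 }
  (fun j => if 0 < r.1.num j then ((r.1.num j : ℝ)⁻¹) • r.1.sum j else r.1.sum j,
    r.2 + 2 * k)

/-! ### Updating the bounds -/

/-- What the update of the bounds uses: the new centroids, how far each centroid has moved, the
  largest of these distances, and half the distance to the nearest other centroid. -/
structure Moves (d k : ℕ) where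
  cen : Fin k → Pt d
  mov : Fin k → ℝ
  maxMov : ℝ
  half : Fin k → EReal

/-- The movement of the centroid `o`. -/
def Moves.of (M : Moves d k) : Option (Fin k) → EReal
  | none => ((M.maxMov : ℝ) : EReal)
  | some j => ((M.mov j : ℝ) : EReal)

/-- Half the distance from `o` to the nearest other centroid. -/
def Moves.halfOf (M : Moves d k) : Option (Fin k) → EReal
  | none => ⊥
  | some j => M.half j

/-- Updating a node, before its children. -/
def updatePre (x : Fin N → Pt d) (M : Moves d k) (par : Option (Key N)) (t : CTree (Fin N))
    (σ : State N k) : State N k :=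
  let a := t.key
  let big : EReal := ((M.maxMov : ℝ) : EReal)
  if ∃ b ∈ par, σ.canchange b = false then
    let o := par.bind σ.closest
    { σ with
      closest := Function.update σ.closest a o
      ub := Function.update σ.ub a (σ.ub a + M.of o)
      lb := Function.update σ.lb a (σ.lb a - big)
      canchange := Function.update σ.canchange a false }
  else if σ.pruned a + 1 = k then
    let o := σ.closest a
    let u := σ.ub a + M.of o
    let l := max (σ.lb a - big) (M.halfOf o)
    if u < l then
      { σ with
        ub := Function.update σ.ub a u
        lb := Function.update σ.lb a l
        canchange := Function.update σ.canchange a false }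
    else
      let u' := match o with
        | none => u
        | some j => min u ((dMax x M.cen t j : ℝ) : EReal)
      { σ with
        ub := Function.update σ.ub a u'
        lb := Function.update σ.lb a l
        canchange := Function.update σ.canchange a (decide (¬ u' < l)) }
  else
    { σ with
      ub := Function.update σ.ub a (σ.ub a + M.of (σ.closest a))
      lb := Function.update σ.lb a (σ.lb a - big)
      canchange := Function.update σ.canchange a true }

/-- Updating a point that is held by a node whose owners can change. -/
def updatePoint (x : Fin N → Pt d) (M : Moves d k) (p : Fin N) (σ : State N k) : State N k :=
  let o := σ.pclosest p
  let u := σ.pub p + M.of o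
  let l := min (σ.plb p - ((M.maxMov : ℝ) : EReal)) (M.halfOf o)
  if u < l then
    { σ with
      pub := Function.update σ.pub p u
      plb := Function.update σ.plb p l
      pcanchange := Function.update σ.pcanchange p false }
  else
    let u' := match o with
      | none => u
      | some j => min u ((dist (x p) (M.cen j) : ℝ) : EReal)
    if u' < l then
      { σ with
        pub := Function.update σ.pub p u'
        plb := Function.update σ.plb p l
        pcanchange := Function.update σ.pcanchange p false }
    else
      { σ with
        pub := Function.update σ.pub p ⊤
        plb := Function.update σ.plb p ⊤ }

/-- Updating a node, and its point, after its children. -/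
def updatePost (x : Fin N → Pt d) (M : Moves d k) (t : CTree (Fin N)) (σ₀ : State N k) :
    State N k :=
  let a := t.key
  let p := t.pt
  let σ :=
    if σ₀.canchange a then updatePoint x M p σ₀
    else if σ₀.pcanchange p = false then
      { σ₀ with
        pub := Function.update σ₀.pub p (σ₀.pub p + M.of (σ₀.pclosest p))
        plb := Function.update σ₀.plb p (σ₀.plb p - ((M.maxMov : ℝ) : EReal)) }
    else σ₀
  let can : Bool := σ.canchange a &&
    ((t.children.any fun ch => σ.canchange ch.key) || σ.pcanchange p)
  { σ with
    canchange := Function.update σ.canchange a can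
    pruned := if can then Function.update σ.pruned a 0 else σ.pruned }

mutual
/-- Update the bounds of a node, of everything below it, and of the points held there. -/
def updateBounds (x : Fin N → Pt d) (M : Moves d k) (par : Option (Key N)) :
    CTree (Fin N) → State N k → State N k × ℕ
  | leaf p, σ => (updatePost x M (leaf p) (updatePre x M par (leaf p) σ), 2)
  | node p s cs, σ =>
    let r := updateBoundsList x M (some (p, (s : WithBot ℤ))) cs
      (updatePre x M par (node p s cs) σ)
    (updatePost x M (node p s cs) r.1, r.2 + cs.length + 2)
/-- Update the bounds below a list of siblings. -/
def updateBoundsList (x : Fin N → Pt d) (M : Moves d k) (par : Option (Key N)) :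
    List (CTree (Fin N)) → State N k → State N k × ℕ
  | [], σ => (σ, 0)
  | t :: ts, σ =>
    let r := updateBounds x M par t σ
    let r' := updateBoundsList x M par ts r.1
    (r'.1, r.2 + r'.2 + 1)
end

/-- Update the tree, after the centroids have changed from `c` to `c'`. -/
def updateTree [NeZero k] (x : Fin N → Pt d) (T : CTree (Fin N)) (c c' : Fin k → Pt d)
    (σ : State N k) : State N k × ℕ :=
  let nn := allNearest c'
  let M : Moves d k :=
    { cen := c'
      mov := fun j => dist (c' j) (c j)
      maxMov := ⨆ j, dist (c' j) (c j)
      half := fun j => nn.1 j / 2 }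
  let r := updateBounds x M none T σ
  (r.1, nn.2 + 3 * k + r.2)

/-! ### One iteration -/

/-- The outcome of an iteration. -/
structure Outcome (d N k : ℕ) where
  /-- the new centroids -/
  cen : Fin k → Pt d
  /-- the new bounds and marks -/
  state : State N k
  /-- the running time -/
  time : ℕ

/-- One iteration of dual-tree `k`-means on the data `x` with the tree `T`, from the centroids
  `c` and the bounds and marks `σ`.  Coalescing works on a copy of the tree, and
  restoring the original tree is charged for all its nodes. -/
def iteration [NeZero k] (x : Fin N → Pt d) (T : CTree (Fin N)) (c : Fin k → Pt d)
    (σ : State N k) : Outcome d N k :=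
  let small := coalesceTree σ T
  let ctree := buildTree c
  let pass := dualTree x c small.1 ctree.1.tree σ
  let cen := updateCentroids x T pass.1
  let upd := updateTree x T c cen.1 pass.1
  { cen := cen.1
    state := upd.1
    time := (T.numNodes + small.2) + ctree.2 + pass.2 + T.numNodes + cen.2 + upd.2 }

end Iteration

end DualTree

end

namespace DualTree

namespace CTree

variable {α : Type}

/-! ### Structural facts about trees -/

-- Outside the dual-tree pass and the work on trees of centroids, every phase is linear in the
-- number of nodes of the query tree, plus `O(k)`. As each internal node branches, there are fewer
-- than `2N` nodes (`Loc.numNodes_le`).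
--
-- Trees of centroids. Points on one level are separated, so doubling bounds how many of them lie
-- near a given point (`Doubling.card_le`). The depth is the real issue, since scales may be spread
-- arbitrarily. But a scale `s` on which `p` sees another centroid at distance about `2 ^ s` makes
-- the balls around `p` grow by a factor `1 + e⁻²` (`Doubling.growth`), so there are only `O(e² log
-- k)` such scales (`Doubling.card_scales_le`). With `e⁵` nodes per scale, an insertion costs `O(e⁷
-- log k)` (`nearLinks_le`). A round of a nearest-neighbour search costs `O(e⁷)`. Rounds on scales
-- that are not small against the nearest-neighbour distance `δ` are counted by these scales, the
-- others by internal nodes in the ball of radius `3δ`, which holds at most `e²` centroids. This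
-- gives `O(e⁹ log k)` per centroid (`nearest_time`).
--
-- Dual-tree pass. Write `e`, `e'` for `c_k`, `c_qk`. Either a query node counts as decided, and
-- then nothing is kept for it, or its reference set still holds the nearest centroid of each of its
-- descendant points (`visit_spec`). The argument uses that the bounds `ub` are valid; it never
-- needs the pruning counters to be right. In the second case all nodes kept at scale `s` lie within
-- `δ + 5 * 2 ^ s` of the query point, where `δ` is its distance to the nearest centroid
-- (`Ready.near_kept`). There are `O(e' ^ 5)` of them (`length_le_of_near`), and one reference
-- recursion costs `O(e ^ 4 * e' ^ 5)`.
--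
-- The number of reference recursions is bounded by potentials (`StepBound`). At an internal query
-- node they run between its scale and that of its parent, so its imbalance pays. At a leaf they may
-- go to the bottom of the reference tree, and three regimes occur (`stepBound_amortized`). Scales
-- comparable with `δ` are at most five. On scales far below `δ` the set has at most `e'` nodes, and
-- each recursion expands one of at most `e' ^ 2` internal nodes close to the point. On scales above
-- `δ` the imbalance of the leaf pays down to a few levels below the smallest scale of the query
-- tree. Below that, a recursion costs only `O(e ^ 9)` and is charged to an internal reference node
-- very close to the data point. Data points are too far apart for two of them to charge the same
-- node, so all leaves together make at most `k - 1` such charges (`sum_closeCount_le`). The root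
-- charges its own large scales to all internal reference nodes.
--
-- Coalescing does not increase the sum of the costs of the links: a link replacing two consecutive
-- ones costs no more than both (`linkCost_le`). Remaining terms of order `k` are absorbed by `k - 1
-- ≤ k * log k` and `1 ≤ N`.

theorem induct {P : CTree α → Prop} (leaf : ∀ p, P (leaf p))
    (node : ∀ p s cs, (∀ t ∈ cs, P t) → P (node p s cs)) (t : CTree α) : P t :=
  CTree.rec (motive_1 := P) (motive_2 := fun l => ∀ t ∈ l, P t) leaf node
    (by simp) (fun _ _ h1 h2 t ht => by
      rcases List.mem_cons.1 ht with rfl | ht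
      · exact h1
      · exact h2 t ht) t

theorem subtreesList_eq (l : List (CTree α)) : subtreesList l = l.flatMap subtrees := by
  induction l with
  | nil => rfl
  | cons t ts ih => simp [subtreesList, ih]

theorem leavesList_eq (l : List (CTree α)) : leavesList l = l.flatMap leaves := by
  induction l with
  | nil => rfl
  | cons t ts ih => simp [leavesList, ih]

theorem linksList_eq (s : ℤ) (l : List (CTree α)) :
    linksList s l = l.flatMap fun t => (s, t) :: links t := by
  induction l with
  | nil => rfl
  | cons t ts ih => simp [linksList, ih]

theorem numNodesList_eq (l : List (CTree α)) : numNodesList l = (l.map numNodes).sum := by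
  induction l with
  | nil => rfl
  | cons t ts ih => simp [numNodesList, ih]

@[simp] theorem subtrees_leaf (p : α) : (leaf p).subtrees = [leaf p] := rfl

@[simp] theorem subtrees_node (p : α) (s : ℤ) (cs : List (CTree α)) :
    (node p s cs).subtrees = node p s cs :: cs.flatMap subtrees := by
  rw [subtrees, subtreesList_eq]

@[simp] theorem leaves_leaf (p : α) : (leaf p).leaves = [p] := rfl

@[simp] theorem leaves_node (p : α) (s : ℤ) (cs : List (CTree α)) :
    (node p s cs).leaves = cs.flatMap leaves := by
  rw [leaves, leavesList_eq]

@[simp] theorem links_leaf (p : α) : (leaf p).links = [] := rfl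

@[simp] theorem links_node (p : α) (s : ℤ) (cs : List (CTree α)) :
    (node p s cs).links = cs.flatMap fun t => (s, t) :: links t := by
  rw [links, linksList_eq]

@[simp] theorem numNodes_leaf (p : α) : (leaf p).numNodes = 1 := rfl

@[simp] theorem numNodes_node (p : α) (s : ℤ) (cs : List (CTree α)) :
    (node p s cs).numNodes = 1 + (cs.map numNodes).sum := by
  rw [numNodes, numNodesList_eq]

@[simp] theorem pt_leaf (p : α) : (leaf p).pt = p := rfl
@[simp] theorem pt_node (p : α) (s : ℤ) (cs : List (CTree α)) : (node p s cs).pt = p := rfl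
@[simp] theorem scale_leaf (p : α) : (leaf p).scale = ⊥ := rfl
@[simp] theorem scale_node (p : α) (s : ℤ) (cs : List (CTree α)) :
    (node p s cs).scale = (s : WithBot ℤ) := rfl
@[simp] theorem children_leaf (p : α) : (leaf p).children = [] := rfl
@[simp] theorem children_node (p : α) (s : ℤ) (cs : List (CTree α)) :
    (node p s cs).children = cs := rfl
@[simp] theorem radius_leaf (p : α) : (leaf p).radius = 0 := rfl
@[simp] theorem radius_node (p : α) (s : ℤ) (cs : List (CTree α)) :
    (node p s cs).radius = (2 : ℝ) ^ (s + 1) := rfl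

theorem self_mem_subtrees (t : CTree α) : t ∈ t.subtrees := by
  cases t <;> simp

theorem subtrees_trans {T t u : CTree α} (ht : t ∈ T.subtrees) (hu : u ∈ t.subtrees) :
    u ∈ T.subtrees := by
  induction T using induct with
  | leaf p =>
    simp only [subtrees_leaf, List.mem_singleton] at ht
    subst ht; exact hu
  | node p s cs ih =>
    simp only [subtrees_node, List.mem_cons, List.mem_flatMap] at ht
    rcases ht with rfl | ⟨v, hv, ht⟩
    · exact hu
    · simp only [subtrees_node, List.mem_cons, List.mem_flatMap]
      exact Or.inr ⟨v, hv, ih v hv ht⟩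

theorem child_mem_subtrees {T t : CTree α} {p : α} {s : ℤ} {cs : List (CTree α)}
    (h : node p s cs ∈ T.subtrees) (ht : t ∈ cs) : t ∈ T.subtrees :=
  subtrees_trans h (by
    simp only [subtrees_node, List.mem_cons, List.mem_flatMap]
    exact Or.inr ⟨t, ht, self_mem_subtrees t⟩)

theorem mem_links {T : CTree α} {l : ℤ × CTree α} :
    l ∈ T.links ↔ ∃ p cs, node p l.1 cs ∈ T.subtrees ∧ l.2 ∈ cs := by
  induction T using induct with
  | leaf p => simp
  | node p s cs ih =>
    simp only [links_node, List.mem_flatMap, List.mem_cons, subtrees_node]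
    constructor
    · rintro ⟨t, ht, rfl | h⟩
      · exact ⟨p, cs, Or.inl rfl, ht⟩
      · obtain ⟨q, ds, h1, h2⟩ := (ih t ht).1 h
        exact ⟨q, ds, Or.inr ⟨t, ht, h1⟩, h2⟩
    · rintro ⟨q, ds, h | ⟨t, ht, h1⟩, h2⟩
      · injection h with h3 h4 h5
        subst h5
        exact ⟨l.2, h2, Or.inl (by rw [← h4])⟩
      · exact ⟨t, ht, Or.inr ((ih t ht).2 ⟨q, ds, h1, h2⟩)⟩

theorem leaves_subset {T t : CTree α} (ht : t ∈ T.subtrees) : t.leaves ⊆ T.leaves := by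
  induction T using induct with
  | leaf p =>
    simp only [subtrees_leaf, List.mem_singleton] at ht
    subst ht; exact fun _ h => h
  | node p s cs ih =>
    simp only [subtrees_node, List.mem_cons, List.mem_flatMap] at ht
    rcases ht with rfl | ⟨v, hv, ht⟩
    · exact fun _ h => h
    · intro q hq
      simp only [leaves_node, List.mem_flatMap]
      exact ⟨v, hv, ih v hv ht hq⟩

theorem leaves_nodup_of_mem {T t : CTree α} (ht : t ∈ T.subtrees) (h : T.leaves.Nodup) :
    t.leaves.Nodup := by
  induction T using induct with
  | leaf p =>
    simp only [subtrees_leaf, List.mem_singleton] at ht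
    subst ht; exact h
  | node p s cs ih =>
    simp only [subtrees_node, List.mem_cons, List.mem_flatMap] at ht
    rcases ht with rfl | ⟨v, hv, ht⟩
    · exact h
    · exact ih v hv ht ((List.nodup_flatMap.1 (by simpa using h)).1 v hv)

theorem numNodes_eq_links (t : CTree α) : t.numNodes = t.links.length + 1 := by
  induction t using induct with
  | leaf p => simp
  | node p s cs ih =>
    simp only [numNodes_node, links_node, List.length_flatMap, List.length_cons]
    rw [List.map_congr_left ih, add_comm]

/-- The part of the cover tree conditions that concerns single nodes. -/
inductive Loc {d : ℕ} (x : α → Pt d) : CTree α → Prop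
  | leaf (p : α) : Loc x (leaf p)
  | node (p : α) (s : ℤ) (cs : List (CTree α)) (nesting : ∃ t ∈ cs, t.pt = p)
      (two_le : 2 ≤ cs.length) (scale_lt : ∀ t ∈ cs, t.scale < (s : WithBot ℤ))
      (covering : ∀ t ∈ cs, dist (x t.pt) (x p) ≤ (2 : ℝ) ^ s) (sub : ∀ t ∈ cs, Loc x t) :
      Loc x (node p s cs)

-- Consequences of the local cover tree conditions.

section Loc

variable {d : ℕ} {x : α → Pt d}

theorem Loc.nesting {p : α} {s : ℤ} {cs : List (CTree α)} (h : Loc x (.node p s cs)) :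
    ∃ t ∈ cs, t.pt = p := by cases h; assumption

theorem Loc.two_le {p : α} {s : ℤ} {cs : List (CTree α)} (h : Loc x (.node p s cs)) :
    2 ≤ cs.length := by cases h; assumption

theorem Loc.scale_lt {p : α} {s : ℤ} {cs : List (CTree α)} (h : Loc x (.node p s cs))
    {t : CTree α} (ht : t ∈ cs) : t.scale < (s : WithBot ℤ) := by cases h; simp_all

theorem Loc.covering {p : α} {s : ℤ} {cs : List (CTree α)} (h : Loc x (.node p s cs))
    {t : CTree α} (ht : t ∈ cs) : dist (x t.pt) (x p) ≤ (2 : ℝ) ^ s := by cases h; simp_all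

theorem Loc.child {p : α} {s : ℤ} {cs : List (CTree α)} (h : Loc x (.node p s cs))
    {t : CTree α} (ht : t ∈ cs) : Loc x t := by cases h; simp_all

theorem Loc.of_mem {T t : CTree α} (h : Loc x T) (ht : t ∈ T.subtrees) : Loc x t := by
  induction T using induct with
  | leaf p =>
    simp only [subtrees_leaf, List.mem_singleton] at ht
    subst ht; exact h
  | node p s cs ih =>
    simp only [subtrees_node, List.mem_cons, List.mem_flatMap] at ht
    rcases ht with rfl | ⟨v, hv, ht⟩
    · exact h
    · exact ih v hv (h.child hv) ht

theorem Loc.pt_mem_leaves {t : CTree α} (h : Loc x t) : t.pt ∈ t.leaves := by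
  induction t using induct with
  | leaf p => simp
  | node p s cs ih =>
    obtain ⟨t, ht, htp⟩ := h.nesting
    simp only [leaves_node, List.mem_flatMap, pt_node]
    exact ⟨t, ht, htp ▸ ih t ht (h.child ht)⟩

theorem radius_nonneg (t : CTree α) : 0 ≤ t.radius := by
  cases t <;> simp only [radius_leaf, radius_node] <;> positivity

theorem radius_le_of_lt {t : CTree α} {s : ℤ} (h : t.scale < (s : WithBot ℤ)) :
    t.radius ≤ (2 : ℝ) ^ s := by
  cases t with
  | leaf p => simp only [radius_leaf]; positivity
  | node p z cs =>
    simp only [scale_node, WithBot.coe_lt_coe] at h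
    exact zpow_le_zpow_right₀ (by norm_num) (by omega)

theorem radius_le_of_le {t : CTree α} {s : ℤ} (h : t.scale ≤ (s : WithBot ℤ)) :
    t.radius ≤ (2 : ℝ) ^ (s + 1) := by
  cases t with
  | leaf p => simp only [radius_leaf]; positivity
  | node p z cs =>
    simp only [scale_node, WithBot.coe_le_coe] at h
    exact zpow_le_zpow_right₀ (by norm_num) (by omega)

theorem two_zpow_succ (s : ℤ) : (2 : ℝ) ^ (s + 1) = 2 * 2 ^ s := by
  rw [zpow_add_one₀ (by norm_num), mul_comm]

/-- Geometric series: one link of length at most `2 ^ s`, then a child whose radius is again at most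
`2 ^ s`, because its scale is smaller. -/
theorem Loc.dist_leaf {t : CTree α} (h : Loc x t) {p : α} (hp : p ∈ t.leaves) :
    dist (x p) (x t.pt) ≤ t.radius := by
  induction t using induct with
  | leaf q => simp at hp; simp [hp]
  | node q s cs ih =>
    simp only [leaves_node, List.mem_flatMap] at hp
    obtain ⟨t, ht, hp⟩ := hp
    have h1 := ih t ht (h.child ht) hp
    have h2 := h.covering ht
    have h3 := radius_le_of_lt (h.scale_lt ht)
    have := dist_triangle (x p) (x t.pt) (x q)
    rw [radius_node, two_zpow_succ]
    simp only [pt_node]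
    linarith

/-- Scales along a path are distinct, so the link lengths sum to at most `2 ^ s + ... + 2 ^ l.1`.
The slack `2 ^ l.1` below the radius is what makes the cut-off radius `2 ^ (s + 1)` safe in
searching and grafting. -/
theorem Loc.dist_link {q : α} {s : ℤ} {cs : List (CTree α)} (h : Loc x (.node q s cs))
    {l : ℤ × CTree α} (hl : l ∈ (CTree.node q s cs).links) :
    dist (x l.2.pt) (x q) ≤ (2 : ℝ) ^ (s + 1) - 2 ^ l.1 ∧ l.1 ≤ s := by
  suffices H : ∀ T : CTree α, Loc x T → ∀ q s cs, T = CTree.node q s cs → ∀ l ∈ T.links,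
      dist (x l.2.pt) (x q) ≤ (2 : ℝ) ^ (s + 1) - 2 ^ l.1 ∧ l.1 ≤ s from H _ h _ _ _ rfl l hl
  intro T
  induction T using induct with
  | leaf p => simp
  | node p z ds ih =>
    intro h q s cs heq l hl
    injection heq with h1 h2 h3
    subst h1 h2 h3
    simp only [links_node, List.mem_flatMap, List.mem_cons] at hl
    obtain ⟨t, ht, rfl | hl⟩ := hl
    · have := h.covering ht
      rw [two_zpow_succ]
      exact ⟨by simpa using by linarith, le_rfl⟩
    · cases t with
      | leaf p => simp at hl
      | node a b es =>
        have h1 := ih _ ht (h.child ht) a b es rfl l hl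
        have h2 := h.covering ht
        have h3 := h.scale_lt ht
        simp only [scale_node, WithBot.coe_lt_coe] at h3
        have h4 : (2 : ℝ) ^ (b + 1) ≤ 2 ^ z := zpow_le_zpow_right₀ (by norm_num) (by omega)
        have := dist_triangle (x l.2.pt) (x a) (x p)
        rw [two_zpow_succ z]
        simp only [pt_node] at h2
        exact ⟨by linarith [h1.1], by omega⟩

theorem Loc.numNodes_le {t : CTree α} (h : Loc x t) :
    t.numNodes + 1 ≤ 2 * t.leaves.length := by
  induction t using induct with
  | leaf p => simp
  | node p s cs ih =>
    have h1 : ∀ l : List (CTree α), (∀ t ∈ l, t.numNodes + 1 ≤ 2 * t.leaves.length) →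
        (l.map numNodes).sum + l.length ≤ 2 * (l.flatMap leaves).length := by
      intro l
      induction l with
      | nil => simp
      | cons t ts ih =>
        intro h
        have h1 := ih fun u hu => h u (List.mem_cons_of_mem _ hu)
        have h2 := h t (by simp)
        simp only [List.map_cons, List.sum_cons, List.length_cons, List.flatMap_cons,
          List.length_append]
        omega
    have h2 := h1 cs fun t ht => ih t ht (h.child ht)
    have h3 := h.two_le
    simp only [numNodes_node, leaves_node]
    omega

theorem Loc.scale_lt_of_mem {p : α} {s : ℤ} {cs : List (CTree α)}
    (h : Loc x (.node p s cs)) {t u : CTree α} (ht : t ∈ cs) (hu : u ∈ t.subtrees) :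
    u.scale < (s : WithBot ℤ) := by
  suffices H : ∀ T : CTree α, Loc x T → ∀ u ∈ T.subtrees, u.scale ≤ T.scale from
    (H t (h.child ht) u hu).trans_lt (h.scale_lt ht)
  clear hu ht h
  intro T
  induction T using induct with
  | leaf p => simp
  | node p s cs ih =>
    intro h u hu
    simp only [subtrees_node, List.mem_cons, List.mem_flatMap] at hu
    rcases hu with rfl | ⟨v, hv, hu⟩
    · exact le_rfl
    · exact (ih v hv (h.child hv) u hu).trans (h.scale_lt hv).le

/-- Along a path the scales differ. Off a path the points differ, since a node's point is one of its
own leaves and siblings have disjoint leaves. -/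
theorem Loc.keys_nodup {t : CTree α} (h : Loc x t) (hn : t.leaves.Nodup) :
    (t.subtrees.map key).Nodup := by
  induction t using induct with
  | leaf p => simp
  | node p s cs ih =>
    rw [leaves_node, List.nodup_flatMap] at hn
    rw [subtrees_node, List.map_cons, List.nodup_cons, List.map_flatMap, List.nodup_flatMap]
    refine ⟨?_, fun t ht => ih t ht (h.child ht) (hn.1 t ht), ?_⟩
    · simp only [List.mem_flatMap, List.mem_map, not_exists, not_and]
      intro t ht u hu he
      have h1 := h.scale_lt_of_mem ht hu
      have h2 : u.scale = (s : WithBot ℤ) := congrArg Prod.snd he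
      exact absurd h1 (by simp [h2])
    · refine hn.2.imp_of_mem ?_
      intro a b ha hb hab
      rw [Function.onFun, List.disjoint_left] at hab ⊢
      intro k hk hk'
      obtain ⟨u, hu, rfl⟩ := List.mem_map.1 hk
      obtain ⟨v, hv, he⟩ := List.mem_map.1 hk'
      have h1 : v.pt = u.pt := congrArg Prod.fst he
      refine hab (a := u.pt) (leaves_subset hu ((h.child ha).of_mem hu).pt_mem_leaves) ?_
      rw [← h1]
      exact leaves_subset hv ((h.child hb).of_mem hv).pt_mem_leaves

/-- Every child of an internal node is counted by a point: if the points are counted that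
  satisfy `G`, there are fewer internal nodes all of whose children satisfy `G`. -/
theorem Loc.countP_internal {t : CTree α} (h : Loc x t) (G : α → Bool) :
    t.subtrees.countP (fun u => decide (u.children ≠ []) && u.children.all fun v => G v.pt) +
      (if G t.pt then 1 else 0) ≤ t.leaves.countP G := by
  induction t using induct with
  | leaf p => by_cases hp : G p <;> simp [hp]
  | node p s cs ih =>
    set f : CTree α → Bool :=
      fun u => decide (u.children ≠ []) && u.children.all fun v => G v.pt
    have h1 : ∀ l : List (CTree α), (∀ t ∈ l, t.subtrees.countP f + (if G t.pt then 1 else 0) ≤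
        t.leaves.countP G) → (l.flatMap subtrees).countP f + l.countP (fun t => G t.pt) ≤
        (l.flatMap leaves).countP G := by
      intro l
      induction l with
      | nil => simp
      | cons t ts ih =>
        intro h
        have h1 := ih fun u hu => h u (List.mem_cons_of_mem _ hu)
        have h2 := h t (by simp)
        simp only [List.flatMap_cons, List.countP_append, List.countP_cons]
        omega
    have h2 := h1 cs fun t ht => ih t ht (h.child ht)
    -- If all children satisfy `G`, there are at least two, paying for the node and for its own
    -- point. Otherwise the child with the same point pays for that point.
    have h3 : (if f (CTree.node p s cs) then 1 else 0) + (if G p then 1 else 0) ≤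
        cs.countP (fun t => G t.pt) := by
      by_cases hf : f (CTree.node p s cs)
      · have : cs.countP (fun t => G t.pt) = cs.length := by
          rw [List.countP_eq_length]
          simp only [f, Bool.and_eq_true, List.all_eq_true, children_node] at hf
          exact hf.2
        rw [this]
        have := h.two_le
        split_ifs <;> omega
      · simp only [hf]
        by_cases hp : G p
        · obtain ⟨t, ht, htp⟩ := h.nesting
          have : 0 < cs.countP (fun t => G t.pt) :=
            List.countP_pos_iff.2 ⟨t, ht, by rw [htp]; exact hp⟩
          simp only [hp, if_true]; simp only [Bool.false_eq_true, if_false]; omega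
        · simp [hp]
    rw [subtrees_node, leaves_node, List.countP_cons]
    change _ + (if G p = true then 1 else 0) ≤ _
    omega

end Loc

/-- The cover tree conditions for a tree that does not have to hold all points. -/
structure Cov {d : ℕ} (x : α → Pt d) (T : CTree α) : Prop where
  loc : Loc x T
  nodup : T.leaves.Nodup
  separation : ∀ (i : ℤ) (p q : α), T.OnLevel i p → T.OnLevel i q → p ≠ q →
    (2 : ℝ) ^ i < dist (x p) (x q)

theorem IsCoverTree.cov {d : ℕ} {x : α → Pt d} {T : CTree α} (h : T.IsCoverTree x) :
    Cov x T := by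
  refine ⟨?_, h.leaves_nodup, h.separation⟩
  have : ∀ t : CTree α, t ∈ T.subtrees → Loc x t := by
    intro t
    induction t using induct with
    | leaf p => exact fun _ => .leaf p
    | node p s cs ih =>
      intro ht
      exact .node p s cs (h.nesting _ _ _ ht) (h.two_le _ _ _ ht)
        (fun t ht' => h.scale_lt (s, t) (mem_links.2 ⟨p, cs, ht, ht'⟩)) (h.covering _ _ _ ht)
        (fun t ht' => ih t ht' (child_mem_subtrees ht ht'))
  exact this T (self_mem_subtrees T)

-- Levels, separation and the scales of internal nodes.

section Cov

variable {d : ℕ} {x : α → Pt d} {T : CTree α}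

/-- The occurrence of a tree as a part of `T` reaches up to level `i`. -/
def Top (T : CTree α) (i : ℤ) (t : CTree α) : Prop :=
  t = T ∨ ∃ sp, (sp, t) ∈ T.links ∧ i < sp

theorem Top.onLevel {i : ℤ} {t : CTree α} (h : Top T i t) : T.OnLevel i t.pt := by
  rcases h with rfl | ⟨sp, h, hi⟩
  · exact Or.inl rfl
  · exact Or.inr ⟨(sp, t), h, rfl, hi⟩

theorem Top.mem {i : ℤ} {t : CTree α} (h : Top T i t) : t ∈ T.subtrees := by
  rcases h with rfl | ⟨sp, h, hi⟩
  · exact self_mem_subtrees _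
  · obtain ⟨p, cs, h1, h2⟩ := mem_links.1 h
    exact child_mem_subtrees h1 h2

theorem Top.mono {i j : ℤ} {t : CTree α} (h : Top T i t) (hj : j ≤ i) : Top T j t := by
  rcases h with rfl | ⟨sp, h, hi⟩
  · exact Or.inl rfl
  · exact Or.inr ⟨sp, h, by omega⟩

theorem OnLevel.mono {i j : ℤ} {p : α} (h : T.OnLevel i p) (hj : j ≤ i) : T.OnLevel j p := by
  rcases h with rfl | ⟨l, h, hp, hi⟩
  · exact Or.inl rfl
  · exact Or.inr ⟨l, h, hp, by omega⟩

theorem OnLevel.mem_leaves (hT : Loc x T) {i : ℤ} {p : α} (h : T.OnLevel i p) :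
    p ∈ T.leaves := by
  rcases h with rfl | ⟨l, h, rfl, hi⟩
  · exact hT.pt_mem_leaves
  · obtain ⟨p, cs, h1, h2⟩ := mem_links.1 h
    have h3 := child_mem_subtrees h1 h2
    exact leaves_subset h3 (hT.of_mem h3).pt_mem_leaves

theorem exists_onLevel {p : α} (h : p ∈ T.leaves) : ∃ i : ℤ, T.OnLevel i p := by
  suffices H : p = T.pt ∨ ∃ l ∈ T.links, l.2.pt = p by
    rcases H with h | ⟨l, hl, hp⟩
    · exact ⟨0, Or.inl h⟩
    · exact ⟨l.1 - 1, Or.inr ⟨l, hl, hp, by omega⟩⟩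
  induction T using induct with
  | leaf q => left; simpa using h
  | node q s cs ih =>
    right
    simp only [leaves_node, List.mem_flatMap] at h
    obtain ⟨t, ht, hp⟩ := h
    simp only [links_node, List.mem_flatMap, List.mem_cons]
    rcases ih t ht hp with h | ⟨l, hl, hlp⟩
    · exact ⟨(s, t), ⟨t, ht, Or.inl rfl⟩, h.symm⟩
    · exact ⟨l, ⟨t, ht, Or.inr hl⟩, hlp⟩

theorem Cov.dist_pos (h : Cov x T) {p q : α} (hp : p ∈ T.leaves) (hq : q ∈ T.leaves)
    (hpq : p ≠ q) : 0 < dist (x p) (x q) := by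
  obtain ⟨i, hi⟩ := exists_onLevel hp
  obtain ⟨j, hj⟩ := exists_onLevel hq
  exact lt_trans (by positivity) (h.separation (min i j) p q (hi.mono (min_le_left _ _))
    (hj.mono (min_le_right _ _)) hpq)

theorem Cov.injOn (h : Cov x T) : Set.InjOn x {p | p ∈ T.leaves} := by
  intro p hp q hq hpq
  by_contra hne
  have := h.dist_pos hp hq hne
  rw [hpq, dist_self] at this
  exact lt_irrefl _ this

theorem Cov.children_pts_nodup (h : Cov x T) {p : α} {s : ℤ} {cs : List (CTree α)}
    (hn : node p s cs ∈ T.subtrees) : (cs.map pt).Nodup := by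
  have h1 := leaves_nodup_of_mem hn h.nodup
  rw [leaves_node, List.nodup_flatMap] at h1
  rw [List.Nodup, List.pairwise_map]
  refine h1.2.imp_of_mem ?_
  intro a b ha hb hab he
  rw [Function.onFun, List.disjoint_left] at hab
  refine hab (a := a.pt) ((h.loc.of_mem (child_mem_subtrees hn ha)).pt_mem_leaves) ?_
  rw [he]
  exact (h.loc.of_mem (child_mem_subtrees hn hb)).pt_mem_leaves

/-- An internal node has a child with its own point and a child with another point. -/
theorem Cov.exists_pair (h : Cov x T) {p : α} {s : ℤ} {cs : List (CTree α)}
    (hn : node p s cs ∈ T.subtrees) :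
    ∃ u ∈ cs, u.pt ≠ p ∧ p ∈ T.leaves ∧ u.pt ∈ T.leaves ∧
      (2 : ℝ) ^ (s - 1) < dist (x u.pt) (x p) ∧ dist (x u.pt) (x p) ≤ 2 ^ s := by
  have hl := h.loc.of_mem hn
  obtain ⟨t, ht, htp⟩ := hl.nesting
  have : ∃ u ∈ cs, u.pt ≠ p := by
    by_contra! hc
    have h1 := h.children_pts_nodup hn
    have h2 : cs.map pt = List.replicate cs.length p := by
      rw [List.eq_replicate_iff]
      refine ⟨by simp, ?_⟩
      intro b hb
      obtain ⟨u, hu, rfl⟩ := List.mem_map.1 hb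
      exact hc u hu
    rw [h2, List.nodup_replicate] at h1
    have := hl.two_le
    omega
  obtain ⟨u, hu, hup⟩ := this
  have hL : ∀ v ∈ cs, T.OnLevel (s - 1) v.pt := fun v hv =>
    Or.inr ⟨(s, v), mem_links.2 ⟨p, cs, hn, hv⟩, rfl, by simp⟩
  refine ⟨u, hu, hup, htp ▸ (hL t ht).mem_leaves h.loc, (hL u hu).mem_leaves h.loc, ?_,
    hl.covering hu⟩
  exact h.separation _ _ _ (hL u hu) (htp ▸ hL t ht) hup

theorem countP_lt_countP {β : Type*} {f g : β → Bool} {l : List β}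
    (h : ∀ a ∈ l, f a → g a) {a : β} (ha : a ∈ l) (hg : g a) (hf : ¬ f a) :
    l.countP f + 1 ≤ l.countP g := by
  induction l with
  | nil => simp at ha
  | cons b l ih =>
    have h1 := h b (by simp)
    have hsub : ∀ a ∈ l, f a → g a := fun a ha => h a (List.mem_cons_of_mem _ ha)
    have h2 := List.countP_mono_left hsub
    rw [List.countP_cons, List.countP_cons]
    rcases List.mem_cons.1 ha with rfl | ha
    · simp only [hf, hg, if_true]; simp; omega
    · have h3 := ih hsub ha
      by_cases hb : f b
      · simp only [hb, h1 hb, if_true]; omega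
      · simp only [hb]; simp; omega

/-- The scales of the internal nodes. -/
def scales (T : CTree α) : Finset ℤ := (T.links.map Prod.fst).toFinset

theorem Loc.mem_scales (h : Loc x T) {p : α} {s : ℤ} {cs : List (CTree α)}
    (hn : CTree.node p s cs ∈ T.subtrees) : s ∈ T.scales := by
  obtain ⟨t, ht, -⟩ := (h.of_mem hn).nesting
  simp only [scales, List.mem_toFinset, List.mem_map]
  exact ⟨(s, t), mem_links.2 ⟨p, cs, hn, ht⟩, rfl⟩

end Cov

end CTree

/-! ### Expansion constants and packing -/

section Packing

variable {d : ℕ}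

/-- The inequality that defines the expansion constant. -/
structure Doubling (S : Finset (Pt d)) (e : ℝ) : Prop where
  two_le : 2 ≤ e
  ball_le : ∀ p ∈ S, ∀ Δ : ℝ, 0 < Δ → (ballCount S p (2 * Δ) : ℝ) ≤ e * ballCount S p Δ

theorem one_le_ballCount {S : Finset (Pt d)} {p : Pt d} (hp : p ∈ S) {r : ℝ} (hr : 0 ≤ r) :
    1 ≤ ballCount S p r :=
  Finset.card_pos.2 ⟨p, by simp [hp, hr]⟩

theorem ballCount_le_card (S : Finset (Pt d)) (p : Pt d) (r : ℝ) : ballCount S p r ≤ S.card :=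
  Finset.card_filter_le _ _

theorem ballCount_mono {S S' : Finset (Pt d)} (hS : S ⊆ S') {p q : Pt d} {r r' : ℝ}
    (h : dist q p + r ≤ r') : ballCount S p r ≤ ballCount S' q r' := by
  refine Finset.card_le_card fun y hy => ?_
  simp only [Finset.mem_filter] at hy ⊢
  exact ⟨hS hy.1, by have := dist_triangle q p y; linarith [hy.2]⟩

/-- The infimum is attained: the admissible set contains `max 2 |S|`, and each condition is a closed
lower bound on `a`, as balls around points of `S` are nonempty. -/
theorem doubling_expansionConstant (S : Finset (Pt d)) : Doubling S (expansionConstant S) := by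
  have hne : {a : ℝ | 2 ≤ a ∧ ∀ p ∈ S, ∀ Δ : ℝ, 0 < Δ →
      (ballCount S p (2 * Δ) : ℝ) ≤ a * (ballCount S p Δ : ℝ)}.Nonempty := by
    refine ⟨max 2 (S.card : ℝ), le_max_left _ _, fun p hp Δ hΔ => ?_⟩
    have h1 : (1 : ℝ) ≤ ballCount S p Δ := by exact_mod_cast one_le_ballCount hp hΔ.le
    have h2 : (ballCount S p (2 * Δ) : ℝ) ≤ S.card := by exact_mod_cast ballCount_le_card _ _ _
    have h3 : (S.card : ℝ) ≤ max 2 (S.card : ℝ) := le_max_right _ _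
    have h4 : (0 : ℝ) ≤ max 2 (S.card : ℝ) := le_max_of_le_left (by norm_num)
    nlinarith
  refine ⟨le_csInf hne fun a ha => ha.1, fun p hp Δ hΔ => ?_⟩
  have h1 : (0 : ℝ) < ballCount S p Δ := by exact_mod_cast one_le_ballCount hp hΔ.le
  rw [← div_le_iff₀ h1]
  exact le_csInf hne fun a ha => (div_le_iff₀ h1).2 (ha.2 p hp Δ hΔ)

variable {S : Finset (Pt d)} {e : ℝ}

theorem Doubling.iterate (h : Doubling S e) {p : Pt d} (hp : p ∈ S) {Δ : ℝ} (hΔ : 0 < Δ)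
    (m : ℕ) : (ballCount S p (2 ^ m * Δ) : ℝ) ≤ e ^ m * ballCount S p Δ := by
  induction m with
  | zero => simp
  | succ m ih =>
    have h1 := h.ball_le p hp (2 ^ m * Δ) (by positivity)
    have h2 : (2 : ℝ) ^ (m + 1) * Δ = 2 * (2 ^ m * Δ) := by ring
    have h3 := h.two_le
    rw [h2, pow_succ]
    nlinarith

/-- The packing bound, for balls that may overlap to some extent. -/
theorem Doubling.card_le_mul (h : Doubling S e) {A : Finset (Pt d)} (hA : A ⊆ S) {r : ℝ}
    (hr : 0 < r) (μ m : ℕ) (hμ : ∀ z ∈ S, (A.filter fun a => dist z a ≤ r).card ≤ μ)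
    (hd : ∀ a ∈ A, ∀ b ∈ A, dist a b + r ≤ 2 ^ m * r) : (A.card : ℝ) ≤ μ * e ^ m := by
  classical
  rcases A.eq_empty_or_nonempty with rfl | hne
  · have := h.two_le
    simp only [Finset.card_empty, Nat.cast_zero]; positivity
  -- Around the centre `a` of the smallest ball, the ball of radius `2 ^ m * r` contains all the
  -- others, and each point of it is covered at most `μ` times. Double counting compares `A.card`
  -- smallest balls with `μ` times this large ball.
  obtain ⟨a, ha, hmin⟩ := A.exists_min_image (fun a => ballCount S a r) hne
  have h1 : A.card * ballCount S a r ≤ ∑ b ∈ A, ballCount S b r := by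
    rw [← smul_eq_mul]; exact Finset.card_nsmul_le_sum _ _ _ hmin
  have h2 : ∑ b ∈ A, ballCount S b r ≤ ballCount S a (2 ^ m * r) * μ := by
    have h3 : ∀ b ∈ A, ballCount S b r =
        ((S.filter fun y => dist a y ≤ 2 ^ m * r).filter fun y => dist b y ≤ r).card := by
      intro b hb
      rw [Finset.filter_filter]
      refine congrArg Finset.card (Finset.filter_congr fun y hy => ?_)
      have := hd a ha b hb
      have h4 := dist_triangle a b y
      constructor
      · intro h5; exact ⟨by linarith, h5⟩
      · exact fun h5 => h5.2
    rw [Finset.sum_congr rfl h3]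
    simp_rw [Finset.card_filter _ (Finset.filter _ S)]
    rw [Finset.sum_comm, ballCount, ← smul_eq_mul]
    refine Finset.sum_le_card_nsmul _ _ _ fun z hz => ?_
    rw [← Finset.card_filter]
    refine le_trans (le_of_eq ?_) (hμ z (Finset.mem_filter.1 hz).1)
    simp_rw [dist_comm z]
  have h5 := h.iterate (hA ha) hr m
  have h6 : (0 : ℝ) < ballCount S a r := by exact_mod_cast one_le_ballCount (hA ha) hr.le
  have h7 : (A.card : ℝ) * ballCount S a r ≤ ballCount S a (2 ^ m * r) * μ := by
    exact_mod_cast h1.trans h2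
  have h8 : (0 : ℝ) ≤ μ := Nat.cast_nonneg μ
  refine le_of_mul_le_mul_right ?_ h6
  nlinarith

/-- Balls of radius `r` around points more than `2 * r` apart are disjoint, so the multiplicity is
one. -/
theorem Doubling.card_le (h : Doubling S e) {A : Finset (Pt d)} (hA : A ⊆ S) {r : ℝ}
    (hr : 0 < r) (m : ℕ) (hs : ∀ a ∈ A, ∀ b ∈ A, a ≠ b → 2 * r < dist a b)
    (hd : ∀ a ∈ A, ∀ b ∈ A, dist a b + r ≤ 2 ^ m * r) : (A.card : ℝ) ≤ e ^ m := by
  have := h.card_le_mul hA hr 1 m (fun z _ => ?_) hd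
  · simpa using this
  · rw [Finset.card_le_one]
    intro a ha b hb
    simp only [Finset.mem_filter] at ha hb
    by_contra hab
    have h1 := hs a ha.1 b hb.1 hab
    have h2 := dist_triangle_left a b z
    linarith [ha.2, hb.2]

/-- In a Euclidean space, a ball of radius `0.7 ρ` holds a bounded number of points with distances
  greater than `ρ`. -/
theorem card_le_of_separated {A : Finset (Pt d)} {ρ : ℝ} (hρ : 0 < ρ) (z : Pt d)
    (hs : ∀ a ∈ A, ∀ b ∈ A, a ≠ b → ρ < dist a b)
    (hz : ∀ a ∈ A, dist z a ≤ 7 / 10 * ρ) : A.card ≤ 50 := by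
  classical
  by_contra! hc
  set n : ℝ := (A.card : ℝ) with hndef
  have hn : (51 : ℝ) ≤ n := by
    have : 51 ≤ A.card := hc
    rw [hndef]; exact_mod_cast this
  -- The identity for the sum of squared mutual distances, with the square of `∑ (a - z)` dropped.
  have h1 : ∑ a ∈ A, ∑ b ∈ A, dist a b ^ 2 ≤ 2 * n * ∑ a ∈ A, ‖a - z‖ ^ 2 := by
    have h2 : ∀ a b : Pt d, dist a b ^ 2 =
        ‖a - z‖ ^ 2 + ‖b - z‖ ^ 2 - 2 * inner ℝ (a - z) (b - z) := by
      intro a b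
      have h3 : a - b = (a - z) - (b - z) := by abel
      rw [dist_eq_norm, h3, norm_sub_sq_real]
      ring
    have h4 : ∑ a ∈ A, ∑ b ∈ A, inner ℝ (a - z) (b - z) = ‖∑ a ∈ A, (a - z)‖ ^ 2 := by
      rw [← real_inner_self_eq_norm_sq, sum_inner]
      exact Finset.sum_congr rfl fun a _ => (inner_sum _ _ _).symm
    simp_rw [h2, Finset.sum_sub_distrib, Finset.sum_add_distrib, ← Finset.mul_sum, h4,
      Finset.sum_const, nsmul_eq_mul, ← Finset.mul_sum]
    have := sq_nonneg ‖∑ a ∈ A, (a - z)‖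
    linarith
  have h5 : ∑ a ∈ A, ‖a - z‖ ^ 2 ≤ n * (7 / 10 * ρ) ^ 2 := by
    rw [← nsmul_eq_mul]
    refine Finset.sum_le_card_nsmul _ _ _ fun a ha => ?_
    have := hz a ha
    rw [dist_comm, dist_eq_norm] at this
    exact pow_le_pow_left₀ (norm_nonneg _) this 2
  have h6 : n * ((n - 1) * ρ ^ 2) ≤ ∑ a ∈ A, ∑ b ∈ A, dist a b ^ 2 := by
    rw [← nsmul_eq_mul]
    refine Finset.card_nsmul_le_sum _ _ _ fun a ha => ?_
    rw [← Finset.sum_erase A (a := a) (by simp)]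
    have h7 : (n - 1) = ((A.erase a).card : ℝ) := by
      rw [Finset.card_erase_of_mem ha, Nat.cast_sub (by omega)]; simp [n]
    rw [h7, ← nsmul_eq_mul]
    refine Finset.card_nsmul_le_sum _ _ _ fun b hb => ?_
    exact pow_le_pow_left₀ hρ.le
      (hs a ha b (Finset.mem_of_mem_erase hb) (Finset.ne_of_mem_erase hb).symm).le 2
  have h8 : 0 < ρ ^ 2 := by positivity
  have h9 : n * ((n - 1) * ρ ^ 2) ≤ 2 * n * (n * (7 / 10 * ρ) ^ 2) :=
    h6.trans (h1.trans (mul_le_mul_of_nonneg_left h5 (by linarith)))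
  -- Here `2 * 0.7² = 0.98 < 1`, so `n - 1 ≤ 0.98 * n` and `n ≤ 50`. Any radius below `ρ / √2` gives
  -- a bound free of the dimension.
  have h10 : n * ρ ^ 2 * (n - 1) ≤ n * ρ ^ 2 * (98 / 100 * n) := by nlinarith
  have h11 := le_of_mul_le_mul_left h10 (by positivity)
  linarith

/-- Packing with radius `0.7 * ρ` in place of `ρ / 2`: the balls overlap at most fifty times, and
the larger radius saves one doubling step where the diameter condition would otherwise just fail. -/
theorem Doubling.card_le_fifty (h : Doubling S e) {A : Finset (Pt d)} (hA : A ⊆ S) {ρ : ℝ}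
    (hρ : 0 < ρ) (m : ℕ) (hs : ∀ a ∈ A, ∀ b ∈ A, a ≠ b → ρ < dist a b)
    (hd : ∀ a ∈ A, ∀ b ∈ A, dist a b + 7 / 10 * ρ ≤ 2 ^ m * (7 / 10 * ρ)) :
    (A.card : ℝ) ≤ 50 * e ^ m := by
  have := h.card_le_mul hA (r := 7 / 10 * ρ) (by positivity) 50 m (fun z _ => ?_) hd
  · simpa using this
  · refine card_le_of_separated hρ z (fun a ha b hb => ?_) fun a ha => (Finset.mem_filter.1 ha).2
    exact hs a (Finset.mem_filter.1 ha).1 b (Finset.mem_filter.1 hb).1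

/-- Balls around a point that is far from the others. -/
theorem Doubling.ballCount_le (h : Doubling S e) {p : Pt d} (hp : p ∈ S) {δ D : ℝ} (m : ℕ)
    (hδ : ∀ y ∈ S, y ≠ p → δ ≤ dist p y) (hD : D < 2 ^ m * δ) :
    (ballCount S p D : ℝ) ≤ e ^ m := by
  have he := h.two_le
  have h1 : ∀ r < δ, ballCount S p r ≤ 1 := by
    intro r hr
    refine Finset.card_le_one.2 fun a ha b hb => ?_
    simp only [Finset.mem_filter] at ha hb
    have h2 : ∀ y ∈ S, dist p y ≤ r → y = p := by
      intro y hy hyr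
      by_contra hne
      linarith [hδ y hy hne]
    rw [h2 a ha.1 ha.2, h2 b hb.1 hb.2]
  have h3 : (1 : ℝ) ≤ e ^ m := one_le_pow₀ (by linarith)
  rcases le_or_gt D 0 with hD0 | hD0
  · have hδ0 : D < δ ∨ δ ≤ D := lt_or_ge _ _
    rcases hδ0 with hlt | hle
    · exact le_trans (by exact_mod_cast h1 D hlt) h3
    · have : (1 : ℝ) ≤ 2 ^ m := one_le_pow₀ (by norm_num)
      nlinarith
  -- After `m` halvings the radius is below `δ`, where the ball contains only `p`.
  · have h4 : D = 2 ^ m * (D / 2 ^ m) := by field_simp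
    have h5 : D / 2 ^ m < δ := by rw [div_lt_iff₀ (by positivity)]; linarith
    have h6 := h.iterate hp (Δ := D / 2 ^ m) (by positivity) m
    rw [← h4] at h6
    have h7 : (ballCount S p (D / 2 ^ m) : ℝ) ≤ 1 := by exact_mod_cast h1 _ h5
    nlinarith

/-- A point at a distance makes balls grow. -/
theorem Doubling.growth (h : Doubling S e) {p z : Pt d} (hz : z ∈ S)
    (hpz : p ≠ z) :
    (1 + (e ^ 2)⁻¹) * ballCount S p (dist p z / 2) ≤ ballCount S p (11 / 8 * dist p z) := by
  classical
  have he := h.two_le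
  set D := dist p z
  have hD : 0 < D := dist_pos.2 hpz
  -- The radius `3/8 * D` is small enough for disjointness from the ball of radius `D / 2` around
  -- `p` (`3/8 + 1/2 < 1`), and large enough that two doublings reach `3/2 * D` and cover that ball.
  have h1 := h.iterate hz (Δ := 3 / 8 * D) (by positivity) 2
  have h2 : ballCount S p (D / 2) ≤ ballCount S z (2 ^ 2 * (3 / 8 * D)) :=
    ballCount_mono (le_refl S) (by rw [dist_comm]; change D + _ ≤ _; linarith)
  have h3 : ballCount S p (D / 2) + ballCount S z (3 / 8 * D) ≤
      ballCount S p (11 / 8 * D) := by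
    unfold ballCount
    rw [← Finset.card_union_of_disjoint]
    · refine Finset.card_le_card fun y hy => ?_
      simp only [Finset.mem_union, Finset.mem_filter] at hy ⊢
      rcases hy with hy | hy
      · exact ⟨hy.1, by linarith [hy.2]⟩
      · refine ⟨hy.1, ?_⟩
        have := dist_triangle p z y
        change dist p y ≤ D + _ at this
        linarith [hy.2]
    · rw [Finset.disjoint_left]
      intro y hy hy'
      simp only [Finset.mem_filter] at hy hy'
      have := dist_triangle_right p z y
      change D ≤ _ at this
      linarith [hy.2, hy'.2]
  have h4 : (ballCount S p (D / 2) : ℝ) ≤ e ^ 2 * ballCount S z (3 / 8 * D) :=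
    le_trans (by exact_mod_cast h2) h1
  have h5 : (e ^ 2)⁻¹ * ballCount S p (D / 2) ≤ (ballCount S z (3 / 8 * D) : ℝ) := by
    rw [inv_mul_le_iff₀ (by positivity)]; exact h4
  have h6 : (ballCount S p (D / 2) : ℝ) + ballCount S z (3 / 8 * D) ≤
      ballCount S p (11 / 8 * D) := by exact_mod_cast h3
  linarith

/-- The increments of a bounded monotone function add up to a bounded number. -/
theorem sum_increments_le {g : ℤ → ℝ} (hg : Monotone g) {L : ℝ} (h0 : ∀ i, 0 ≤ g i)
    (hL : ∀ i, g i ≤ L) (Z : Finset ℤ) : ∑ s ∈ Z, (g (s + 1) - g s) ≤ L := by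
  have hL0 : 0 ≤ L := (h0 0).trans (hL 0)
  rcases Z.eq_empty_or_nonempty with rfl | hne
  · simpa using hL0
  have hsub : ∃ n : ℕ, Z ⊆ (Finset.range n).image fun i : ℕ => Z.min' hne + i := by
    refine ⟨(Z.max' hne - Z.min' hne + 1).toNat, fun s hs => ?_⟩
    have h1 := Z.min'_le s hs
    have h2 := Z.le_max' s hs
    simp only [Finset.mem_image, Finset.mem_range]
    exact ⟨(s - Z.min' hne).toNat, by omega, by omega⟩
  obtain ⟨n, hn⟩ := hsub
  refine (Finset.sum_le_sum_of_subset_of_nonneg hn fun i _ _ => ?_).trans ?_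
  · linarith [hg (show i ≤ i + 1 by omega)]
  · rw [Finset.sum_image (by intro a _ b _ hab; simpa using hab)]
    have := Finset.sum_range_sub (fun i : ℕ => g (Z.min' hne + i)) n
    simp only [Nat.cast_add, Nat.cast_one, ← add_assoc] at this
    rw [this]
    linarith [hL (Z.min' hne + n), h0 (Z.min' hne + (0 : ℕ))]

/-- An increment over a window of length `m` is a sum of `m` unit increments; for each position in
the window these are increments at distinct integers. -/
theorem sum_increments_le' {g : ℤ → ℝ} (hg : Monotone g) {L : ℝ} (h0 : ∀ i, 0 ≤ g i)
    (hL : ∀ i, g i ≤ L) (Z : Finset ℤ) (m : ℕ) :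
    ∀ a : ℤ, ∑ s ∈ Z, (g (s + a + m) - g (s + a)) ≤ m * L := by
  induction m with
  | zero => intro a; simp
  | succ m ih =>
    intro a
    have h1 := ih a
    have h2 : ∑ s ∈ Z, (g (s + a + m + 1) - g (s + a + m)) ≤ L := by
      have := sum_increments_le hg h0 hL (Z.image fun s => s + (a + m))
      rw [Finset.sum_image (by intro a _ b _ hab; simpa using hab)] at this
      simpa only [add_assoc] using this
    have h3 : ∑ s ∈ Z, (g (s + a + (m + 1 : ℕ)) - g (s + a)) =
        ∑ s ∈ Z, (g (s + a + m) - g (s + a)) +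
          ∑ s ∈ Z, (g (s + a + m + 1) - g (s + a + m)) := by
      rw [← Finset.sum_add_distrib]
      refine Finset.sum_congr rfl fun s _ => ?_
      have : s + a + ((m + 1 : ℕ) : ℤ) = s + a + m + 1 := by push_cast; ring
      rw [this]; ring
    rw [h3]; push_cast; linarith

/-- There are few scales on which a point of the set can be seen from `p`. -/
theorem Doubling.card_scales_le (h : Doubling S e) {p : Pt d} (hp : p ∈ S) {n : ℕ}
    (hn : S.card ≤ n) (Z : Finset ℤ)
    (hZ : ∀ s ∈ Z, ∃ z ∈ S, (2 : ℝ) ^ (s - 2) < dist p z ∧ dist p z ≤ 2 ^ (s + 4)) :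
    (Z.card : ℝ) ≤ 16 * e ^ 2 * Real.log n := by
  have he := h.two_le
  set g : ℤ → ℝ := fun s => Real.log (ballCount S p ((2 : ℝ) ^ s))
  have hpos : ∀ s : ℤ, (1 : ℝ) ≤ ballCount S p ((2 : ℝ) ^ s) := fun s => by
    exact_mod_cast one_le_ballCount hp (by positivity)
  have hbm : Monotone fun r : ℝ => ballCount S p r := fun a b hab =>
    ballCount_mono (le_refl S) (by simpa using hab)
  have hg : Monotone g := fun a b hab => by
    refine Real.log_le_log (by linarith [hpos a]) ?_
    exact_mod_cast hbm (zpow_le_zpow_right₀ (by norm_num) hab)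
  have h0 : ∀ i, 0 ≤ g i := fun i => Real.log_nonneg (hpos i)
  have hL : ∀ i, g i ≤ Real.log n := fun i => by
    refine Real.log_le_log (by linarith [hpos i]) ?_
    exact_mod_cast (ballCount_le_card _ _ _).trans hn
  -- The growth happens between the radii `2 ^ (s - 3) ≤ D / 2` and `2 ^ (s + 5) ≥ 11/8 * D`, where
  -- `D = dist p z`: a window of eight scales. It adds at least `log (1 + e⁻²) ≥ 1 / (2 * e²)` to
  -- the logarithm of the ball count, whence the factor `16`.
  have h1 : ∀ s ∈ Z, (2 * e ^ 2)⁻¹ ≤ g (s + (-3) + 8) - g (s + (-3)) := by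
    intro s hs
    obtain ⟨z, hz, hz1, hz2⟩ := hZ s hs
    have hzp : (0 : ℝ) < 2 ^ (s - 2) := by positivity
    have hpz : p ≠ z := by rintro rfl; rw [dist_self] at hz1; linarith
    have h2 := h.growth hz hpz
    have h3 : (2 : ℝ) ^ (s - 2) = 2 * 2 ^ (s + -3) := by
      rw [← CTree.two_zpow_succ]; congr 1; ring
    have h4 : (2 : ℝ) ^ (s + -3 + 8) = 2 * 2 ^ (s + 4) := by
      rw [← CTree.two_zpow_succ]; congr 1; ring
    have h5 : ballCount S p ((2 : ℝ) ^ (s + -3)) ≤ ballCount S p (dist p z / 2) :=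
      hbm (by rw [h3] at hz1; linarith)
    have h6 : ballCount S p (11 / 8 * dist p z) ≤ ballCount S p ((2 : ℝ) ^ (s + -3 + 8)) :=
      hbm (by rw [h4]; have := dist_nonneg (x := p) (y := z); linarith)
    have h7 : (1 + (e ^ 2)⁻¹) * ballCount S p ((2 : ℝ) ^ (s + -3)) ≤
        ballCount S p ((2 : ℝ) ^ (s + -3 + 8)) := by
      refine le_trans (mul_le_mul_of_nonneg_left (by exact_mod_cast h5) (by positivity))
        (h2.trans (by exact_mod_cast h6))
    have h8 : Real.log (1 + (e ^ 2)⁻¹) + g (s + -3) ≤ g (s + -3 + 8) := by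
      rw [← Real.log_mul (by positivity) (by linarith [hpos (s + -3)])]
      refine Real.log_le_log ?_ h7
      have := hpos (s + -3)
      positivity
    have h9 : (2 * e ^ 2)⁻¹ ≤ Real.log (1 + (e ^ 2)⁻¹) := by
      have h10 := Real.one_sub_inv_le_log_of_pos (x := 1 + (e ^ 2)⁻¹) (by positivity)
      refine le_trans ?_ h10
      have h11 : 1 ≤ e ^ 2 := one_le_pow₀ (by linarith)
      have h12 : 1 - (1 + (e ^ 2)⁻¹)⁻¹ = (e ^ 2 + 1)⁻¹ := by
        have : e ^ 2 ≠ 0 := by positivity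
        have : e ^ 2 + 1 ≠ 0 := by positivity
        field_simp; ring
      rw [h12]
      exact inv_anti₀ (by positivity) (by linarith)
    linarith
  have h2 := sum_increments_le' hg h0 hL Z 8 (-3)
  have h3 : Z.card * (2 * e ^ 2)⁻¹ ≤ ∑ s ∈ Z, (g (s + (-3) + 8) - g (s + (-3))) := by
    rw [← nsmul_eq_mul]; exact Finset.card_nsmul_le_sum _ _ _ h1
  have h4 : Z.card * (2 * e ^ 2)⁻¹ ≤ 8 * Real.log n := h3.trans (by exact_mod_cast h2)
  rw [← div_eq_mul_inv, div_le_iff₀ (by positivity)] at h4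
  linarith

end Packing

open CTree

/-! ### Insertion into a cover tree -/

section Insertion

variable {d k : ℕ} {c : Fin k → Pt d} {p q : Fin k}

theorem ceilLog_le_iff {r : ℝ} (hr : 0 < r) {i : ℤ} : ceilLog r ≤ i ↔ r ≤ (2 : ℝ) ^ i := by
  have := Int.le_zpow_iff_clog_le (R := ℝ) (b := 2) one_lt_two (x := i) hr
  simpa [ceilLog] using this.symm

/-- The number of links that a search for the neighbourhood of `p` can meet. -/
noncomputable def nearLinks (c : Fin k → Pt d) (p : Fin k) (t : CTree (Fin k)) : ℕ :=
  t.links.countP fun l => decide (dist (c p) (c l.2.pt) ≤ 3 * 2 ^ l.1)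

/-- When a search enters a node, each child is within `2 ^ (s + 1) + 2 ^ s = 3 * 2 ^ s` of `p`, so
every link looked at is counted. -/
theorem nearLinks_node {y : Fin k} {s : ℤ} {cs : List (CTree (Fin k))}
    (h : Loc c (.node y s cs)) (hn : dist (c p) (c y) ≤ (2 : ℝ) ^ (s + 1)) :
    (cs.map fun t => 1 + nearLinks c p t).sum = nearLinks c p (.node y s cs) := by
  unfold nearLinks
  rw [links_node, List.countP_flatMap]
  refine congrArg List.sum (List.map_congr_left fun t ht => ?_)
  have h1 := h.covering ht
  have h2 := dist_triangle_right (c p) (c t.pt) (c y)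
  rw [two_zpow_succ] at hn
  have h3 : dist (c p) (c t.pt) ≤ 3 * 2 ^ s := by linarith
  simp only [Function.comp_def, List.countP_cons, h3, decide_true, if_true]
  rw [add_comm]

/-- What a search among the points of a list of links with start value `b` and
  result `r` achieves. -/
structure SearchSpec (c : Fin k → Pt d) (p : Fin k) (L : List (ℤ × CTree (Fin k)))
    (b r : Found k) : Prop where
  level_le : r.level ≤ b.level
  minimal : r.twin = none → b.twin = none ∧ ∀ l ∈ L, 0 < dist (c p) (c l.2.pt) ∧
    (ceilLog (dist (c p) (c l.2.pt)) ≤ l.1 - 1 → r.level ≤ ceilLog (dist (c p) (c l.2.pt)))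
  attained : (r.par = b.par ∧ r.level = b.level) ∨ ∃ l ∈ L, r.par = l.2.pt ∧
    0 < dist (c p) (c l.2.pt) ∧ r.level = ceilLog (dist (c p) (c l.2.pt)) ∧ r.level ≤ l.1 - 1
  twin : ∀ q, r.twin = some q → b.twin = some q ∨ ∃ l ∈ L, l.2.pt = q ∧ dist (c p) (c q) = 0

/-- The case of a subtree that is cut off: its points are too far away to be parents on the levels
where they occur, so ignoring them loses nothing. -/
theorem SearchSpec.refl {L : List (ℤ × CTree (Fin k))} {b : Found k}
    (h : ∀ l ∈ L, (2 : ℝ) ^ l.1 < dist (c p) (c l.2.pt)) : SearchSpec c p L b b := by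
  refine ⟨le_rfl, fun hb => ⟨hb, fun l hl => ?_⟩, Or.inl ⟨rfl, rfl⟩, fun q hq => Or.inl hq⟩
  have h1 := h l hl
  have h2 : (0 : ℝ) < 2 ^ l.1 := by positivity
  refine ⟨by linarith, fun h3 => ?_⟩
  rw [ceilLog_le_iff (by linarith)] at h3
  have : (2 : ℝ) ^ (l.1 - 1) ≤ 2 ^ l.1 := zpow_le_zpow_right₀ (by norm_num) (by omega)
  linarith

theorem SearchSpec.trans {L L' : List (ℤ × CTree (Fin k))} {b r r' : Found k}
    (h : SearchSpec c p L b r) (h' : SearchSpec c p L' r r') :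
    SearchSpec c p (L ++ L') b r' := by
  refine ⟨h'.level_le.trans h.level_le, fun hr => ?_, ?_, fun q hq => ?_⟩
  · obtain ⟨h1, h2⟩ := h'.minimal hr
    obtain ⟨h3, h4⟩ := h.minimal h1
    refine ⟨h3, fun l hl => ?_⟩
    rcases List.mem_append.1 hl with hl | hl
    · exact ⟨(h4 l hl).1, fun h5 => h'.level_le.trans ((h4 l hl).2 h5)⟩
    · exact h2 l hl
  · rcases h'.attained with ⟨h1, h2⟩ | ⟨l, hl, h1⟩
    · rcases h.attained with ⟨h3, h4⟩ | ⟨l, hl, h3⟩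
      · exact Or.inl ⟨h1.trans h3, h2.trans h4⟩
      · exact Or.inr ⟨l, by simp [hl], by rw [h1, h2]; exact h3⟩
    · exact Or.inr ⟨l, by simp [hl], h1⟩
  · rcases h'.twin q hq with h1 | ⟨l, hl, h1⟩
    · rcases h.twin q h1 with h2 | ⟨l, hl, h2⟩
      · exact Or.inl h2
      · exact Or.inr ⟨l, by simp [hl], h2⟩
    · exact Or.inr ⟨l, by simp [hl], h1⟩

theorem searchSpec_consider (s : ℤ) (t : CTree (Fin k)) (b : Found k) :
    SearchSpec c p [(s, t)] b (consider c p (s - 1) t b) := by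
  unfold consider
  split_ifs with h1 h2
  · refine ⟨le_rfl, fun h => by simp at h, Or.inl ⟨rfl, rfl⟩, fun q hq => Or.inr ?_⟩
    simp only [Option.some.injEq] at hq
    exact ⟨(s, t), by simp, hq, by rw [← hq]; exact h1⟩
  · have h3 := lt_of_le_of_ne dist_nonneg (Ne.symm h1)
    refine ⟨h2.2.le, fun h => ⟨h, ?_⟩, Or.inr ⟨(s, t), by simp, rfl, h3, rfl, h2.1⟩,
      fun q hq => Or.inl hq⟩
    simp only [List.mem_singleton, forall_eq]
    exact ⟨h3, fun _ => le_rfl⟩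
  · have h3 := lt_of_le_of_ne dist_nonneg (Ne.symm h1)
    refine ⟨le_rfl, fun h => ⟨h, ?_⟩, Or.inl ⟨rfl, rfl⟩, fun q hq => Or.inl hq⟩
    simp only [List.mem_singleton, forall_eq]
    exact ⟨h3, fun h4 => by by_contra h5; exact h2 ⟨h4, by omega⟩⟩

theorem search_spec {t : CTree (Fin k)} (h : Loc c t) (b : Found k) :
    SearchSpec c p t.links b (search c p t b).1 ∧
      (search c p t b).2 ≤ 1 + 2 * nearLinks c p t := by
  induction t using induct generalizing b with
  | leaf y =>
    simp only [search, links_leaf]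
    exact ⟨.refl (by simp), by omega⟩
  | node y s cs ih =>
    have hl : ∀ l : List (CTree (Fin k)), (∀ t ∈ l, t ∈ cs) → ∀ b,
        SearchSpec c p (l.flatMap fun t => (s, t) :: t.links) b (searchList c p s l b).1 ∧
        (searchList c p s l b).2 ≤ 2 * (l.map fun t => 1 + nearLinks c p t).sum := by
      intro l
      induction l with
      | nil => intro _ b; simp only [searchList]; exact ⟨.refl (by simp), by simp⟩
      | cons t ts iht =>
        intro hsub b
        have h1 := ih t (hsub t (by simp)) (h.child (hsub t (by simp)))
          (consider c p (s - 1) t b)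
        have h2 := iht (fun u hu => hsub u (List.mem_cons_of_mem _ hu))
          (search c p t (consider c p (s - 1) t b)).1
        simp only [searchList]
        refine ⟨?_, ?_⟩
        · have := ((searchSpec_consider s t b).trans h1.1).trans h2.1
          simpa using this
        · simp only [List.map_cons, List.sum_cons]
          have := h1.2
          have := h2.2
          omega
    unfold search
    split_ifs with hn
    · have h1 := hl cs (fun _ ht => ht) b
      refine ⟨by simpa using h1.1, ?_⟩
      rw [← nearLinks_node h hn]
      have := h1.2
      simp only
      omega
    -- Beyond `2 ^ (s + 1)` from the node, the slack in `Loc.dist_link` leaves more than `2 ^ l.1`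
    -- between `p` and the end of each link below.
    · refine ⟨.refl fun l hl' => ?_, by simp⟩
      have h1 := (h.dist_link hl').1
      have h2 := dist_triangle_right (c p) (c y) (c l.2.pt)
      rw [dist_comm (c y)] at h2
      push Not at hn
      linarith

theorem graftList_fst (i : ℤ) (cs : List (CTree (Fin k))) :
    (graftList c p q i cs).1 = cs.map fun t => (graft c p q i t).1 := by
  induction cs with
  | nil => rfl
  | cons t ts ih => simp [graftList, ih]

theorem graft_time {t : CTree (Fin k)} (h : Loc c t) (i : ℤ) :
    (graft c p q i t).2 ≤ 1 + 2 * nearLinks c p t := by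
  induction t using induct with
  | leaf y => unfold graft; split_ifs <;> simp
  | node y s cs ih =>
    have hl : ∀ l : List (CTree (Fin k)), (∀ t ∈ l, t ∈ cs) →
        (graftList c p q i l).2 ≤ 2 * (l.map fun t => 1 + nearLinks c p t).sum := by
      intro l
      induction l with
      | nil => intro _; simp [graftList]
      | cons t ts iht =>
        intro hsub
        have h1 := ih t (hsub t (by simp)) (h.child (hsub t (by simp)))
        have h2 := iht (fun u hu => hsub u (List.mem_cons_of_mem _ hu))
        simp only [graftList, List.map_cons, List.sum_cons]
        omega
    unfold graft
    split_ifs with h1 h2 hn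
    · simp
    · simp
    · rw [← nearLinks_node h hn]
      have := hl cs fun _ ht => ht
      simp only
      omega
    · simp

/-- Hence grafting changes only the one child whose leaves include `q`. -/
theorem graft_of_notMem {t : CTree (Fin k)} (h : Loc c t) {i : ℤ} (hq : q ∉ t.leaves) :
    (graft c p q i t).1 = t := by
  induction t using induct with
  | leaf y =>
    have : y ≠ q := by rintro rfl; simp at hq
    simp [graft, this]
  | node y s cs ih =>
    have hy : y ≠ q := by rintro rfl; exact hq h.pt_mem_leaves
    have h1 : (graftList c p q i cs).1 = cs := by
      rw [graftList_fst]
      conv_rhs => rw [← List.map_id cs]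
      refine List.map_congr_left fun t ht => ih t ht (h.child ht) fun hqt => hq ?_
      rw [leaves_node, List.mem_flatMap]
      exact ⟨t, ht, hqt⟩
    simp only [graft, hy, h1, false_and, if_false]
    split_ifs <;> rfl

/-- What grafting a point does to a tree. -/
structure GraftSpec (c : Fin k → Pt d) (p q : Fin k) (i : ℤ) (t t' : CTree (Fin k)) : Prop where
  loc : Loc c t'
  pt_eq : t'.pt = t.pt
  leaves_perm : t'.leaves.Perm (p :: t.leaves)
  scale_lt : ∀ s : ℤ, t.scale < (s : WithBot ℤ) → (t.pt = q → i < s) → t'.scale < s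
  links_le : ∀ l ∈ t'.links, (∃ l' ∈ t.links, l'.2.pt = l.2.pt ∧ l.1 ≤ l'.1) ∨
    ((l.2.pt = p ∨ l.2.pt = q) ∧ l.1 ≤ i)

/-- Three local changes are possible: a leaf or a node of `q` of lower scale gets a new parent of
scale `i`, or an existing node of scale `i` gets one more child. Apart from old occurrences, only
`p` and `q` appear, on levels below `i`; this suffices to recheck separation. -/
theorem graft_spec {t : CTree (Fin k)} (h : Loc c t) (hn : t.leaves.Nodup) {i : ℤ}
    (hq : t.OnLevel i q) (hpq : dist (c p) (c q) ≤ (2 : ℝ) ^ i) :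
    GraftSpec c p q i t (graft c p q i t).1 := by
  have hi0 : (0 : ℝ) ≤ 2 ^ i := by positivity
  induction t using induct with
  | leaf y =>
    have hy : y = q := by
      rcases hq with hq | ⟨l, hl, -⟩
      · exact hq.symm
      · simp at hl
    subst hy
    simp only [graft, if_true]
    refine ⟨.node _ _ _ ⟨leaf y, by simp, rfl⟩ (by simp) (by simp) ?_ ?_, rfl,
      by simpa using List.Perm.swap _ _ _, ?_, ?_⟩
    · simp [hpq, hi0]
    · simp only [List.mem_cons, List.not_mem_nil, or_false, forall_eq_or_imp, forall_eq]
      exact ⟨.leaf _, .leaf _⟩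
    · intro s _ hs
      simpa using hs rfl
    · simp
  | node y s cs ih =>
    unfold graft
    by_cases h1 : y = q ∧ s = i
    · obtain ⟨rfl, rfl⟩ := h1
      simp only [and_self, if_true]
      refine ⟨.node _ _ _ ?_ ?_ ?_ ?_ ?_, rfl, by simp, fun _ hs _ => hs, ?_⟩
      · obtain ⟨t, ht, htp⟩ := h.nesting
        exact ⟨t, by simp [ht], htp⟩
      · have := h.two_le
        simp; omega
      · simp only [List.mem_cons, forall_eq_or_imp]
        exact ⟨by simp, fun t ht => h.scale_lt ht⟩
      · simp only [List.mem_cons, forall_eq_or_imp]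
        exact ⟨by simpa using hpq, fun t ht => h.covering ht⟩
      · simp only [List.mem_cons, forall_eq_or_imp]
        exact ⟨.leaf _, fun t ht => h.child ht⟩
      · intro l hl
        simp only [links_node, List.flatMap_cons, links_leaf] at hl
        rcases List.mem_append.1 hl with hl | hl
        · right; simp only [List.mem_singleton] at hl; subst hl; simp
        · left; exact ⟨l, by simpa using hl, rfl, le_rfl⟩
    · by_cases h2 : y = q ∧ s < i
      · rw [if_neg h1, if_pos h2]
        obtain ⟨rfl, hsi⟩ := h2
        refine ⟨.node _ _ _ ⟨node y s cs, by simp, rfl⟩ (by simp) (by simpa using hsi) ?_ ?_, rfl,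
          ?_, ?_, ?_⟩
        · simp [hpq, hi0]
        · simp only [List.mem_cons, List.not_mem_nil, or_false, forall_eq_or_imp, forall_eq]
          exact ⟨h, .leaf _⟩
        · simp
        · intro z _ hz
          simpa using hz rfl
        · intro l hl
          simp only [links_node, List.flatMap_cons, List.flatMap_nil, links_leaf,
            List.append_nil, List.mem_append, List.mem_cons, List.not_mem_nil, or_false] at hl
          rcases hl with (rfl | hl) | rfl
          · right; simp
          · left; exact ⟨l, by simpa using hl, rfl, le_rfl⟩
          · right; simp
      · rw [if_neg h1, if_neg h2]
        -- The distance test never blocks the way to `q`: if `q` hangs on a link of scale `l.1 > i`,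
        -- then `dist (c p) (c y) ≤ 2 ^ i + (2 ^ (s + 1) - 2 ^ l.1) ≤ 2 ^ (s + 1)`.
        have hchild : ∃ t ∈ cs, t.OnLevel i q ∧ q ∈ t.leaves ∧ i < s ∧
            dist (c p) (c y) ≤ (2 : ℝ) ^ (s + 1) := by
          by_cases hy : y = q
          · have his : i < s := by
              rcases lt_trichotomy s i with h3 | h3 | h3
              · exact absurd ⟨hy, h3⟩ h2
              · exact absurd ⟨hy, h3⟩ h1
              · exact h3
            obtain ⟨t, ht, htp⟩ := h.nesting
            refine ⟨t, ht, Or.inl (by rw [htp, hy]), ?_, his, ?_⟩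
            · rw [← hy, ← htp]; exact (h.child ht).pt_mem_leaves
            · rw [hy]
              exact hpq.trans (zpow_le_zpow_right₀ (by norm_num) (by omega))
          · rcases hq with hq | ⟨l, hl, hlq, hil⟩
            · exact absurd hq.symm hy
            · have h3 := h.dist_link hl
              have h4 : (2 : ℝ) ^ i ≤ 2 ^ l.1 := zpow_le_zpow_right₀ (by norm_num) hil.le
              have h5 := dist_triangle (c p) (c q) (c y)
              rw [hlq] at h3
              have h6 : dist (c p) (c y) ≤ (2 : ℝ) ^ (s + 1) := by linarith [h3.1]
              simp only [links_node, List.mem_flatMap, List.mem_cons] at hl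
              obtain ⟨t, ht, hl⟩ := hl
              have h7 : t.OnLevel i q := by
                rcases hl with rfl | hl
                · exact Or.inl hlq.symm
                · exact Or.inr ⟨l, hl, hlq, hil⟩
              exact ⟨t, ht, h7, h7.mem_leaves (h.child ht), by omega, h6⟩
        obtain ⟨t, ht, htl, hqt, his, hnear⟩ := hchild
        rw [if_pos hnear]
        rw [leaves_node, List.nodup_flatMap] at hn
        have hspec := ih t ht (h.child ht) (hn.1 t ht) htl
        obtain ⟨l1, l2, rfl⟩ := List.append_of_mem ht
        have hothers : ∀ u, u ∈ l1 ∨ u ∈ l2 → (graft c p q i u).1 = u := by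
          intro u hu
          refine graft_of_notMem (h.child (by simp; tauto)) fun hqu => ?_
          have h3 := hn.2
          rw [List.pairwise_append] at h3
          rcases hu with hu | hu
          · exact List.disjoint_left.1 (h3.2.2 u hu t (by simp)) hqu hqt
          · have h4 := h3.2.1
            rw [List.pairwise_cons] at h4
            exact List.disjoint_left.1 (h4.1 u hu) hqt hqu
        have hmap : (graftList c p q i (l1 ++ t :: l2)).1 =
            l1 ++ (graft c p q i t).1 :: l2 := by
          rw [graftList_fst, List.map_append, List.map_cons,
            List.map_congr_left fun u hu => hothers u (Or.inl hu),
            List.map_congr_left fun u hu => hothers u (Or.inr hu)]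
          simp
        simp only [hmap]
        have hmem : ∀ u ∈ l1 ++ (graft c p q i t).1 :: l2,
            u ∈ l1 ++ t :: l2 ∨ u = (graft c p q i t).1 := by
          intro u hu
          simp only [List.mem_append, List.mem_cons] at hu ⊢
          tauto
        refine ⟨.node _ _ _ ?_ ?_ ?_ ?_ ?_, rfl, ?_, fun _ hs _ => hs, ?_⟩
        · obtain ⟨u, hu, hup⟩ := h.nesting
          simp only [List.mem_append, List.mem_cons] at hu
          rcases hu with hu | rfl | hu
          · exact ⟨u, by simp [hu], hup⟩
          · exact ⟨_, by simp, hspec.pt_eq.trans hup⟩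
          · exact ⟨u, by simp [hu], hup⟩
        · simpa using h.two_le
        · intro u hu
          rcases hmem u hu with hu | rfl
          · exact h.scale_lt hu
          · exact hspec.scale_lt s (h.scale_lt ht) fun _ => his
        · intro u hu
          rcases hmem u hu with hu | rfl
          · exact h.covering hu
          · rw [hspec.pt_eq]; exact h.covering ht
        · intro u hu
          rcases hmem u hu with hu | rfl
          · exact h.child hu
          · exact hspec.loc
        · simp only [leaves_node, List.flatMap_append, List.flatMap_cons]
          refine ((hspec.leaves_perm.append_right _).append_left _).trans ?_
          simp
        · intro l hl
          simp only [links_node, List.mem_flatMap, List.mem_cons] at hl ⊢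
          obtain ⟨u, hu, hl⟩ := hl
          rcases hmem u hu with hu | rfl
          · left; exact ⟨l, ⟨u, hu, hl⟩, rfl, le_rfl⟩
          · rcases hl with rfl | hl
            · left; exact ⟨(s, t), ⟨t, ht, Or.inl rfl⟩, hspec.pt_eq.symm, le_rfl⟩
            · rcases hspec.links_le l hl with ⟨l', hl', h3⟩ | h3
              · left; exact ⟨l', ⟨t, ht, Or.inr hl'⟩, h3⟩
              · exact Or.inr h3

/-- The state of the construction after the points of the list `P` have been inserted. -/
structure BuiltSpec (c : Fin k → Pt d) (P : List (Fin k)) (B : Built k) : Prop where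
  cov : Cov c B.tree
  subset : ∀ q ∈ B.tree.leaves, q ∈ P
  mem : ∀ q ∈ P, q ∈ B.tree.leaves ∨
    (B.twins q = true ∧ ∃ q' ∈ B.tree.leaves, c q' = c q)

/-- That the level found is attained gives covering for the new link; that it is minimal gives
separation below it. The search and the grafting each meet only near links. -/
theorem insertPoint_spec {P : List (Fin k)} {B : Built k} (h : BuiltSpec c P B) (hp : p ∉ P) :
    BuiltSpec c (p :: P) (insertPoint c B p).1 ∧
      (insertPoint c B p).2 ≤ 3 + 4 * nearLinks c p B.tree := by
  have hloc := h.cov.loc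
  set b : Found k := ⟨B.tree.pt, ceilLog (dist (c p) (c B.tree.pt)),
      if dist (c p) (c B.tree.pt) = 0 then some B.tree.pt else none⟩ with hb
  have hs := search_spec (p := p) hloc b
  set r := search c p B.tree b with hr
  have hpl : p ∉ B.tree.leaves := fun hpl => hp (h.subset p hpl)
  rcases htw : r.1.twin with _ | q
  · have hins : insertPoint c B p = ({ B with tree := (graft c p r.1.par r.1.level B.tree).1 },
        r.2 + (graft c p r.1.par r.1.level B.tree).2 + 1) := by
      simp only [insertPoint]
      rw [← hb, ← hr, htw]
    rw [hins]
    obtain ⟨hb0, hmin⟩ := hs.1.minimal htw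
    have hD : 0 < dist (c p) (c B.tree.pt) := by
      refine lt_of_le_of_ne dist_nonneg fun h0 => ?_
      simp [hb, ← h0] at hb0
    have hpar : B.tree.OnLevel r.1.level r.1.par ∧
        dist (c p) (c r.1.par) ≤ (2 : ℝ) ^ r.1.level := by
      rcases hs.1.attained with ⟨h1, h2⟩ | ⟨l, hl, h1, h2, h3, h4⟩
      · rw [h1, h2]
        exact ⟨Or.inl rfl, (ceilLog_le_iff hD).1 le_rfl⟩
      · refine ⟨Or.inr ⟨l, hl, h1.symm, by omega⟩, ?_⟩
        rw [h1]
        exact (ceilLog_le_iff h2).1 h3.ge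
    -- A point within `2 ^ j` of `p` on a level `j` below the one found would have been a better
    -- parent.
    have hlow : ∀ j u, B.tree.OnLevel j u → j < r.1.level → (2 : ℝ) ^ j < dist (c p) (c u) := by
      intro j u hu hj
      by_contra! hle
      rcases hu with rfl | ⟨l, hl, rfl, hjl⟩
      · have h1 : r.1.level ≤ ceilLog (dist (c p) (c B.tree.pt)) := hs.1.level_le
        have h2 := (ceilLog_le_iff hD).2 hle
        omega
      · obtain ⟨h1, h2⟩ := hmin l hl
        have h3 := (ceilLog_le_iff h1).2 hle
        have := h2 (by omega)
        omega
    have hg := graft_spec hloc h.cov.nodup hpar.1 hpar.2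
    have ht := graft_time (p := p) (q := r.1.par) hloc r.1.level
    refine ⟨⟨⟨hg.loc, ?_, ?_⟩, ?_, ?_⟩, ?_⟩
    · rw [hg.leaves_perm.nodup_iff]
      exact List.nodup_cons.2 ⟨hpl, h.cov.nodup⟩
    · have hlev : ∀ j u, (graft c p r.1.par r.1.level B.tree).1.OnLevel j u →
          B.tree.OnLevel j u ∨ (u = p ∧ j < r.1.level) := by
        rintro j u (rfl | ⟨l, hl, rfl, hjl⟩)
        · left; left; exact hg.pt_eq
        · rcases hg.links_le l hl with ⟨l', hl', h1, h2⟩ | ⟨h1 | h1, h2⟩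
          · left; right; exact ⟨l', hl', h1, by omega⟩
          · right; exact ⟨h1, by omega⟩
          · left; rw [h1]; exact hpar.1.mono (by omega)
      intro j u v hu hv huv
      rcases hlev j u hu with hu' | ⟨rfl, hju⟩
      · rcases hlev j v hv with hv' | ⟨rfl, hjv⟩
        · exact h.cov.separation j u v hu' hv' huv
        · rw [dist_comm]; exact hlow j u hu' hjv
      · rcases hlev j v hv with hv' | ⟨rfl, hjv⟩
        · exact hlow j v hv' hju
        · exact absurd rfl huv
    · intro u hu
      rcases List.mem_cons.1 (hg.leaves_perm.mem_iff.1 hu) with rfl | hu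
      · simp
      · exact List.mem_cons_of_mem _ (h.subset u hu)
    · intro u hu
      rcases List.mem_cons.1 hu with rfl | hu
      · left; exact hg.leaves_perm.mem_iff.2 (by simp)
      · rcases h.mem u hu with hu | ⟨h1, v, hv, h2⟩
        · left; exact hg.leaves_perm.mem_iff.2 (by simp [hu])
        · right; exact ⟨h1, v, hg.leaves_perm.mem_iff.2 (by simp [hv]), h2⟩
    · have := hs.2
      simp only
      omega
  · have hins : insertPoint c B p =
        ({ B with twins := Function.update (Function.update B.twins q true) p true },
          r.2 + 1) := by
      simp only [insertPoint]
      rw [← hb, ← hr, htw]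
    rw [hins]
    have hq : q ∈ B.tree.leaves ∧ c q = c p := by
      rcases hs.1.twin q htw with h1 | ⟨l, hl, rfl, h1⟩
      · have h2 : dist (c p) (c B.tree.pt) = 0 ∧ B.tree.pt = q := by simpa [hb] using h1
        rw [← h2.2]
        exact ⟨hloc.pt_mem_leaves, (dist_eq_zero.1 h2.1).symm⟩
      · refine ⟨?_, (dist_eq_zero.1 h1).symm⟩
        exact OnLevel.mem_leaves (i := l.1 - 1) hloc (Or.inr ⟨l, hl, rfl, by omega⟩)
    have hmono : ∀ u, B.twins u = true →
        Function.update (Function.update B.twins q true) p true u = true := by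
      intro u hu
      simp only [Function.update_apply]
      split_ifs <;> simp [hu]
    refine ⟨⟨h.cov, fun u hu => List.mem_cons_of_mem _ (h.subset u hu), ?_⟩, ?_⟩
    · intro u hu
      rcases List.mem_cons.1 hu with rfl | hu
      · right; exact ⟨by simp, q, hq⟩
      · rcases h.mem u hu with hu | ⟨h1, h2⟩
        · exact Or.inl hu
        · exact Or.inr ⟨hmono u h1, h2⟩
    · have := hs.2
      simp only
      omega

theorem insertList_spec {W : ℕ} (hW : ∀ T : CTree (Fin k), Cov c T → ∀ p, nearLinks c p T ≤ W)
    (ps : List (Fin k)) {P : List (Fin k)} {B : Built k} (h : BuiltSpec c P B)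
    (hps : (ps ++ P).Nodup) :
    (∃ P', (∀ q, q ∈ P' ↔ q ∈ ps ++ P) ∧ BuiltSpec c P' (insertList c ps B).1) ∧
      (insertList c ps B).2 ≤ ps.length * (3 + 4 * W) := by
  induction ps generalizing P B with
  | nil => exact ⟨⟨P, by simp, by simpa [insertList] using h⟩, by simp [insertList]⟩
  | cons p ps ih =>
    rw [List.cons_append, List.nodup_cons] at hps
    have h1 := insertPoint_spec (p := p) h (fun hp => hps.1 (by simp [hp]))
    have h2 := ih h1.1 (by
      rw [List.perm_middle.nodup_iff]; exact List.nodup_cons.2 hps)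
    obtain ⟨⟨P', hP', h3⟩, h4⟩ := h2
    simp only [insertList]
    refine ⟨⟨P', fun q => ?_, h3⟩, ?_⟩
    · rw [hP']; simp only [List.mem_append, List.mem_cons]; tauto
    · have := hW B.tree h.cov p
      have := h1.2
      rw [List.length_cons, add_mul]
      omega

/-- A tree on the distinct centroids has been built. -/
theorem buildTree_spec [NeZero k] {W : ℕ}
    (hW : ∀ T : CTree (Fin k), Cov c T → ∀ p, nearLinks c p T ≤ W) :
    Cov c (buildTree c).1.tree ∧
    (∀ q, q ∈ (buildTree c).1.tree.leaves ∨ ((buildTree c).1.twins q = true ∧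
      ∃ q' ∈ (buildTree c).1.tree.leaves, c q' = c q)) ∧
    (buildTree c).2 ≤ (k - 1) * (3 + 4 * W) + k := by
  have hk : List.finRange k = 0 :: (List.finRange k).tail := by
    obtain ⟨n, rfl⟩ := Nat.exists_eq_succ_of_ne_zero (NeZero.ne k)
    rw [List.finRange_succ]; rfl
  have h0 : BuiltSpec c [0] { tree := leaf 0, twins := fun _ => false } := by
    refine ⟨⟨.leaf _, by simp, ?_⟩, by simp, by simp⟩
    rintro i p q (rfl | ⟨l, hl, -⟩) (rfl | ⟨l', hl', -⟩) hpq <;> simp_all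
  have hnd := List.nodup_finRange k
  rw [hk] at hnd
  obtain ⟨⟨P', hP', h1⟩, h2⟩ := insertList_spec hW (List.finRange k).tail h0 (by
    rw [List.perm_append_comm.nodup_iff]; simpa using hnd)
  refine ⟨h1.cov, fun q => h1.mem q ?_, ?_⟩
  · rw [hP']
    have : q ∈ List.finRange k := List.mem_finRange q
    rw [hk] at this
    simp only [List.mem_append, List.mem_cons, List.not_mem_nil, or_false] at this ⊢
    tauto
  · have h3 : (List.finRange k).tail.length = k - 1 := by simp
    rw [h3] at h2
    simp only [buildTree]
    omega

end Insertion

-- Counting the links near a point.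

section NearLinks

variable {d k : ℕ} {c : Fin k → Pt d}

theorem CTree.Cov.links_nodup {T : CTree (Fin k)} (h : Cov c T) :
    (T.links.map fun l => (l.1, l.2.pt)).Nodup := by
  have : ∀ t : CTree (Fin k), Loc c t → t.leaves.Nodup →
      (t.links.map fun l => (l.1, l.2.pt)).Nodup := by
    intro t
    induction t using induct with
    | leaf p => simp
    | node p s cs ih =>
      intro h hn
      rw [leaves_node, List.nodup_flatMap] at hn
      have hpt : ∀ t ∈ cs, ∀ l ∈ (s, t) :: t.links, l.2.pt ∈ t.leaves := by
        intro t ht l hl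
        rcases List.mem_cons.1 hl with rfl | hl
        · exact (h.child ht).pt_mem_leaves
        · exact OnLevel.mem_leaves (i := l.1 - 1) (h.child ht) (Or.inr ⟨l, hl, rfl, by omega⟩)
      rw [links_node, List.map_flatMap, List.nodup_flatMap]
      refine ⟨fun t ht => ?_, hn.2.imp_of_mem ?_⟩
      · rw [List.map_cons, List.nodup_cons]
        refine ⟨?_, ih t ht (h.child ht) (hn.1 t ht)⟩
        rw [List.mem_map]
        rintro ⟨l, hl, hls⟩
        have h1 : l.1 = s := congrArg Prod.fst hls
        obtain ⟨q, ds, h2, -⟩ := mem_links.1 hl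
        have := h.scale_lt_of_mem ht h2
        rw [scale_node, WithBot.coe_lt_coe] at this
        omega
      · intro a b ha hb hab
        rw [Function.onFun, List.disjoint_left] at hab ⊢
        intro z hz hz'
        obtain ⟨l, hl, rfl⟩ := List.mem_map.1 hz
        obtain ⟨l', hl', he⟩ := List.mem_map.1 hz'
        have h1 : l'.2.pt = l.2.pt := congrArg Prod.snd he
        exact hab (hpt a ha l hl) (h1 ▸ hpt b hb l' hl')
  exact this T h.loc h.nodup

theorem mem_image_centroids (c : Fin k → Pt d) (j : Fin k) : c j ∈ Finset.univ.image c :=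
  Finset.mem_image_of_mem c (Finset.mem_univ j)

theorem card_image_centroids_le (c : Fin k → Pt d) : (Finset.univ.image c).card ≤ k := by
  simpa using Finset.card_image_le (s := Finset.univ) (f := c)

open scoped Classical in
/-- The scales of the internal nodes that are close to `p` in relation to their scale. -/
noncomputable def nearScales (c : Fin k → Pt d) (p : Fin k) (T : CTree (Fin k)) : Finset ℤ :=
  T.scales.filter fun s => ∃ z ∈ Finset.univ.image c,
    (2 : ℝ) ^ (s - 2) < dist (c p) z ∧ dist (c p) z ≤ 2 ^ (s + 4)

theorem mem_nearScales_iff {p : Fin k} {T : CTree (Fin k)} {s : ℤ} :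
    s ∈ nearScales c p T ↔ s ∈ T.scales ∧ ∃ z ∈ Finset.univ.image c,
      (2 : ℝ) ^ (s - 2) < dist (c p) z ∧ dist (c p) z ≤ 2 ^ (s + 4) := by
  simp only [nearScales, Finset.mem_filter]

theorem card_nearScales_le {e : ℝ} (he : Doubling (Finset.univ.image c) e) (p : Fin k)
    (T : CTree (Fin k)) : ((nearScales c p T).card : ℝ) ≤ 16 * e ^ 2 * Real.log k :=
  he.card_scales_le (mem_image_centroids c p) (card_image_centroids_le c) _
    fun _ hs => (mem_nearScales_iff.1 hs).2

/-- An internal node has a child `u` at distance more than `2 ^ (s - 1)`. If `p` is too close to `q`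
for `q` to witness the scale, then `u` is more than `2 ^ (s - 2)` from `p` and serves instead. -/
theorem mem_nearScales {T : CTree (Fin k)} (h : Cov c T) (p : Fin k) {q : Fin k} {s : ℤ}
    {cs : List (CTree (Fin k))} (hn : node q s cs ∈ T.subtrees)
    (hd : dist (c p) (c q) ≤ 8 * 2 ^ s) : s ∈ nearScales c p T := by
  refine mem_nearScales_iff.2 ⟨h.loc.mem_scales hn, ?_⟩
  obtain ⟨u, hu, -, -, -, h1, h2⟩ := h.exists_pair hn
  have h3 : (2 : ℝ) ^ (s + 4) = 16 * 2 ^ s := by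
    rw [zpow_add₀ (by norm_num)]; norm_num; ring
  have h4 : (2 : ℝ) ^ (s - 1) = 2 * 2 ^ (s - 2) := by
    rw [← two_zpow_succ]; congr 1; ring
  have h5 : (0 : ℝ) < 2 ^ s := by positivity
  by_cases hq : (2 : ℝ) ^ (s - 2) < dist (c p) (c q)
  · exact ⟨c q, mem_image_centroids c q, hq, by linarith⟩
  · push Not at hq
    have h6 := dist_triangle_left (c u.pt) (c q) (c p)
    have h7 := dist_triangle_right (c p) (c u.pt) (c q)
    exact ⟨c u.pt, mem_image_centroids c _, by linarith, by linarith⟩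

/-- Sort the links by the scale of the parent: packing gives at most `e ^ 5` per scale, and only
near scales occur. -/
theorem nearLinks_le {T : CTree (Fin k)} (h : Cov c T) {e : ℝ}
    (he : Doubling (Finset.univ.image c) e) (p : Fin k) :
    (nearLinks c p T : ℝ) ≤ e ^ 5 * (16 * e ^ 2 * Real.log k) := by
  classical
  have he2 := he.two_le
  set L := T.links.filter fun l => decide (dist (c p) (c l.2.pt) ≤ 3 * 2 ^ l.1) with hL
  have hnd : (L.map fun l => (l.1, l.2.pt)).Nodup :=
    h.links_nodup.sublist (List.filter_sublist.map _)
  set F := (L.map fun l => (l.1, l.2.pt)).toFinset with hF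
  have hmem : ∀ z ∈ F, ∃ l ∈ T.links, (l.1, l.2.pt) = z ∧
      dist (c p) (c z.2) ≤ 3 * 2 ^ z.1 := by
    intro z hz
    simp only [hF, List.mem_toFinset, List.mem_map, hL, List.mem_filter, decide_eq_true_eq] at hz
    obtain ⟨l, ⟨h1, h2⟩, rfl⟩ := hz
    exact ⟨l, h1, rfl, h2⟩
  have hcard : nearLinks c p T = F.card := by
    rw [hF, List.toFinset_card_of_nodup hnd, List.length_map, nearLinks, List.countP_eq_length_filter]
  have hsub : F.image Prod.fst ⊆ nearScales c p T := by
    intro s hs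
    obtain ⟨z, hz, rfl⟩ := Finset.mem_image.1 hs
    obtain ⟨l, hl, rfl, hd⟩ := hmem z hz
    obtain ⟨q, cs, h1, h2⟩ := mem_links.1 hl
    refine mem_nearScales h p h1 ?_
    have h3 := (h.loc.of_mem h1).covering h2
    have h4 := dist_triangle (c p) (c l.2.pt) (c q)
    have h5 : (0 : ℝ) < 2 ^ l.1 := by positivity
    simp only at hd ⊢
    linarith
  have hfib : ∀ s ∈ F.image Prod.fst, ((F.filter fun z => z.1 = s).card : ℝ) ≤ e ^ 5 := by
    intro s _
    have hlev : ∀ z ∈ F.filter (fun z => z.1 = s), T.OnLevel (s - 1) z.2 := by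
      intro z hz
      obtain ⟨hz, hzs⟩ := Finset.mem_filter.1 hz
      obtain ⟨l, hl, rfl, -⟩ := hmem z hz
      exact Or.inr ⟨l, hl, rfl, by simp only at hzs; omega⟩
    have hsep : ∀ z ∈ F.filter (fun z => z.1 = s), ∀ z' ∈ F.filter (fun z => z.1 = s), z ≠ z' →
        (2 : ℝ) ^ (s - 1) < dist (c z.2) (c z'.2) := by
      intro z hz z' hz' hne
      refine h.separation _ _ _ (hlev z hz) (hlev z' hz') fun h2 => hne ?_
      exact Prod.ext ((Finset.mem_filter.1 hz).2.trans (Finset.mem_filter.1 hz').2.symm) h2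
    have h4 : (2 : ℝ) ^ (s - 1) = 2 * 2 ^ (s - 2) := by
      rw [← two_zpow_succ]; congr 1; ring
    have h5 : (2 : ℝ) ^ s = 4 * 2 ^ (s - 2) := by
      have : s = s - 1 + 1 := by ring
      conv_lhs => rw [this, two_zpow_succ, h4]
      ring
    have hpos : (0 : ℝ) < 2 ^ (s - 2) := by positivity
    have hinj : Set.InjOn (fun z : ℤ × Fin k => c z.2) (F.filter (fun z => z.1 = s) : Set _) := by
      intro z hz z' hz' he
      by_contra hne
      have := hsep z hz z' hz' hne
      simp only at he
      rw [he, dist_self] at this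
      linarith
    rw [← Finset.card_image_of_injOn hinj]
    -- With `r = 2 ^ (s - 2)`, the points are more than `2 * r` apart and within `12 * r` of `p`;
    -- `24 + 1 ≤ 2 ^ 5`.
    refine he.card_le (fun y hy => ?_) hpos 5 ?_ ?_
    · obtain ⟨z, -, rfl⟩ := Finset.mem_image.1 hy
      exact mem_image_centroids c _
    · intro a ha b hb hab
      obtain ⟨z, hz, rfl⟩ := Finset.mem_image.1 ha
      obtain ⟨z', hz', rfl⟩ := Finset.mem_image.1 hb
      rw [← h4]
      exact hsep z hz z' hz' (by rintro rfl; exact hab rfl)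
    · have hclose : ∀ a ∈ (F.filter fun z => z.1 = s).image fun z => c z.2,
          dist (c p) a ≤ 12 * 2 ^ (s - 2) := by
        intro a ha
        obtain ⟨z, hz, rfl⟩ := Finset.mem_image.1 ha
        obtain ⟨hz, hzs⟩ := Finset.mem_filter.1 hz
        obtain ⟨l, -, -, hd⟩ := hmem z hz
        rw [hzs, h5] at hd
        linarith
      intro a ha b hb
      have := dist_triangle_left a b (c p)
      linarith [hclose a ha, hclose b hb]
  have hsum : (F.card : ℝ) ≤ (F.image Prod.fst).card * e ^ 5 := by
    rw [Finset.card_eq_sum_card_image Prod.fst F, Nat.cast_sum, ← nsmul_eq_mul]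
    exact Finset.sum_le_card_nsmul _ _ _ hfib
  rw [hcard]
  refine hsum.trans ?_
  rw [mul_comm]
  refine mul_le_mul_of_nonneg_left ?_ (by positivity)
  exact le_trans (by exact_mod_cast Finset.card_le_card hsub) (card_nearScales_le he p T)

end NearLinks

/-! ### Sets of nodes on a level -/

namespace CTree

section LevelSet

variable {α : Type}

theorem expand_eq (z : WithBot ℤ) (R : List (CTree α)) :
    expand z R = R.flatMap fun t => if t.scale = z then t.children else [t] := by
  induction R with
  | nil => rfl
  | cons t ts ih => unfold expand; split_ifs with h <;> simp [h, ih]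

theorem scale_le_maxScale {R : List (CTree α)} {t : CTree α} (h : t ∈ R) :
    t.scale ≤ maxScale R := by
  induction R with
  | nil => simp at h
  | cons u us ih =>
    rcases List.mem_cons.1 h with rfl | h
    · exact le_max_left _ _
    · exact (ih h).trans (le_max_right _ _)

theorem maxScale_le {R : List (CTree α)} {z : WithBot ℤ} (h : ∀ t ∈ R, t.scale ≤ z) :
    maxScale R ≤ z := by
  induction R with
  | nil => exact bot_le
  | cons u us ih =>
    exact max_le (h u (by simp)) (ih fun t ht => h t (List.mem_cons_of_mem _ ht))

theorem exists_scale_eq_maxScale {R : List (CTree α)} (h : maxScale R ≠ ⊥) :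
    ∃ t ∈ R, t.scale = maxScale R := by
  by_contra! hc
  refine (h ?_).elim
  induction R with
  | nil => rfl
  | cons u us ih =>
    have h1 : u.scale ≤ maxScale us := by
      by_contra! h2
      exact hc u (by simp) (by simp [maxScale, h2.le])
    have h3 : maxScale (u :: us) = maxScale us := by simp [maxScale, h1]
    rw [h3] at h hc ⊢
    exact ih h fun t ht => hc t (List.mem_cons_of_mem _ ht)

theorem exists_node_of_maxScale {R : List (CTree α)} {z : ℤ} (h : maxScale R = z) :
    ∃ p cs, node p z cs ∈ R := by
  obtain ⟨t, ht, hs⟩ := exists_scale_eq_maxScale (R := R) (by simp [h])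
  rw [h] at hs
  cases t with
  | leaf p => simp at hs
  | node p s cs =>
    simp only [scale_node, WithBot.coe_inj] at hs
    exact ⟨p, cs, hs ▸ ht⟩

theorem flatMap_leaves_expand (z : ℤ) (R : List (CTree α)) :
    (expand z R).flatMap leaves = R.flatMap leaves := by
  rw [expand_eq, List.flatMap_assoc]
  congr 1
  funext t
  split_ifs with h
  · cases t with
    | leaf p => simp at h
    | node p s cs => simp
  · simp

/-- A set of parts of `T` with disjoint sets of points that are present on level `s - 1` and have
  scales below `s`. -/
structure LevelSet (T : CTree α) (s : ℤ) (R : List (CTree α)) : Prop where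
  top : ∀ t ∈ R, Top T (s - 1) t
  scale_lt : ∀ t ∈ R, t.scale < (s : WithBot ℤ)
  nodup : (R.flatMap leaves).Nodup

theorem LevelSet.sublist {T : CTree α} {s : ℤ} {R R' : List (CTree α)} (h : LevelSet T s R)
    (hR : R'.Sublist R) : LevelSet T s R' :=
  ⟨fun t ht => h.top t (hR.subset ht), fun t ht => h.scale_lt t (hR.subset ht),
    h.nodup.sublist (hR.flatMap leaves)⟩

theorem mem_expand {z : ℤ} {R : List (CTree α)} {t : CTree α} :
    t ∈ expand z R ↔ (t ∈ R ∧ t.scale ≠ z) ∨ ∃ p cs, node p z cs ∈ R ∧ t ∈ cs := by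
  rw [expand_eq, List.mem_flatMap]
  constructor
  · rintro ⟨u, hu, ht⟩
    split_ifs at ht with h
    · cases u with
      | leaf p => simp at ht
      | node p s cs =>
        simp only [scale_node, WithBot.coe_inj] at h
        subst h
        exact Or.inr ⟨p, cs, hu, ht⟩
    · rw [List.mem_singleton] at ht
      subst ht
      exact Or.inl ⟨hu, h⟩
  · rintro (⟨h, hz⟩ | ⟨p, cs, h, ht⟩)
    · exact ⟨t, h, by simp [hz]⟩
    · exact ⟨_, h, by simpa using ht⟩

variable {d : ℕ} {x : α → Pt d} {T : CTree α}

/-- As `z` is the largest scale, expanding all nodes of scale `z` leaves only smaller scales, and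
both the new children and the old nodes reach level `z - 1`. -/
theorem LevelSet.expand (h : LevelSet T s R) (hT : Loc x T) {z : ℤ} (hz : maxScale R = z) :
    LevelSet T z (expand z R) := by
  have hzs : z < s := by
    obtain ⟨p, cs, hn⟩ := exists_node_of_maxScale hz
    simpa using h.scale_lt _ hn
  refine ⟨fun t ht => ?_, fun t ht => ?_, by rw [flatMap_leaves_expand]; exact h.nodup⟩
  · rcases mem_expand.1 ht with ⟨ht, -⟩ | ⟨p, cs, hn, ht⟩
    · exact (h.top t ht).mono (by omega)
    · exact Or.inr ⟨z, mem_links.2 ⟨p, cs, (h.top _ hn).mem, ht⟩, by omega⟩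
  · rcases mem_expand.1 ht with ⟨ht, hne⟩ | ⟨p, cs, hn, ht⟩
    · exact lt_of_le_of_ne (hz ▸ scale_le_maxScale ht) hne
    · exact (hT.of_mem (h.top _ hn).mem).scale_lt ht

theorem LevelSet.children (hT : Cov x T) {p : α} {s : ℤ} {cs : List (CTree α)}
    (hn : CTree.node p s cs ∈ T.subtrees) : LevelSet T s cs :=
  ⟨fun t ht => Or.inr ⟨s, mem_links.2 ⟨p, cs, hn, ht⟩, by omega⟩,
    fun _ ht => (hT.loc.of_mem hn).scale_lt ht,
    by simpa using leaves_nodup_of_mem hn hT.nodup⟩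

theorem length_le_expand (hT : Loc x T) {R : List (CTree α)} (hR : ∀ t ∈ R, t ∈ T.subtrees)
    (z : ℤ) : R.length ≤ (CTree.expand z R).length := by
  induction R with
  | nil => simp
  | cons t ts ih =>
    have h1 := ih fun u hu => hR u (List.mem_cons_of_mem _ hu)
    unfold CTree.expand
    split_ifs with h
    · cases t with
      | leaf p => simp at h
      | node p s cs =>
        have := (hT.of_mem (hR (.node p s cs) (by simp))).two_le
        simp only [children_node, List.length_append, List.length_cons]
        omega
    · simp only [List.length_cons]; omega

theorem expand_length_le {M : ℝ} (hM : 1 ≤ M) {R : List (CTree α)} {z : ℤ}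
    (hR : ∀ t ∈ R, (t.children.length : ℝ) ≤ M) :
    ((CTree.expand z R).length : ℝ) ≤ M * R.length := by
  induction R with
  | nil => simp [CTree.expand]
  | cons t ts ih =>
    have h1 := ih fun u hu => hR u (List.mem_cons_of_mem _ hu)
    have h2 := hR t (by simp)
    unfold CTree.expand
    split_ifs with h
    · simp only [List.length_append, List.length_cons]; push_cast; linarith
    · simp only [List.length_cons]; push_cast; linarith

end LevelSet

end CTree

-- Nearest-neighbour search on the centroids.

section Nearest

variable {d k : ℕ} {c : Fin k → Pt d} {T : CTree (Fin k)}

/-- The points of a set of nodes on a level, as a subset of the set of centroids. -/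
theorem CTree.LevelSet.exists_finset (hT : Cov c T) {s : ℤ} {R : List (CTree (Fin k))}
    (h : LevelSet T s R) : ∃ A ⊆ Finset.univ.image c, A.card = R.length ∧
      (∀ a ∈ A, ∃ t ∈ R, c t.pt = a) ∧ ∀ a ∈ A, ∀ b ∈ A, a ≠ b → (2 : ℝ) ^ (s - 1) < dist a b := by
  classical
  have hnd : (R.map fun t => c t.pt).Nodup := by
    have h1 := h.nodup
    rw [List.nodup_flatMap] at h1
    rw [List.Nodup, List.pairwise_map]
    refine h1.2.imp_of_mem ?_
    intro a b ha hb hab he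
    rw [Function.onFun, List.disjoint_left] at hab
    have hla := (hT.loc.of_mem (h.top a ha).mem).pt_mem_leaves
    have hlb := (hT.loc.of_mem (h.top b hb).mem).pt_mem_leaves
    have := hT.injOn (leaves_subset (h.top a ha).mem hla) (leaves_subset (h.top b hb).mem hlb) he
    exact hab hla (this ▸ hlb)
  refine ⟨(R.map fun t => c t.pt).toFinset, fun a ha => ?_, ?_, fun a ha => ?_, ?_⟩
  · simp only [List.mem_toFinset, List.mem_map] at ha
    obtain ⟨t, -, rfl⟩ := ha
    exact mem_image_centroids c _
  · rw [List.toFinset_card_of_nodup hnd, List.length_map]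
  · simpa using ha
  · intro a ha b hb hab
    simp only [List.mem_toFinset, List.mem_map] at ha hb
    obtain ⟨t, ht, rfl⟩ := ha
    obtain ⟨u, hu, rfl⟩ := hb
    exact hT.separation _ _ _ (h.top t ht).onLevel (h.top u hu).onLevel
      fun h => hab (congrArg c h)

/-- A node of the tree on the centroids has few children. -/
theorem children_length_le (hT : Cov c T) {e : ℝ} (he : Doubling (Finset.univ.image c) e)
    {t : CTree (Fin k)} (ht : t ∈ T.subtrees) : (t.children.length : ℝ) ≤ e ^ 4 := by
  have he2 := he.two_le
  cases t with
  | leaf p => simp only [children_leaf, List.length_nil, Nat.cast_zero]; positivity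
  | node p s cs =>
    obtain ⟨A, hA, hcard, hmem, hsep⟩ := (LevelSet.children hT ht).exists_finset hT
    have h4 : (2 : ℝ) ^ (s - 1) = 2 * 2 ^ (s - 2) := by
      rw [← two_zpow_succ]; congr 1; ring
    have h5 : (2 : ℝ) ^ s = 4 * 2 ^ (s - 2) := by
      have : s = s - 1 + 1 := by ring
      conv_lhs => rw [this, two_zpow_succ, h4]
      ring
    have hpos : (0 : ℝ) < 2 ^ (s - 2) := by positivity
    rw [children_node, ← hcard]
    -- With `r = 2 ^ (s - 2)` all children lie within `4 * r` of `p`, and `8 + 1 ≤ 2 ^ 4`.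
    refine he.card_le hA hpos 4 (by rw [← h4]; exact hsep) ?_
    have hclose : ∀ a ∈ A, dist a (c p) ≤ 4 * 2 ^ (s - 2) := by
      intro a ha
      obtain ⟨t, ht', rfl⟩ := hmem a ha
      rw [← h5]
      exact (hT.loc.of_mem ht).covering ht'
    intro a ha b hb
    have := dist_triangle_right a b (c p)
    linarith [hclose a ha, hclose b hb]

/-- There are fewer internal nodes than points. -/
theorem countP_internal_le (hT : Cov c T) (G : Fin k → Bool) :
    T.subtrees.countP (fun u => decide (u.children ≠ []) && u.children.all fun v => G v.pt) ≤
      (Finset.univ.filter fun j => G j = true).card := by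
  classical
  have h1 := hT.loc.countP_internal G
  have h2 : T.leaves.countP G ≤ (Finset.univ.filter fun j => G j = true).card := by
    rw [List.countP_eq_length_filter,
      ← List.toFinset_card_of_nodup (hT.nodup.filter G)]
    refine Finset.card_le_card fun j hj => ?_
    simp only [List.mem_toFinset, List.mem_filter] at hj
    simp [hj.2]
  omega

theorem improve_le (j : Fin k) (R : List (CTree (Fin k))) (B : EReal) :
    improve c j R B ≤ B ∧ ∀ t ∈ R, improve c j R B ≤ neighborBound c j t := by
  induction R generalizing B with
  | nil => simp [improve]
  | cons t ts ih =>
    obtain ⟨h1, h2⟩ := ih (min B (neighborBound c j t))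
    simp only [improve]
    refine ⟨h1.trans (min_le_left _ _), fun u hu => ?_⟩
    rcases List.mem_cons.1 hu with rfl | hu
    · exact h1.trans (min_le_right _ _)
    · exact h2 u hu

/-- The invariants of a search for the nearest neighbour `y` of `j`. -/
structure SearchState (c : Fin k → Pt d) (T : CTree (Fin k)) (j y : Fin k)
    (Q : List (CTree (Fin k))) (B : EReal) : Prop where
  level : ∃ s, LevelSet T s Q
  near : ∀ t ∈ Q, ((dist (c j) (c t.pt) : ℝ) : EReal) ≤ B + ((t.radius : ℝ) : EReal)
  bound : ∀ t ∈ Q, B ≤ neighborBound c j t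
  found : B ≤ ((dist (c j) (c y) : ℝ) : EReal) ∨ y ∈ Q.flatMap leaves
  inner : (∀ t ∈ Q, t.scale ≠ ⊥) ∨ Q.length ≤ 1

theorem dist_le_of_mem_leaves (hT : Loc c T) {t : CTree (Fin k)} (ht : t ∈ T.subtrees)
    {y : Fin k} (hy : y ∈ t.leaves) (q : Pt d) :
    dist q (c t.pt) ≤ dist q (c y) + t.radius := by
  have := (hT.of_mem ht).dist_leaf hy
  exact (dist_triangle q (c y) _).trans (by linarith)

/-- The bound `B` exceeds `dist (c j) (c y)` by at most `2 * 2 ^ z`: it is already below that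
distance, or a node of the set contains `y` and has contributed to `B`. The radius of `t` adds
another `2 * 2 ^ z`. -/
theorem SearchState.dist_le (hT : Cov c T) {j y : Fin k} (hyj : y ≠ j)
    {Q : List (CTree (Fin k))} {B : EReal} (h : SearchState c T j y Q B) {z : ℤ}
    (hz : maxScale Q = z) {t : CTree (Fin k)} (ht : t ∈ Q) :
    dist (c j) (c t.pt) ≤ dist (c j) (c y) + 4 * 2 ^ z := by
  obtain ⟨s, hs⟩ := h.level
  have hpos : (0 : ℝ) < 2 ^ z := by positivity
  have hrad : ∀ a ∈ Q, a.radius ≤ 2 * 2 ^ z := fun a ha => by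
    rw [← two_zpow_succ]; exact radius_le_of_le (hz ▸ scale_le_maxScale ha)
  have hB : B ≤ ((dist (c j) (c y) + 2 * 2 ^ z : ℝ) : EReal) := by
    rcases h.found with h1 | h1
    · exact h1.trans (EReal.coe_le_coe_iff.2 (by linarith))
    · obtain ⟨a, ha, hya⟩ := List.mem_flatMap.1 h1
      refine (h.bound a ha).trans ?_
      have h2 := dist_le_of_mem_leaves hT.loc (hs.top a ha).mem hya (c j)
      have h3 := hrad a ha
      unfold neighborBound
      split_ifs with h4 h5
      · exact EReal.coe_le_coe_iff.2 (by linarith)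
      -- The value `⊤` occurs only for the leaf of `j`, which does not contain `y`.
      · exfalso
        cases a with
        | leaf p =>
          simp only [leaves_leaf, List.mem_singleton] at hya
          exact hyj (by simpa [hya] using h4)
        | node p s cs => simp at h5
      · exact EReal.coe_le_coe_iff.2 (by linarith [dist_nonneg (x := c j) (y := c y)])
  have h1 := (h.near t ht).trans (add_le_add_left hB _)
  rw [← EReal.coe_add, EReal.coe_le_coe_iff] at h1
  linarith [hrad t ht]

/-- The node that contains `y` passes the filter unless `B` has already come down to the distance of
`y`; a leaf holding `y` brings it down itself. -/
theorem SearchState.step (hT : Cov c T) {j y : Fin k} (hyj : y ≠ j)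
    {Q : List (CTree (Fin k))} {B : EReal} (h : SearchState c T j y Q B) {z : ℤ}
    (hz : maxScale Q = z) (f : CTree (Fin k) → Bool)
    (hf : ∀ t, f t = true ↔ t.scale ≠ ⊥ ∧ ((dist (c j) (c t.pt) : ℝ) : EReal) ≤
      improve c j (expand z Q) B + ((t.radius : ℝ) : EReal)) :
    SearchState c T j y ((expand z Q).filter f) (improve c j (expand z Q) B) := by
  obtain ⟨s, hs⟩ := h.level
  have hE := hs.expand hT.loc hz
  obtain ⟨h1, h2⟩ := improve_le (c := c) j (expand z Q) B
  refine ⟨⟨z, hE.sublist List.filter_sublist⟩, fun t ht => ?_, fun t ht => ?_, ?_, Or.inl ?_⟩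
  · exact ((hf t).1 (List.mem_filter.1 ht).2).2
  · exact h2 t (List.mem_filter.1 ht).1
  · rcases h.found with h3 | h3
    · exact Or.inl (h1.trans h3)
    · rw [← flatMap_leaves_expand z] at h3
      obtain ⟨a, ha, hya⟩ := List.mem_flatMap.1 h3
      by_cases hfa : f a = true
      · exact Or.inr (List.mem_flatMap.2 ⟨a, List.mem_filter.2 ⟨ha, hfa⟩, hya⟩)
      · left
        cases a with
        | leaf p =>
          simp only [leaves_leaf, List.mem_singleton] at hya
          subst hya
          have := h2 _ ha
          simpa [neighborBound, hyj] using this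
        | node p s' cs =>
          by_contra! hlt
          refine hfa ((hf _).2 ⟨by simp, ?_⟩)
          have h4 := dist_le_of_mem_leaves hT.loc (hE.top _ ha).mem hya (c j)
          refine le_trans ?_ (add_le_add_left hlt.le _)
          rw [← EReal.coe_add]
          exact EReal.coe_le_coe_iff.2 h4
  · intro t ht
    exact ((hf t).1 (List.mem_filter.1 ht).2).1

/-- A node whose children all belong to a neighbourhood of `j`. -/
noncomputable def closeNode (c : Fin k → Pt d) (q : Pt d) (r : ℝ) (t : CTree (Fin k)) : Bool :=
  decide (t.children ≠ []) && t.children.all fun v => decide (dist q (c v.pt) ≤ r)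

theorem closeNode_of_le (hT : Loc c T) {p : Fin k} {s : ℤ} {cs : List (CTree (Fin k))}
    (hn : node p s cs ∈ T.subtrees) {q : Pt d} {r : ℝ} (h : dist q (c p) + 2 ^ s ≤ r) :
    closeNode c q r (node p s cs) = true := by
  have hl := hT.of_mem hn
  simp only [closeNode, Bool.and_eq_true, decide_eq_true_eq, List.all_eq_true]
  refine ⟨?_, fun v hv => ?_⟩
  · rintro rfl
    simpa using hl.two_le
  · have h1 := hl.covering hv
    have h2 := dist_triangle_right q (c v.pt) (c p)
    linarith

/-- What bounds the number of further rounds of a search. -/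
noncomputable def searchPotential (c : Fin k → Pt d) (T : CTree (Fin k)) (j y : Fin k)
    (m : WithBot ℤ) : ℕ :=
  ((nearScales c j T).filter fun s : ℤ => (s : WithBot ℤ) ≤ m).card +
    T.subtrees.countP fun t =>
      closeNode c (c j) (3 * dist (c j) (c y)) t && decide (t.scale ≤ m)

theorem searchPotential_mono {j y : Fin k} {m m' : WithBot ℤ} (h : m ≤ m') :
    searchPotential c T j y m ≤ searchPotential c T j y m' := by
  refine Nat.add_le_add (Finset.card_le_card fun s hs => ?_) (List.countP_mono_left ?_)
  · simp only [Finset.mem_filter] at hs ⊢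
    exact ⟨hs.1, hs.2.trans h⟩
  · simp only [Bool.and_eq_true, decide_eq_true_eq]
    exact fun t _ ht => ⟨ht.1, ht.2.trans h⟩

/-- Each round costs at most `4 * e ^ 7` and uses up at least one unit of the potential; the case
split compares the current scale with the nearest-neighbour distance `δ`. -/
theorem nearest_time (hT : Cov c T) {e : ℝ} (he : Doubling (Finset.univ.image c) e)
    {j y : Fin k} (hyj : y ≠ j)
    (hy : ∀ z ∈ Finset.univ.image c, z ≠ c j → dist (c j) (c y) ≤ dist (c j) z)
    (Q : List (CTree (Fin k))) (B : EReal) (h : SearchState c T j y Q B) :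
    ((nearest c j Q B).2 : ℝ) ≤ 4 * e ^ 7 * searchPotential c T j y (maxScale Q) + 2 := by
  induction hN : numNodesList Q using Nat.strong_induction_on generalizing Q B with
  | _ N ih =>
  have he2 := he.two_le
  rw [nearest]
  split_ifs with hb
  · have : Q.length ≤ 1 := by
      rcases h.inner with h1 | h1
      · rcases Q with _ | ⟨t, ts⟩
        · simp
        · have h2 := scale_le_maxScale (R := t :: ts) (t := t) (by simp)
          rw [hb, le_bot_iff] at h2
          exact absurd h2 (h1 t (by simp))
      · exact h1
    have h1 : ((Q.length + 1 : ℕ) : ℝ) ≤ 2 := by exact_mod_cast Nat.succ_le_succ this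
    have h2 : 0 ≤ 4 * e ^ 7 * (searchPotential c T j y (maxScale Q) : ℝ) := by positivity
    simp only
    linarith
  · obtain ⟨z, hz⟩ := WithBot.ne_bot_iff_exists.1 hb
    have hz := hz.symm
    obtain ⟨s, hs⟩ := h.level
    set δ := dist (c j) (c y) with hδ
    have hlt := numNodesList_expand_lt Q hb
    simp only [hz] at hlt ⊢
    set E := expand (z : WithBot ℤ) Q with hEdef
    set f : CTree (Fin k) → Bool := fun t => decide (t.scale ≠ ⊥ ∧
      ((dist (c j) (c t.pt) : ℝ) : EReal) ≤ improve c j E B + ((t.radius : ℝ) : EReal)) with hf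
    have hstep := h.step hT hyj hz f fun t => by simp [hf, hEdef]
    have hrec := ih _ (hN ▸ (numNodesList_filter_le f E).trans_lt hlt) _ _ hstep rfl
    have hE := hs.expand hT.loc hz
    have hpos : (0 : ℝ) < 2 ^ (z - 2) := by positivity
    have h4 : (2 : ℝ) ^ (z - 1) = 2 * 2 ^ (z - 2) := by
      rw [← two_zpow_succ]; congr 1; ring
    have h5 : (2 : ℝ) ^ z = 4 * 2 ^ (z - 2) := by
      have : z = z - 1 + 1 := by ring
      conv_lhs => rw [this, two_zpow_succ, h4]
      ring
    have hQd : ∀ t ∈ Q, dist (c j) (c t.pt) ≤ δ + 4 * 2 ^ z := fun t ht =>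
      h.dist_le hT hyj hz ht
    have hEd : ∀ t ∈ E, dist (c j) (c t.pt) ≤ δ + 5 * 2 ^ z := by
      intro t ht
      rcases mem_expand.1 ht with ⟨ht, -⟩ | ⟨p, cs, hn, ht⟩
      · linarith [hQd t ht]
      · have h6 := hQd _ hn
        have h7 := (hT.loc.of_mem (hs.top _ hn).mem).covering ht
        have h8 := dist_triangle_right (c j) (c t.pt) (c p)
        simp only [pt_node] at h6
        linarith
    obtain ⟨p, cs, hn⟩ := exists_node_of_maxScale hz
    have hnT := (hs.top _ hn).mem
    obtain ⟨A, hA, hcard, hmem, hsep⟩ := hE.exists_finset hT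
    have hnd := hQd _ hn
    simp only [pt_node] at hnd
    -- For `δ ≤ 4 * 2 ^ z` this is packing with `r = 2 ^ (z - 2)`: the diameter is at most `18 * 2 ^
    -- z = 72 * r`, and `73 ≤ 2 ^ 7`. Otherwise everything lies within `9/4 * δ < 4 * δ` of `c j`,
    -- where there are at most `e ^ 2` centroids.
    have hEle : (E.length : ℝ) ≤ e ^ 7 := by
      rw [← hcard]
      have hAd : ∀ a ∈ A, dist (c j) a ≤ δ + 5 * 2 ^ z := by
        intro a ha
        obtain ⟨t, ht, rfl⟩ := hmem a ha
        exact hEd t ht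
      by_cases hcase : δ ≤ 4 * 2 ^ z
      · refine he.card_le hA hpos 7 (by rw [← h4]; exact hsep) fun a ha b hb => ?_
        have h6 := dist_triangle_left a b (c j)
        linarith [hAd a ha, hAd b hb]
      · push Not at hcase
        have h6 := he.ballCount_le (mem_image_centroids c j) (δ := δ) (D := δ + 5 * 2 ^ z) 2
          (fun z hz hne => hy z hz hne) (by linarith)
        have h7 : A.card ≤ ballCount (Finset.univ.image c) (c j) (δ + 5 * 2 ^ z) := by
          refine Finset.card_le_card fun a ha => ?_
          simp only [Finset.mem_filter]
          exact ⟨hA ha, hAd a ha⟩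
        have h8 : e ^ 2 ≤ e ^ 7 := pow_le_pow_right₀ (by linarith) (by norm_num)
        exact le_trans (by exact_mod_cast h7) (h6.trans h8)
    -- If `δ ≤ 4 * 2 ^ z`, the expanded node is within `8 * 2 ^ z` of `c j`, so the scale `z` is
    -- near and drops out. Otherwise its children are within `δ + 5 * 2 ^ z ≤ 3 * δ`, so the node is
    -- counted by `closeNode` and drops out.
    have hpot : searchPotential c T j y (maxScale (E.filter f)) + 1 ≤
        searchPotential c T j y z := by
      have hm : maxScale (E.filter f) ≤ ((z - 1 : ℤ) : WithBot ℤ) := by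
        refine maxScale_le fun t ht => ?_
        have h6 := hE.scale_lt t (List.mem_filter.1 ht).1
        cases t with
        | leaf p => simp
        | node p s cs =>
          simp only [scale_node, WithBot.coe_lt_coe, WithBot.coe_le_coe] at h6 ⊢
          omega
      refine le_trans (Nat.add_le_add_right (searchPotential_mono hm) 1) ?_
      unfold searchPotential
      by_cases hcase : δ ≤ 4 * 2 ^ z
      · have hzn := mem_nearScales hT j hnT (by linarith)
        have h6 : ((nearScales c j T).filter fun s : ℤ => (s : WithBot ℤ) ≤ ((z - 1 : ℤ) : WithBot ℤ)).card
            < ((nearScales c j T).filter fun s : ℤ => (s : WithBot ℤ) ≤ (z : WithBot ℤ)).card := by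
          refine Finset.card_lt_card (Finset.ssubset_iff_of_subset ?_ |>.2 ⟨z, ?_, ?_⟩)
          · intro s hs
            simp only [Finset.mem_filter, WithBot.coe_le_coe] at hs ⊢
            exact ⟨hs.1, by omega⟩
          · simp [hzn]
          · simp
        have h7 : T.subtrees.countP (fun t => closeNode c (c j) (3 * dist (c j) (c y)) t &&
            decide (t.scale ≤ ((z - 1 : ℤ) : WithBot ℤ))) ≤ T.subtrees.countP (fun t =>
            closeNode c (c j) (3 * dist (c j) (c y)) t &&
            decide (t.scale ≤ (z : WithBot ℤ))) := by
          refine List.countP_mono_left ?_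
          simp only [Bool.and_eq_true, decide_eq_true_eq]
          exact fun t _ ht => ⟨ht.1, ht.2.trans (by rw [WithBot.coe_le_coe]; omega)⟩
        omega
      · push Not at hcase
        have h6 : ((nearScales c j T).filter fun s : ℤ => (s : WithBot ℤ) ≤ ((z - 1 : ℤ) : WithBot ℤ)).card
            ≤ ((nearScales c j T).filter fun s : ℤ => (s : WithBot ℤ) ≤ (z : WithBot ℤ)).card := by
          refine Finset.card_le_card fun s hs => ?_
          simp only [Finset.mem_filter, WithBot.coe_le_coe] at hs ⊢
          exact ⟨hs.1, by omega⟩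
        have hclose := closeNode_of_le hT.loc hnT (q := c j) (r := 3 * dist (c j) (c y))
          (by linarith)
        have h7 := countP_lt_countP (l := T.subtrees)
          (f := fun t => closeNode c (c j) (3 * dist (c j) (c y)) t &&
            decide (t.scale ≤ ((z - 1 : ℤ) : WithBot ℤ)))
          (g := fun t => closeNode c (c j) (3 * dist (c j) (c y)) t &&
            decide (t.scale ≤ (z : WithBot ℤ)))
          (fun t _ ht => by
            simp only [Bool.and_eq_true, decide_eq_true_eq] at ht ⊢
            exact ⟨ht.1, ht.2.trans (by rw [WithBot.coe_le_coe]; omega)⟩)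
          hnT (by simp [hclose]) (by simp)
        omega
    have hQE : Q.length ≤ E.length := length_le_expand hT.loc (fun t ht => (hs.top t ht).mem) z
    have hQ1 : 1 ≤ Q.length := List.length_pos_of_mem hn
    have hcost : ((Q.length + 2 * E.length + 1 : ℕ) : ℝ) ≤ 4 * e ^ 7 := by
      have : Q.length + 2 * E.length + 1 ≤ 4 * E.length := by omega
      calc ((Q.length + 2 * E.length + 1 : ℕ) : ℝ) ≤ ((4 * E.length : ℕ) : ℝ) := by
            exact_mod_cast this
        _ ≤ 4 * e ^ 7 := by push_cast; linarith
    have hpot' : (searchPotential c T j y (maxScale (E.filter f)) : ℝ) + 1 ≤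
        searchPotential c T j y z := by exact_mod_cast hpot
    have h9 : 0 ≤ 4 * e ^ 7 := by positivity
    have h10 := mul_le_mul_of_nonneg_left hpot' h9
    push_cast at hcost ⊢
    linarith

theorem half_le_log {k : ℕ} (hk : 2 ≤ k) : 1 / 2 ≤ Real.log k := by
  have h1 := Real.log_two_gt_d9
  have h2 : Real.log 2 ≤ Real.log k := Real.log_le_log (by norm_num) (by exact_mod_cast hk)
  linarith

theorem log_natCast_nonneg (k : ℕ) : 0 ≤ Real.log k := Real.log_natCast_nonneg k

/-- The scales contribute `16 * e ^ 2 * log k`. The internal nodes inside the ball of radius `3 * δ`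
are at most `e ^ 2`, which is at most `2 * e ^ 2 * log k` because `k ≥ 2`. -/
theorem searchPotential_le (hT : Cov c T) {e : ℝ} (he : Doubling (Finset.univ.image c) e)
    {j y : Fin k} (hyj : y ≠ j) (hyT : y ∈ T.leaves) (hjT : j ∈ T.leaves)
    (hy : ∀ z ∈ Finset.univ.image c, z ≠ c j → dist (c j) (c y) ≤ dist (c j) z)
    (hc : ∀ q ∈ T.leaves, ∀ q' ∈ T.leaves, c q = c q' → q = q')
    (m : WithBot ℤ) :
    (searchPotential c T j y m : ℝ) ≤ 18 * e ^ 2 * Real.log k := by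
  classical
  have he2 := he.two_le
  have hk : 2 ≤ k := by
    have h1 := y.isLt
    have h2 := j.isLt
    have h3 : (y : ℕ) ≠ j := fun h => hyj (Fin.ext h)
    omega
  have h1 : ((nearScales c j T).filter fun s : ℤ => (s : WithBot ℤ) ≤ m).card ≤
      (nearScales c j T).card := Finset.card_filter_le _ _
  have h2 := card_nearScales_le he j T
  have h3 : T.subtrees.countP (fun t => closeNode c (c j) (3 * dist (c j) (c y)) t &&
      decide (t.scale ≤ m)) ≤
      T.leaves.countP fun q => decide (dist (c j) (c q) ≤ 3 * dist (c j) (c y)) := by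
    have h4 := hT.loc.countP_internal fun q => decide (dist (c j) (c q) ≤ 3 * dist (c j) (c y))
    refine le_trans (List.countP_mono_left ?_) ((Nat.le_add_right _ _).trans h4)
    simp only [Bool.and_eq_true]
    exact fun t _ ht => by simpa [closeNode] using ht.1
  have h5 : T.leaves.countP (fun q => decide (dist (c j) (c q) ≤ 3 * dist (c j) (c y))) ≤
      ballCount (Finset.univ.image c) (c j) (3 * dist (c j) (c y)) := by
    rw [List.countP_eq_length_filter, ← List.toFinset_card_of_nodup (hT.nodup.filter _),
      ← Finset.card_image_of_injOn (f := c)]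
    · refine Finset.card_le_card fun z hz => ?_
      simp only [Finset.mem_image, List.mem_toFinset, List.mem_filter, decide_eq_true_eq] at hz
      obtain ⟨q, hq, rfl⟩ := hz
      simp only [Finset.mem_filter]
      exact ⟨mem_image_centroids c q, hq.2⟩
    · intro q hq q' hq' hqq
      simp only [Finset.mem_coe, List.mem_toFinset, List.mem_filter] at hq hq'
      exact hc q hq.1 q' hq'.1 hqq
  have hpos := hT.dist_pos hjT hyT hyj.symm
  have h6 := he.ballCount_le (mem_image_centroids c j) (δ := dist (c j) (c y))
    (D := 3 * dist (c j) (c y)) 2 hy (by linarith)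
  have h7 : (searchPotential c T j y m : ℝ) ≤ (nearScales c j T).card +
      ballCount (Finset.univ.image c) (c j) (3 * dist (c j) (c y)) := by
    unfold searchPotential
    exact_mod_cast Nat.add_le_add h1 (h3.trans h5)
  have h8 := half_le_log hk
  have h9 : 0 < e ^ 2 := by positivity
  nlinarith

/-- The search for the nearest neighbour of a centroid. -/
theorem nearest_root_time (hT : Cov c T) {e : ℝ} (he : Doubling (Finset.univ.image c) e)
    {j : Fin k} (hj : j ∈ T.leaves) (hall : ∀ q, ∃ q' ∈ T.leaves, c q' = c q) :
    ((nearest c j [T] (neighborBound c j T)).2 : ℝ) ≤ 72 * e ^ 9 * Real.log k + 2 := by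
  classical
  have he2 := he.two_le
  have hlog := log_natCast_nonneg k
  by_cases hone : ∃ q ∈ T.leaves, q ≠ j
  · obtain ⟨y, hy, hmin⟩ := (T.leaves.toFinset.filter (· ≠ j)).exists_min_image
      (fun q => dist (c j) (c q)) (by
        obtain ⟨q, hq, hqj⟩ := hone
        exact ⟨q, by simp [hq, hqj]⟩)
    simp only [Finset.mem_filter, List.mem_toFinset] at hy hmin
    have hyS : ∀ z ∈ Finset.univ.image c, z ≠ c j → dist (c j) (c y) ≤ dist (c j) z := by
      intro z hz hzj
      obtain ⟨q, -, rfl⟩ := Finset.mem_image.1 hz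
      obtain ⟨q', hq', hqq⟩ := hall q
      rw [← hqq] at hzj ⊢
      exact hmin q' ⟨hq', fun h => hzj (congrArg c h)⟩
    have hstate : SearchState c T j y [T] (neighborBound c j T) := by
      have hroot : ∃ s : ℤ, T.scale < s := by
        cases T with
        | leaf p => exact ⟨0, by simp⟩
        | node p s cs => exact ⟨s + 1, by rw [scale_node, WithBot.coe_lt_coe]; omega⟩
      obtain ⟨s, hs⟩ := hroot
      refine ⟨⟨s, fun t ht => Or.inl (by simpa using ht), by simpa using hs,
        by simpa using hT.nodup⟩, ?_, by simp, Or.inr (by simpa using hy.1), Or.inr (by simp)⟩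
      simp only [List.mem_singleton, forall_eq]
      have hr := radius_nonneg T
      unfold neighborBound
      split_ifs with h1 h2
      · rw [← EReal.coe_add]
        exact EReal.coe_le_coe_iff.2 (by linarith)
      · rw [EReal.top_add_coe]; exact le_top
      · rw [← EReal.coe_add]
        have h3 := hT.loc.dist_leaf hj
        exact EReal.coe_le_coe_iff.2 (by linarith)
    have h1 := nearest_time hT he hy.2 hyS _ _ hstate
    have h2 := searchPotential_le hT he hy.2 hy.1 hj hyS (fun q hq q' hq' h => hT.injOn hq hq' h)
      (maxScale [T])
    have h3 : 4 * e ^ 7 * (searchPotential c T j y (maxScale [T]) : ℝ) ≤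
        4 * e ^ 7 * (18 * e ^ 2 * Real.log k) :=
      mul_le_mul_of_nonneg_left h2 (by positivity)
    have h4 : 4 * e ^ 7 * (18 * e ^ 2 * Real.log k) = 72 * e ^ 9 * Real.log k := by ring
    linarith
  · push Not at hone
    have hleaf : T = leaf j := by
      cases T with
      | leaf p => simpa using (hone p (by simp))
      | node p s cs =>
        obtain ⟨u, hu, hup, h1, h2, -⟩ := hT.exists_pair (self_mem_subtrees _)
        exact absurd ((hone _ h2).trans (hone _ h1).symm) hup
    subst hleaf
    rw [nearest, dif_pos (by simp [maxScale])]
    have : 0 ≤ 72 * e ^ 9 * Real.log k := by positivity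
    simp only [List.length_singleton]
    push_cast
    linarith

theorem nearestList_time {B : Built k} {W : ℝ} (hW : 1 ≤ W)
    (h : ∀ j, B.twins j = false →
      ((nearest c j [B.tree] (neighborBound c j B.tree)).2 : ℝ) ≤ W) (js : List (Fin k))
    (f : Fin k → EReal) : ((nearestList c B js f).2 : ℝ) ≤ js.length * (W + 1) := by
  induction js generalizing f with
  | nil => simp [nearestList]
  | cons j js ih =>
    simp only [nearestList, List.length_cons]
    push_cast
    split_ifs with h1
    · have := ih (Function.update f j 0)
      simp only
      push_cast
      linarith
    · have h2 := h j (by simpa using h1)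
      have := ih (Function.update f j (nearest c j [B.tree] (neighborBound c j B.tree)).1)
      linarith

-- Total time for the work on the centroids.

theorem exists_nearLinks_bound (c : Fin k → Pt d) {e : ℝ}
    (he : Doubling (Finset.univ.image c) e) :
    ∃ W : ℕ, (W : ℝ) ≤ 16 * e ^ 7 * Real.log k ∧
      ∀ T : CTree (Fin k), Cov c T → ∀ p, nearLinks c p T ≤ W := by
  have he2 := he.two_le
  have hlog := log_natCast_nonneg k
  refine ⟨⌊16 * e ^ 7 * Real.log k⌋₊, Nat.floor_le (by positivity), fun T hT p => ?_⟩
  refine Nat.le_floor ((nearLinks_le hT he p).trans (le_of_eq (by ring)))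

/-- From `log k ≥ 1 - 1 / k`. For `k = 1` both sides vanish, so bounds in terms of `k * log k` carry
an additive constant. -/
theorem natCast_sub_one_le (k : ℕ) [NeZero k] : (k : ℝ) - 1 ≤ k * Real.log k := by
  have hk : (1 : ℝ) ≤ k := by exact_mod_cast NeZero.one_le
  have h1 := Real.one_sub_inv_le_log_of_pos (x := k) (by linarith)
  have h2 := mul_le_mul_of_nonneg_left h1 (show (0 : ℝ) ≤ k by linarith)
  rwa [mul_sub, mul_inv_cancel₀ (by linarith), mul_one] at h2

theorem buildTree_time [NeZero k] (c : Fin k → Pt d) {e : ℝ}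
    (he : Doubling (Finset.univ.image c) e) :
    ((buildTree c).2 : ℝ) ≤ 80 * e ^ 9 * (k * Real.log k) + 1 := by
  have he2 := he.two_le
  have hlog := log_natCast_nonneg k
  obtain ⟨W, hW, hW'⟩ := exists_nearLinks_bound c he
  obtain ⟨-, -, h1⟩ := buildTree_spec hW'
  have hk1 : 1 ≤ k := NeZero.one_le
  have hk : (1 : ℝ) ≤ k := by exact_mod_cast hk1
  have h2 : ((buildTree c).2 : ℝ) ≤ (k - 1) * (3 + 4 * W) + k := by
    have h3 : ((buildTree c).2 : ℝ) ≤ (((k - 1) * (3 + 4 * W) + k : ℕ) : ℝ) := by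
      exact_mod_cast h1
    push_cast [Nat.cast_sub hk1] at h3
    exact h3
  have h3 := natCast_sub_one_le k
  have h4 : (1 : ℝ) ≤ e ^ 2 := one_le_pow₀ (by linarith)
  have h5 : (1 : ℝ) ≤ e ^ 9 := one_le_pow₀ (by linarith)
  have h6 : e ^ 7 ≤ e ^ 9 := pow_le_pow_right₀ (by linarith) (by norm_num)
  have h7 : ((k : ℝ) - 1) * W ≤ k * (16 * e ^ 9 * Real.log k) := by
    refine mul_le_mul (by linarith) (hW.trans ?_) (Nat.cast_nonneg _) (by linarith)
    gcongr
  have h8 : (k : ℝ) * Real.log k ≤ e ^ 9 * (k * Real.log k) :=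
    le_mul_of_one_le_left (by positivity) h5
  nlinarith

/-- Updated centroids may coincide. One that is missing from the tree is marked as a twin and
answered in one step; all the others are leaves, so the search bound applies to them. -/
theorem allNearest_time [NeZero k] (c : Fin k → Pt d) {e : ℝ}
    (he : Doubling (Finset.univ.image c) e) :
    ((allNearest c).2 : ℝ) ≤ 160 * e ^ 9 * (k * Real.log k) + 4 := by
  have he2 := he.two_le
  have hlog := log_natCast_nonneg k
  obtain ⟨W, hW, hW'⟩ := exists_nearLinks_bound c he
  obtain ⟨h1, h2, -⟩ := buildTree_spec hW'
  have hall : ∀ q, ∃ q' ∈ (buildTree c).1.tree.leaves, c q' = c q := fun q => by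
    rcases h2 q with h3 | h3
    · exact ⟨q, h3, rfl⟩
    · exact h3.2
  have hk : (1 : ℝ) ≤ k := by exact_mod_cast NeZero.one_le
  have h5 : (1 : ℝ) ≤ e ^ 9 := one_le_pow₀ (by linarith)
  have h3 := nearestList_time (c := c) (B := (buildTree c).1) (W := 72 * e ^ 9 * Real.log k + 2)
    (by have : 0 ≤ 72 * e ^ 9 * Real.log k := by positivity
        linarith)
    (fun j hj => nearest_root_time h1 he ((h2 j).resolve_right (by simp [hj])) hall)
    (List.finRange k) (fun _ => ⊤)
  have h4 := buildTree_time c he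
  have h6 := natCast_sub_one_le k
  have h8 : (k : ℝ) * Real.log k ≤ e ^ 9 * (k * Real.log k) :=
    le_mul_of_one_le_left (by positivity) h5
  simp only [allNearest]
  rw [List.length_finRange] at h3
  push_cast
  nlinarith

end Nearest

/-! ### Query trees -/

section Query

variable {d N k : ℕ} {x : Fin N → Pt d}

theorem CTree.length_subtrees {α : Type} (t : CTree α) : t.subtrees.length = t.numNodes := by
  induction t using induct with
  | leaf p => simp
  | node p s cs ih =>
    simp only [subtrees_node, List.length_cons, List.length_flatMap, numNodes_node]
    rw [List.map_congr_left ih, add_comm]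

/-- The points below the node of `T` that is called `a`. -/
def below (T : CTree (Fin N)) (a : Key N) : Set (Fin N) :=
  {p | ∃ t ∈ T.subtrees, t.key = a ∧ p ∈ t.leaves}

theorem mem_below {T : CTree (Fin N)} (hT : Cov x T) {t : CTree (Fin N)} (ht : t ∈ T.subtrees)
    {p : Fin N} : p ∈ below T t.key ↔ p ∈ t.leaves := by
  constructor
  · rintro ⟨u, hu, hk, hp⟩
    rwa [← List.inj_on_of_nodup_map (hT.loc.keys_nodup hT.nodup) hu ht hk]
  · exact fun hp => ⟨t, ht, rfl, hp⟩

theorem below_subset {T : CTree (Fin N)} (hT : Cov x T) {t u : CTree (Fin N)}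
    (ht : t ∈ T.subtrees) (hu : u ∈ t.subtrees) : below T u.key ⊆ below T t.key := by
  intro p hp
  rw [mem_below hT ht]
  rw [mem_below hT (subtrees_trans ht hu)] at hp
  exact leaves_subset hu hp

/-- What the traversal uses of a query tree, in which some nodes may have been removed; `D` gives
  the points that a node stands for. -/
inductive QTree (x : Fin N → Pt d) (D : Key N → Set (Fin N)) : CTree (Fin N) → Prop
  | leaf (p : Fin N) (mem : p ∈ D (p, ⊥)) (eq : ∀ q ∈ D (p, ⊥), q = p) : QTree x D (leaf p)
  | node (p : Fin N) (s : ℤ) (cs : List (CTree (Fin N))) (mem : p ∈ D (p, (s : WithBot ℤ)))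
      (dist_le : ∀ q ∈ D (p, (s : WithBot ℤ)), dist (x q) (x p) ≤ (2 : ℝ) ^ (s + 1))
      (scale_lt : ∀ t ∈ cs, t.scale < (s : WithBot ℤ))
      (subset : ∀ t ∈ cs, D t.key ⊆ D (p, (s : WithBot ℤ))) (sub : ∀ t ∈ cs, QTree x D t) :
      QTree x D (node p s cs)

theorem QTree.pt_mem {D : Key N → Set (Fin N)} {t : CTree (Fin N)} (h : QTree x D t) :
    t.pt ∈ D t.key := by
  cases h <;> assumption

theorem QTree.dist_le {D : Key N → Set (Fin N)} {t : CTree (Fin N)} (h : QTree x D t)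
    {q : Fin N} (hq : q ∈ D t.key) : dist (x q) (x t.pt) ≤ t.radius := by
  cases h with
  | leaf p _ heq => rw [heq q hq]; simp
  | node p s cs _ hd => exact hd q hq

theorem QTree.inv {D : Key N → Set (Fin N)} {p : Fin N} {s : ℤ} {cs : List (CTree (Fin N))}
    (h : QTree x D (CTree.node p s cs)) : (∀ t ∈ cs, t.scale < (s : WithBot ℤ)) ∧
      (∀ t ∈ cs, D t.key ⊆ D (p, (s : WithBot ℤ))) ∧ ∀ t ∈ cs, QTree x D t := by
  cases h with
  | node _ _ _ _ _ h1 h2 h3 => exact ⟨h1, h2, h3⟩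

/-- The share of a non-root node, given with the scale of its parent, in the bound for the
  running time. -/
noncomputable def linkCost (T : CTree (Fin N)) (l : ℤ × CTree (Fin N)) : ℕ :=
  T.nodeImbalance l.1 l.2 + 1

/-- The share of a subtree whose parent has scale `sp`. -/
noncomputable def subtreeCost (T : CTree (Fin N)) (sp : ℤ) (t : CTree (Fin N)) : ℕ :=
  linkCost T (sp, t) + (t.links.map (linkCost T)).sum

theorem sum_linkCost_node (T : CTree (Fin N)) (p : Fin N) (s : ℤ) (cs : List (CTree (Fin N))) :
    ((node p s cs).links.map (linkCost T)).sum = (cs.map (subtreeCost T s)).sum := by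
  rw [links_node]
  induction cs with
  | nil => rfl
  | cons t ts ih =>
    rw [List.flatMap_cons, List.map_append, List.sum_append, ih, List.map_cons, List.sum_cons]
    rfl

/-- Up to truncation the cost of a link is a difference of scales, hence additive along a path. So
contracting a node with one remaining child does not raise the total. -/
theorem linkCost_le {T : CTree (Fin N)} {sp s : ℤ} (hs : s < sp) {t : CTree (Fin N)}
    (ht : t.scale < (s : WithBot ℤ)) (p : Fin N) (cs : List (CTree (Fin N))) :
    linkCost T (sp, t) ≤ linkCost T (sp, node p s cs) + linkCost T (s, t) := by
  unfold linkCost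
  cases t with
  | leaf q => simp only [nodeImbalance]; omega
  | node q z ds =>
    rw [scale_node, WithBot.coe_lt_coe] at ht
    simp only [nodeImbalance]
    omega

/-- What coalescing does to a subtree of `T`. -/
structure CoalesceSpec (x : Fin N → Pt d) (T t t' : CTree (Fin N)) : Prop where
  keys : (t'.subtrees.map key).Sublist (t.subtrees.map key)
  leaves : t'.leaves.Sublist t.leaves
  scale_le : t'.scale ≤ t.scale
  cost : ∀ sp : ℤ, t.scale < (sp : WithBot ℤ) → subtreeCost T sp t' ≤ subtreeCost T sp t
  query : QTree x (below T) t'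

theorem CoalesceSpec.below_subset {T t t' : CTree (Fin N)} (h : CoalesceSpec x T t t')
    (hT : Cov x T) (ht : t ∈ T.subtrees) : below T t'.key ⊆ below T t.key := by
  have h1 := h.keys.subset (List.mem_map_of_mem (self_mem_subtrees t'))
  obtain ⟨u, hu, hk⟩ := List.mem_map.1 h1
  rw [← hk]
  exact DualTree.below_subset hT ht hu

theorem node_below {T : CTree (Fin N)} (hT : Cov x T) {p : Fin N} {s : ℤ}
    {cs : List (CTree (Fin N))} (hn : node p s cs ∈ T.subtrees) :
    p ∈ below T (p, (s : WithBot ℤ)) ∧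
      ∀ q ∈ below T (p, (s : WithBot ℤ)), dist (x q) (x p) ≤ (2 : ℝ) ^ (s + 1) := by
  have hl := hT.loc.of_mem hn
  have hk : (node p s cs).key = (p, (s : WithBot ℤ)) := rfl
  refine ⟨?_, fun q hq => ?_⟩
  · rw [← hk, mem_below hT hn]; exact hl.pt_mem_leaves
  · rw [← hk, mem_below hT hn] at hq
    exact hl.dist_leaf hq

/-- What coalescing does to a list of siblings. -/
structure CoalesceListSpec (x : Fin N → Pt d) (T : CTree (Fin N)) (s : ℤ)
    (l l' : List (CTree (Fin N))) : Prop where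
  keys : ((l'.flatMap subtrees).map key).Sublist ((l.flatMap subtrees).map key)
  leaves : (l'.flatMap leaves).Sublist (l.flatMap leaves)
  cost : (l'.map (subtreeCost T s)).sum ≤ (l.map (subtreeCost T s)).sum
  sub : ∀ t' ∈ l', ∃ t ∈ l, CoalesceSpec x T t t'

theorem coalesceList_spec {T : CTree (Fin N)} (σ : State N k) {s : ℤ}
    (l : List (CTree (Fin N))) (hs : ∀ t ∈ l, t.scale < (s : WithBot ℤ))
    (h : ∀ t ∈ l, CoalesceSpec x T t (coalesce σ t).1 ∧
      (coalesce σ t).2 + 1 ≤ 2 * t.numNodes) :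
    CoalesceListSpec x T s l (coalesceList σ l).1 ∧
      (coalesceList σ l).2 ≤ 2 * (l.map numNodes).sum := by
  induction l with
  | nil => simp only [coalesceList]; exact ⟨⟨by simp, by simp, by simp, by simp⟩, by simp⟩
  | cons t ts ih =>
    obtain ⟨h1, h2⟩ := ih (fun u hu => hs u (List.mem_cons_of_mem _ hu))
      fun u hu => h u (List.mem_cons_of_mem _ hu)
    obtain ⟨h3, h4⟩ := h t (by simp)
    simp only [coalesceList, List.map_cons, List.sum_cons]
    split_ifs with hc
    · refine ⟨⟨?_, ?_, ?_, fun t' ht' => ?_⟩, ?_⟩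
      · rw [List.flatMap_cons, List.map_append]
        exact h1.keys.trans (List.sublist_append_right _ _)
      · rw [List.flatMap_cons]
        exact h1.leaves.trans (List.sublist_append_right _ _)
      · simp only [List.map_cons, List.sum_cons]
        exact h1.cost.trans (Nat.le_add_left _ _)
      · obtain ⟨u, hu, h5⟩ := h1.sub t' ht'
        exact ⟨u, List.mem_cons_of_mem _ hu, h5⟩
      · simp only; omega
    · refine ⟨⟨?_, ?_, ?_, fun t' ht' => ?_⟩, ?_⟩
      · simp only [List.flatMap_cons, List.map_append]
        exact h3.keys.append h1.keys
      · simp only [List.flatMap_cons]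
        exact h3.leaves.append h1.leaves
      · simp only [List.map_cons, List.sum_cons]
        exact Nat.add_le_add (h3.cost s (hs t (by simp))) h1.cost
      · rcases List.mem_cons.1 ht' with rfl | ht'
        · exact ⟨t, by simp, h3⟩
        · obtain ⟨u, hu, h5⟩ := h1.sub t' ht'
          exact ⟨u, List.mem_cons_of_mem _ hu, h5⟩
      · simp only; omega

theorem CoalesceListSpec.node {T : CTree (Fin N)} (hT : Cov x T) {p : Fin N} {s : ℤ}
    {cs cs' : List (CTree (Fin N))} (hn : CTree.node p s cs ∈ T.subtrees)
    (h : CoalesceListSpec x T s cs cs') :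
    CoalesceSpec x T (CTree.node p s cs) (CTree.node p s cs') := by
  refine ⟨?_, by simpa using h.leaves, le_rfl, fun sp hsp => ?_, ?_⟩
  · rw [subtrees_node, subtrees_node, List.map_cons, List.map_cons]
    exact h.keys.cons_cons _
  · unfold subtreeCost
    rw [sum_linkCost_node, sum_linkCost_node]
    exact Nat.add_le_add le_rfl h.cost
  · obtain ⟨h1, h2⟩ := node_below hT hn
    refine .node p s cs' h1 h2 (fun t' ht' => ?_) (fun t' ht' => ?_) fun t' ht' => ?_
    · obtain ⟨t, ht, h3⟩ := h.sub t' ht'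
      exact h3.scale_le.trans_lt ((hT.loc.of_mem hn).scale_lt ht)
    · obtain ⟨t, ht, h3⟩ := h.sub t' ht'
      refine (h3.below_subset hT (child_mem_subtrees hn ht)).trans ?_
      have := DualTree.below_subset hT hn (u := t) (by
        rw [subtrees_node]
        exact List.mem_cons_of_mem _ (List.mem_flatMap.2 ⟨t, ht, self_mem_subtrees t⟩))
      exact this
    · obtain ⟨t, -, h3⟩ := h.sub t' ht'
      exact h3.query

theorem coalesce_spec {T : CTree (Fin N)} (hT : Cov x T) (σ : State N k) {t : CTree (Fin N)}
    (ht : t ∈ T.subtrees) :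
    CoalesceSpec x T t (coalesce σ t).1 ∧ (coalesce σ t).2 + 1 ≤ 2 * t.numNodes := by
  induction t using induct with
  | leaf p =>
    simp only [coalesce]
    refine ⟨⟨List.Sublist.refl _, List.Sublist.refl _, le_rfl, fun _ _ => le_rfl, ?_⟩, by simp⟩
    have hk : (leaf p).key = (p, (⊥ : WithBot ℤ)) := rfl
    refine .leaf p ?_ fun q hq => ?_
    · rw [← hk, mem_below hT ht]; simp
    · rw [← hk, mem_below hT ht] at hq; simpa using hq
  | node p s cs ih =>
    have hl := hT.loc.of_mem ht
    obtain ⟨h1, h2⟩ := coalesceList_spec σ cs (fun t ht' => hl.scale_lt ht')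
      fun t ht' => ih t ht' (child_mem_subtrees ht ht')
    have h3 := h1.node hT ht
    have htime : (coalesceList σ cs).2 + 1 + 1 ≤ 2 * (node p s cs).numNodes := by
      rw [numNodes_node]; omega
    unfold coalesce
    simp only
    split
    · rename_i t' heq
      refine ⟨?_, htime⟩
      rw [heq] at h1
      obtain ⟨t, htc, h4⟩ := h1.sub t' (by simp)
      have hts := h4.scale_le.trans_lt (hl.scale_lt htc)
      refine ⟨?_, ?_, hts.le, fun sp hsp => ?_, h4.query⟩
      · rw [subtrees_node, List.map_cons]
        have := h1.keys
        simp only [List.flatMap_cons, List.flatMap_nil, List.append_nil] at this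
        exact this.trans (List.sublist_cons_self _ _)
      · have := h1.leaves
        simpa using this
      · have h5 := h1.cost
        simp only [List.map_cons, List.map_nil, List.sum_cons, List.sum_nil, add_zero] at h5
        rw [scale_node, WithBot.coe_lt_coe] at hsp
        have h6 := linkCost_le (T := T) hsp hts p cs
        have h7 : subtreeCost T sp (node p s cs) =
            linkCost T (sp, node p s cs) + (cs.map (subtreeCost T s)).sum := by
          rw [← sum_linkCost_node (p := p)]; rfl
        have h8 : subtreeCost T s t' = linkCost T (s, t') + (t'.links.map (linkCost T)).sum := rfl
        have h9 : subtreeCost T sp t' = linkCost T (sp, t') + (t'.links.map (linkCost T)).sum := rfl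
        change subtreeCost T sp t' ≤ _
        omega
    · exact ⟨h3, htime⟩

/-- What coalescing does to a tree. -/
theorem coalesceTree_spec {T : CTree (Fin N)} (hT : Cov x T) (σ : State N k) :
    ((coalesceTree σ T).1.subtrees.map key).Sublist (T.subtrees.map key) ∧
    (coalesceTree σ T).1.leaves.Sublist T.leaves ∧
    ((coalesceTree σ T).1.links.map (linkCost T)).sum ≤ (T.links.map (linkCost T)).sum ∧
    QTree x (below T) (coalesceTree σ T).1 ∧
    (coalesceTree σ T).2 ≤ 2 * T.numNodes ∧
    (coalesceTree σ T).1.key = T.key := by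
  -- The specification includes a link to a parent. For the root a fictitious parent scale is used;
  -- its share depends only on the scale of the root, which is unchanged, and cancels.
  have key : ∀ T', CoalesceSpec x T T T' →
      (T'.links.map (linkCost T)).sum ≤ (T.links.map (linkCost T)).sum ∨ T'.key ≠ T.key := by
    intro T' h
    by_cases hk : T'.key = T.key
    · left
      have hs : T'.scale = T.scale := congrArg Prod.snd hk
      obtain ⟨sp, hsp⟩ : ∃ sp : ℤ, T.scale < sp := by
        cases T with
        | leaf p => exact ⟨0, by simp⟩
        | node p s cs => exact ⟨s + 1, by rw [scale_node, WithBot.coe_lt_coe]; omega⟩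
      have h1 := h.cost sp hsp
      have h2 : linkCost T (sp, T') = linkCost T (sp, T) := by
        have : ∀ R a b : CTree (Fin N), a.scale = b.scale →
            linkCost R (sp, a) = linkCost R (sp, b) := by
          intro R a b hab
          cases a <;> cases b <;> simp_all [linkCost, nodeImbalance]
        exact this T T' T hs
      unfold subtreeCost at h1
      omega
    · exact Or.inr hk
  have hmain : CoalesceSpec x T T (coalesceTree σ T).1 ∧ (coalesceTree σ T).2 ≤ 2 * T.numNodes ∧
      (coalesceTree σ T).1.key = T.key := by
    rcases hTT : T with p | ⟨p, s, cs⟩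
    · have h := coalesce_spec hT σ (self_mem_subtrees T)
      rw [hTT] at h
      simp only [coalesceTree]
      simp only [coalesce] at h
      exact ⟨h.1, by simp, by simp⟩
    · rw [hTT] at hT
      have hl := hT.loc
      obtain ⟨h1, h2⟩ := coalesceList_spec (T := node p s cs) (x := x) σ cs
        (fun t ht => hl.scale_lt ht)
        fun t ht => coalesce_spec hT σ (child_mem_subtrees (self_mem_subtrees _) ht)
      refine ⟨h1.node hT (self_mem_subtrees _), ?_, rfl⟩
      simp only [coalesceTree, numNodes_node]
      omega
  exact ⟨hmain.1.keys, hmain.1.leaves, (key _ hmain.1).resolve_right (by simp [hmain.2.2]),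
    hmain.1.query, hmain.2.1, hmain.2.2⟩

theorem sum_linkCost (T : CTree (Fin N)) :
    (T.links.map (linkCost T)).sum = T.imbalance + T.links.length := by
  unfold linkCost CTree.imbalance
  induction T.links with
  | nil => simp
  | cons l ls ih => simp only [List.map_cons, List.sum_cons, List.length_cons, ih]; omega

theorem IsCoverTree.numNodes_le {T : CTree (Fin N)} (h : T.IsCoverTree x) :
    T.numNodes + 1 ≤ 2 * N := by
  have h1 := h.cov.loc.numNodes_le
  have h2 : T.leaves.length = N := by
    rw [← List.toFinset_card_of_nodup h.leaves_nodup]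
    have : T.leaves.toFinset = Finset.univ := by
      ext p; simp [h.mem_leaves p]
    rw [this, Finset.card_univ, Fintype.card_fin]
  omega

theorem IsCoverTree.minScale_le {T : CTree (Fin N)} {p : Fin N} {s : ℤ}
    {cs : List (CTree (Fin N))} (hn : node p s cs ∈ T.subtrees) : T.minScale ≤ s := by
  refine csInf_le ?_ ⟨p, cs, hn⟩
  have hfin : {s : ℤ | ∃ p cs, node p s cs ∈ T.subtrees}.Finite := by
    refine Set.Finite.subset ((T.subtrees.map scale).toFinset.finite_toSet.preimage
      (WithBot.coe_injective.injOn)) ?_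
    rintro s ⟨p, cs, h⟩
    simp only [Set.mem_preimage, Finset.mem_coe, List.mem_toFinset, List.mem_map]
    exact ⟨_, h, rfl⟩
  exact hfin.bddBelow

/-- Two data points are far apart in relation to the smallest scale. -/
theorem IsCoverTree.dist_lt {T : CTree (Fin N)} (h : T.IsCoverTree x) (hT : T.links ≠ [])
    {p q : Fin N} (hpq : p ≠ q) : (2 : ℝ) ^ (T.minScale - 1) < dist (x p) (x q) := by
  -- Every point hangs on some link, whose parent is internal and so has scale at least the minimum.
  have key : ∀ p, T.OnLevel (T.minScale - 1) p := by
    intro p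
    have h1 : ∀ t : CTree (Fin N), t ∈ T.subtrees → p ∈ t.leaves →
        t = leaf p ∨ ∃ l ∈ t.links, l.2.pt = p := by
      intro t
      induction t using induct with
      | leaf q => intro _ hp; left; simp only [leaves_leaf, List.mem_singleton] at hp; rw [hp]
      | node q s cs ih =>
        intro ht hp
        simp only [leaves_node, List.mem_flatMap] at hp
        obtain ⟨u, hu, hp⟩ := hp
        simp only [links_node, List.mem_flatMap, List.mem_cons]
        rcases ih u hu (child_mem_subtrees ht hu) hp with rfl | ⟨l, hl, hlp⟩
        · exact Or.inr ⟨(s, leaf p), ⟨_, hu, Or.inl rfl⟩, rfl⟩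
        · exact Or.inr ⟨l, ⟨u, hu, Or.inr hl⟩, hlp⟩
    rcases h1 T (self_mem_subtrees T) (h.mem_leaves p) with h2 | ⟨l, hl, hlp⟩
    · rw [h2] at hT; simp at hT
    · obtain ⟨q, cs, h3, -⟩ := mem_links.1 hl
      have := IsCoverTree.minScale_le h3
      exact Or.inr ⟨l, hl, hlp, by omega⟩
  exact h.separation _ p q (key p) (key q) hpq

end Query

/-! ### The dual-tree traversal -/

section Traversal

variable {d N k : ℕ} {x : Fin N → Pt d} {c : Fin k → Pt d} {D : Key N → Set (Fin N)}

/-- How the marks and bounds of the nodes develop while the nodes in `K` are handled. -/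
structure Progress (K : Set (Key N)) (σ σ' : State N k) : Prop where
  ub_le : ∀ a, σ'.ub a ≤ σ.ub a
  visited : ∀ a, σ.visited a = true → σ'.visited a = true
  dead : ∀ a, σ.visited a = true → σ.pruned a + 1 = k → σ'.pruned a + 1 = k
  frame : ∀ a ∉ K, σ'.visited a = σ.visited a

theorem Progress.refl (K : Set (Key N)) (σ : State N k) : Progress K σ σ :=
  ⟨fun _ => le_rfl, fun _ h => h, fun _ _ h => h, fun _ _ => rfl⟩

theorem Progress.trans {K : Set (Key N)} {σ σ' σ'' : State N k} (h : Progress K σ σ')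
    (h' : Progress K σ' σ'') : Progress K σ σ'' :=
  ⟨fun a => (h'.ub_le a).trans (h.ub_le a), fun a ha => h'.visited a (h.visited a ha),
    fun a ha hd => h'.dead a (h.visited a ha) (h.dead a ha hd),
    fun a ha => (h'.frame a ha).trans (h.frame a ha)⟩

theorem Progress.mono {K K' : Set (Key N)} {σ σ' : State N k} (h : Progress K σ σ')
    (hK : K ⊆ K') : Progress K' σ σ' :=
  ⟨h.ub_le, h.visited, h.dead, fun a ha => h.frame a fun h' => ha (hK h')⟩

/-- The upper bounds are valid for the points given by `D`. -/
def BoundsValid (x : Fin N → Pt d) (c : Fin k → Pt d) (D : Key N → Set (Fin N))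
    (σ : State N k) : Prop :=
  ∀ a, ∀ p ∈ D a, ∃ j, ((dist (x p) (c j) : ℝ) : EReal) ≤ σ.ub a

/-- A node that has been visited and of which all but one centroid are taken to be pruned. -/
def Dead (σ : State N k) (a : Key N) : Prop := σ.visited a = true ∧ σ.pruned a + 1 = k

theorem Progress.dead_of_dead {K : Set (Key N)} {σ σ' : State N k} (h : Progress K σ σ')
    {a : Key N} (ha : Dead σ a) : Dead σ' a :=
  ⟨h.visited a ha.1, h.dead a ha.1 ha.2⟩

theorem baseCase_fields (p : Fin N) (j : Fin k) (σ : State N k) :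
    (baseCase x c p j σ).ub = σ.ub ∧ (baseCase x c p j σ).visited = σ.visited ∧
      (baseCase x c p j σ).pruned = σ.pruned := by
  unfold baseCase
  simp only
  split_ifs <;> simp

theorem inherit_of_visited {par : Option (Key N)} {tq : CTree (Fin N)} {σ : State N k}
    (h : σ.visited tq.key = true) : inherit par tq σ = σ := by
  simp [inherit, h]

theorem inherit_fields (par : Option (Key N)) (tq : CTree (Fin N)) (σ : State N k) :
    (inherit par tq σ).ub = σ.ub ∧ (inherit par tq σ).visited tq.key = true ∧
      Progress {tq.key} σ (inherit par tq σ) := by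
  by_cases h : σ.visited tq.key = true
  · rw [inherit_of_visited h]
    exact ⟨rfl, h, .refl _ _⟩
  · have hv : (inherit par tq σ).visited = Function.update σ.visited tq.key true := by
      cases par <;> simp [inherit, h]
    have hu : (inherit par tq σ).ub = σ.ub := by cases par <;> simp [inherit, h]
    have hp : ∀ a, a ≠ tq.key → (inherit par tq σ).pruned a = σ.pruned a := by
      intro a ha
      cases par <;> simp [inherit, h, ha]
    refine ⟨hu, by simp [hv], ⟨fun a => by rw [hu], fun a ha => ?_, fun a ha hd => ?_,
      fun a ha => ?_⟩⟩
    · rw [hv, Function.update_apply]; split_ifs <;> simp [ha]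
    · rw [hp a (by rintro rfl; exact h ha)]; exact hd
    · rw [hv, Function.update_of_ne (by simpa using ha)]

theorem inherit_pruned {a : Key N} {tq : CTree (Fin N)} {σ : State N k}
    (h : σ.visited tq.key = false) : (inherit (some a) tq σ).pruned tq.key = σ.pruned a := by
  simp [inherit, h]

theorem le_dMax {tq : CTree (Fin N)} (hq : QTree x D tq) {p : Fin N} (hp : p ∈ D tq.key)
    (j : Fin k) : dist (x p) (c j) ≤ dMax x c tq j := by
  have := hq.dist_le hp
  exact (dist_triangle _ (x tq.pt) _).trans (by unfold dMax; linarith)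

theorem dMin_le {tq : CTree (Fin N)} (hq : QTree x D tq) {p : Fin N} (hp : p ∈ D tq.key)
    {tr : CTree (Fin k)} (hr : Loc c tr) {j : Fin k} (hj : j ∈ tr.leaves) :
    dMin x c tq tr ≤ dist (x p) (c j) := by
  have h1 := hq.dist_le hp
  have h2 := hr.dist_leaf hj
  refine max_le dist_nonneg ?_
  have h3 := dist_triangle4 (x tq.pt) (x p) (c j) (c tr.pt)
  rw [dist_comm (x tq.pt) (x p)] at h3
  linarith

/-- What the node-to-node function does. -/
theorem score_spec {par : Option (Key N)} {tq : CTree (Fin N)} (hq : QTree x D tq)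
    {tr : CTree (Fin k)} {σ : State N k} (hσ : BoundsValid x c D σ) :
    Progress {tq.key} σ (score x c par tq tr σ).2 ∧
    BoundsValid x c D (score x c par tq tr σ).2 ∧
    (score x c par tq tr σ).2.visited tq.key = true ∧
    (((score x c par tq tr σ).1 = ⊤ ∧ (Dead (score x c par tq tr σ).2 tq.key ∨
        σ.ub tq.key < ((dMin x c tq tr : ℝ) : EReal))) ∨
      ((score x c par tq tr σ).1 ≠ ⊤ ∧ ((dMin x c tq tr : ℝ) : EReal) ≤ σ.ub tq.key ∧
        (score x c par tq tr σ).2.ub tq.key ≤ ((dMax x c tq tr.pt : ℝ) : EReal))) ∧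
    ((inherit par tq σ).pruned tq.key + 1 = k → (score x c par tq tr σ).1 = ⊤ ∧
      Dead (score x c par tq tr σ).2 tq.key) := by
  obtain ⟨h1, h2, h3⟩ := inherit_fields par tq σ
  have hv1 : BoundsValid x c D (inherit par tq σ) := by
    intro a p hp; rw [h1]; exact hσ a p hp
  unfold score
  simp only
  rw [h1]
  split_ifs with h4 h5 h6
  · exact ⟨h3, hv1, h2, Or.inl ⟨rfl, Or.inl ⟨h2, h4⟩⟩, fun _ => ⟨rfl, h2, h4⟩⟩
  -- The counter changes only at `tq.key`, where by `h4` it was not at `k - 1`; counters that have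
  -- reached `k - 1` stay there.
  · refine ⟨h3.trans ⟨fun a => by rw [h1], fun _ h => h, fun a ha hd => ?_, fun _ _ => rfl⟩,
      fun a p hp => hσ a p hp, h2, Or.inl ⟨rfl, Or.inr h5⟩, fun h => absurd h h4⟩
    simp only
    rw [Function.update_of_ne (by rintro rfl; exact h4 hd)]
    exact hd
  · refine ⟨h3.trans ⟨fun a => ?_, fun _ h => h, fun _ _ h => h, fun _ _ => rfl⟩, ?_, h2,
      Or.inr ⟨EReal.coe_ne_top _, not_lt.1 h5, by simp⟩, fun h => absurd h h4⟩
    · simp only [Function.update_apply, h1]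
      split_ifs with ha
      · rw [ha]; exact h6.le
      · exact le_rfl
    · intro a p hp
      simp only [Function.update_apply]
      split_ifs with ha
      · subst ha
        exact ⟨tr.pt, EReal.coe_le_coe_iff.2 (le_dMax hq hp _)⟩
      · exact hσ a p hp
  · exact ⟨h3, hv1, h2, Or.inr ⟨EReal.coe_ne_top _, not_lt.1 h5, h1 ▸ not_lt.1 h6⟩,
      fun h => absurd h h4⟩

/-- What a round of visits does. -/
structure VisitSpec (x : Fin N → Pt d) (c : Fin k → Pt d) (D : Key N → Set (Fin N))
    (y : Fin N → Fin k) (par : Option (Key N)) (tq : CTree (Fin N)) (R : List (CTree (Fin k)))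
    (σ : State N k) (v : Visited N k) : Prop where
  progress : Progress {tq.key} σ v.state
  valid : BoundsValid x c D v.state
  sublist : v.kept.Sublist R
  ub_le : ∀ t ∈ v.kept, v.state.ub tq.key ≤ ((dMax x c tq t.pt : ℝ) : EReal)
  near : ∀ t ∈ v.kept, ((dMin x c tq t : ℝ) : EReal) ≤ σ.ub tq.key
  time_le : v.time ≤ 2 * R.length
  alive : Dead v.state tq.key ∨ ∀ t ∈ R, (∃ p ∈ D tq.key, y p ∈ t.leaves) → t ∈ v.kept
  dead : (inherit par tq σ).pruned tq.key + 1 = k → v.kept = []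

/-- A reference node containing the nearest centroid of a descendant point can be lost only through
the counter, that is, when the query node becomes `Dead`; the distance test cannot remove it. -/
theorem visit_spec {y : Fin N → Fin k} (hy : ∀ p j, dist (x p) (c (y p)) ≤ dist (x p) (c j))
    {par : Option (Key N)} {tq : CTree (Fin N)} (hq : QTree x D tq) (R : List (CTree (Fin k)))
    (hR : ∀ t ∈ R, Loc c t) {σ : State N k} (hσ : BoundsValid x c D σ) :
    VisitSpec x c D y par tq R σ (visit x c par tq R σ) := by
  induction R generalizing σ with
  | nil =>
    exact ⟨.refl _ _, hσ, List.Sublist.refl _, by simp [visit], by simp [visit], by simp [visit],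
      Or.inr (by simp), fun _ => rfl⟩
  | cons tr trs ih =>
    obtain ⟨h1, h2, h3, h4, h5⟩ := score_spec (par := par) hq (tr := tr) hσ
    set r := score x c par tq tr σ with hr
    have hR' : ∀ t ∈ trs, Loc c t := fun t ht => hR t (List.mem_cons_of_mem _ ht)
    -- For such a node `dMin` is at most the distance from `p` to its nearest centroid, hence at
    -- most the valid bound `ub`.
    have hmem : σ.ub tq.key < ((dMin x c tq tr : ℝ) : EReal) →
        ¬ ∃ p ∈ D tq.key, y p ∈ tr.leaves := by
      rintro hlt ⟨p, hp, hyp⟩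
      obtain ⟨j, hj⟩ := hσ _ p hp
      have h6 := dMin_le hq hp (hR tr (by simp)) hyp
      have h7 : ((dMin x c tq tr : ℝ) : EReal) ≤ ((dist (x p) (c j) : ℝ) : EReal) :=
        EReal.coe_le_coe_iff.2 (h6.trans (hy p j))
      exact absurd (h7.trans hj) (not_le.2 hlt)
    unfold visit
    simp only
    rw [← hr]
    by_cases htop : r.1 = ⊤
    · rw [if_pos htop]
      have hv := ih hR' h2
      set v := visit x c par tq trs r.2
      have hpr := h1.trans hv.progress
      refine ⟨hpr, hv.valid, hv.sublist.cons _, hv.ub_le,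
        fun t ht => (hv.near t ht).trans (h1.ub_le _), ?_, ?_, fun hd => hv.dead ?_⟩
      · have := hv.time_le
        simp only [List.length_cons]; omega
      · rcases h4 with ⟨-, h4 | h4⟩ | ⟨h4, -⟩
        · exact Or.inl (hv.progress.dead_of_dead h4)
        · rcases hv.alive with h6 | h6
          · exact Or.inl h6
          · right
            intro t ht hp
            rcases List.mem_cons.1 ht with rfl | ht
            · exact absurd hp (hmem h4)
            · exact h6 t ht hp
        · exact absurd htop h4
      · rw [inherit_of_visited h3]
        exact (h5 hd).2.2
    · rw [if_neg htop]
      obtain ⟨hb1, hb2, hb3⟩ := baseCase_fields (x := x) (c := c) tq.pt tr.pt r.2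
      have hbp : Progress {tq.key} r.2 (baseCase x c tq.pt tr.pt r.2) := by
        refine ⟨fun a => by rw [hb1], fun a ha => by rw [hb2]; exact ha,
          fun a _ hd => by rw [hb3]; exact hd, fun a _ => by rw [hb2]⟩
      have hbv : BoundsValid x c D (baseCase x c tq.pt tr.pt r.2) := by
        intro a p hp; rw [hb1]; exact h2 a p hp
      have hv := ih hR' hbv
      set v := visit x c par tq trs (baseCase x c tq.pt tr.pt r.2)
      have h4 := (h4.resolve_left fun h => htop h.1).2
      have hub : v.state.ub tq.key ≤ r.2.ub tq.key :=
        (hv.progress.ub_le _).trans (hbp.ub_le _)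
      refine ⟨(h1.trans hbp).trans hv.progress, hv.valid, hv.sublist.cons_cons _, ?_, ?_, ?_, ?_,
        fun hd => ?_⟩
      · intro t ht
        rcases List.mem_cons.1 ht with rfl | ht
        · exact hub.trans h4.2
        · exact hv.ub_le t ht
      · intro t ht
        rcases List.mem_cons.1 ht with rfl | ht
        · exact h4.1
        · exact (hv.near t ht).trans ((hbp.ub_le _).trans (h1.ub_le _))
      · have := hv.time_le
        simp only [List.length_cons]; omega
      · rcases hv.alive with h6 | h6
        · exact Or.inl h6
        · right
          intro t ht hp
          rcases List.mem_cons.1 ht with rfl | ht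
          · simp
          · exact List.mem_cons_of_mem _ (h6 t ht hp)
      · exact absurd (h5 hd).1 htop

/-- The data point `p` is close to the nodes in `R`, in relation to the scale `s`. -/
def Near (x : Fin N → Pt d) (c : Fin k → Pt d) (y : Fin N → Fin k) (p : Fin N) (s : ℤ)
    (R : List (CTree (Fin k))) : Prop :=
  ∀ t ∈ R, dist (x p) (c t.pt) ≤ dist (x p) (c (y p)) + 5 * 2 ^ s

/-- The state before a traversal from `tq` with the reference nodes `R`. -/
structure Ready (x : Fin N → Pt d) (c : Fin k → Pt d) (D : Key N → Set (Fin N))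
    (y : Fin N → Fin k) (tq : CTree (Fin N)) (R : List (CTree (Fin k))) (σ : State N k) :
    Prop where
  ub_le : ∀ t ∈ R, σ.ub tq.key ≤ ((dMax x c tq t.pt : ℝ) : EReal)
  alive : Dead σ tq.key ∨ ∀ p ∈ D tq.key, y p ∈ R.flatMap leaves

/-- The nodes that a reference recursion keeps are close to the query point. -/
theorem Ready.near_kept {y : Fin N → Fin k} {tq : CTree (Fin N)} {R : List (CTree (Fin k))}
    {σ : State N k} (h : Ready x c D y tq R σ) (hq : QTree x D tq) {Tc : CTree (Fin k)}
    (hTc : Loc c Tc) {s z : ℤ} (hs : LevelSet Tc s R) (hz : maxScale R = z)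
    (htq : tq.scale < (z : WithBot ℤ)) {par : Option (Key N)} {v : Visited N k}
    (hv : VisitSpec x c D y par tq (expand z R) σ v) : Near x c y tq.pt z v.kept := by
  intro t ht
  rcases h.alive with hd | ha
  · rw [hv.dead (by rw [inherit_of_visited hd.1]; exact hd.2)] at ht
    simp at ht
  -- The node `a` with the nearest centroid has `dist ≤ δ + 2 * 2 ^ z` and, by `h.ub_le`, controls
  -- `ub`. The radius of `tq` enters twice and that of `t` once, each at most `2 ^ z`: in all `δ + 5
  -- * 2 ^ z`.
  · obtain ⟨a, haR, hya⟩ := List.mem_flatMap.1 (ha tq.pt hq.pt_mem)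
    have h1 := dist_le_of_mem_leaves hTc (hs.top a haR).mem hya (x tq.pt)
    have h2 : a.radius ≤ 2 * 2 ^ z := by
      rw [← two_zpow_succ]; exact radius_le_of_le (hz ▸ scale_le_maxScale haR)
    have h3 : tq.radius ≤ 2 ^ z := radius_le_of_lt htq
    have h4 : t.radius ≤ 2 ^ z :=
      radius_le_of_lt ((hs.expand hTc hz).scale_lt t (hv.sublist.subset ht))
    have h5 := (hv.near t ht).trans (h.ub_le a haR)
    rw [EReal.coe_le_coe_iff] at h5
    have h6 : dist (x tq.pt) (c t.pt) - tq.radius - t.radius ≤ dMin x c tq t := le_max_right _ _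
    unfold dMax at h5
    linarith

theorem Ready.after_visit {y : Fin N → Fin k} {tq : CTree (Fin N)}
    {R : List (CTree (Fin k))} {σ : State N k} {par : Option (Key N)} {v : Visited N k}
    (hv : VisitSpec x c D y par tq R σ v) (hne : v.kept ≠ [])
    (h : (inherit par tq σ).pruned tq.key + 1 = k ∨ ∀ p ∈ D tq.key, y p ∈ R.flatMap leaves) :
    Ready x c D y tq v.kept v.state := by
  refine ⟨hv.ub_le, ?_⟩
  rcases hv.alive with h1 | h1
  · exact Or.inl h1
  · rcases h with h2 | h2
    · exact absurd (hv.dead h2) hne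
    · right
      intro p hp
      obtain ⟨a, ha, hya⟩ := List.mem_flatMap.1 (h2 p hp)
      exact List.mem_flatMap.2 ⟨a, h1 a ha ⟨p, hp, hya⟩, hya⟩

/-- A potential for the reference recursions at a query node. -/
structure StepBound (x : Fin N → Pt d) (c : Fin k → Pt d) (y : Fin N → Fin k)
    (Tc : CTree (Fin k)) (b : ℝ) (tq : CTree (Fin N)) (ψ : ℤ → ℝ) : Prop where
  nonneg : ∀ s, 0 ≤ ψ s
  mono : Monotone ψ
  step : ∀ (s z : ℤ) (R : List (CTree (Fin k))), LevelSet Tc s R → Near x c y tq.pt s R →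
    maxScale R = z → tq.scale < (z : WithBot ℤ) → 5 * b * R.length + ψ z ≤ ψ s

/-- The time for everything below a non-root query node. -/
noncomputable def traverseShare (b m : ℝ) (Ψ : CTree (Fin N) → ℤ → ℝ)
    (l : ℤ × CTree (Fin N)) : ℝ := 3 * m + 2 + 5 * b * m + Ψ l.2 l.1

noncomputable def traverseTotal (b m : ℝ) (Ψ : CTree (Fin N) → ℤ → ℝ) (t : CTree (Fin N)) : ℝ :=
  (t.links.map (traverseShare b m Ψ)).sum

theorem traverseTotal_node (b m : ℝ) (Ψ : CTree (Fin N) → ℤ → ℝ) (p : Fin N) (s : ℤ)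
    (cs : List (CTree (Fin N))) : traverseTotal b m Ψ (node p s cs) =
      (cs.map fun t => traverseShare b m Ψ (s, t) + traverseTotal b m Ψ t).sum := by
  unfold traverseTotal
  rw [links_node]
  induction cs with
  | nil => rfl
  | cons t ts ih =>
    rw [List.flatMap_cons, List.map_append, List.sum_append, ih, List.map_cons, List.sum_cons]
    rfl

/-- What a traversal does. -/
structure TraverseSpec (x : Fin N → Pt d) (c : Fin k → Pt d) (D : Key N → Set (Fin N))
    (y : Fin N → Fin k) (b m : ℝ) (Ψ : CTree (Fin N) → ℤ → ℝ) (ψ : ℤ → ℝ) (tq : CTree (Fin N))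
    (s : ℤ) (R : List (CTree (Fin k))) (σ : State N k) (r : State N k × ℕ) : Prop where
  progress : Progress {a | a ∈ tq.subtrees.map key} σ r.1
  valid : BoundsValid x c D r.1
  time_near : Near x c y tq.pt s R → (r.2 : ℝ) ≤ ψ s + traverseTotal b m Ψ tq + m + 1
  time : ∀ z : ℤ, maxScale R ≤ z →
    (r.2 : ℝ) ≤ 5 * b * m + ψ z + traverseTotal b m Ψ tq + m + 1

theorem traverseTotal_nonneg {b m : ℝ} (hb : 0 ≤ b) (hm : 0 ≤ m) {Tc : CTree (Fin k)}
    {y : Fin N → Fin k} {Ψ : CTree (Fin N) → ℤ → ℝ} {t : CTree (Fin N)}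
    (h : ∀ l ∈ t.links, StepBound x c y Tc b l.2 (Ψ l.2)) : 0 ≤ traverseTotal b m Ψ t := by
  refine List.sum_nonneg fun r hr => ?_
  obtain ⟨l, hl, rfl⟩ := List.mem_map.1 hr
  have := (h l hl).nonneg l.1
  unfold traverseShare
  positivity

-- Time of the traversal, by induction on the query tree.

section

variable {y : Fin N → Fin k} {Tc : CTree (Fin k)} {b m : ℝ} {Ψ : CTree (Fin N) → ℤ → ℝ}

theorem visited_children {σ σ' : State N k} {t : CTree (Fin N)}
    (hnd : (t.subtrees.map key).Nodup) (hp : Progress {t.key} σ σ')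
    (hu : ∀ w ∈ t.children, ∀ u ∈ w.subtrees, σ.visited u.key = false) :
    ∀ w ∈ t.children, ∀ u ∈ w.subtrees, σ'.visited u.key = false := by
  intro w hw u huw
  rw [hp.frame _ ?_, hu w hw u huw]
  cases t with
  | leaf p => simp at hw
  | node p s cs =>
    rw [subtrees_node, List.map_cons, List.nodup_cons] at hnd
    rw [Set.mem_singleton_iff]
    intro h
    rw [← h] at hnd
    exact hnd.1 (List.mem_map_of_mem (List.mem_flatMap.2 ⟨w, hw, huw⟩))

/-- The induction hypothesis on traversals from children. -/
def TraverseBound (x : Fin N → Pt d) (c : Fin k → Pt d) (D : Key N → Set (Fin N))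
    (y : Fin N → Fin k) (Tc : CTree (Fin k)) (b m : ℝ) (Ψ : CTree (Fin N) → ℤ → ℝ)
    (tq : CTree (Fin N)) : Prop :=
  ∀ (ψ : ℤ → ℝ) (par : Option (Key N)) (s : ℤ) (R : List (CTree (Fin k))) (σ : State N k),
    StepBound x c y Tc b tq ψ → QTree x D tq → (tq.subtrees.map key).Nodup →
    (∀ l ∈ tq.links, StepBound x c y Tc b l.2 (Ψ l.2)) →
    (∀ t ∈ tq.children, ∀ u ∈ t.subtrees, σ.visited u.key = false) →
    BoundsValid x c D σ → (R ≠ [] → Ready x c D y tq R σ) → LevelSet Tc s R →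
    (R.length : ℝ) ≤ m → TraverseSpec x c D y b m Ψ ψ tq s R σ (traverse x c par tq R σ)

/-- Siblings have disjoint sets of keys, so handling one leaves the others unvisited, and the
liveness of the parent survives throughout. The scales of `R` are at most `z`, so each child needs
one unconditional recursion at most before its potential at `z` takes over. -/
theorem traverseList_bound (hy : ∀ p j, dist (x p) (c (y p)) ≤ dist (x p) (c j))
    (hTc : Loc c Tc) {par : Key N} {z s : ℤ} {R : List (CTree (Fin k))}
    (hs : LevelSet Tc s R) (hz : maxScale R ≤ z) (hm : (R.length : ℝ) ≤ m)
    (l : List (CTree (Fin N)))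
    (ih : ∀ t ∈ l, TraverseBound x c D y Tc b m Ψ t)
    (hΨ : ∀ t ∈ l, StepBound x c y Tc b t (Ψ t))
    (hq : ∀ t ∈ l, QTree x D t) (hnd : ((l.flatMap subtrees).map key).Nodup)
    (hpar : par ∉ (l.flatMap subtrees).map key)
    (hlinks : ∀ t ∈ l, ∀ l' ∈ t.links, StepBound x c y Tc b l'.2 (Ψ l'.2))
    (hsub : ∀ t ∈ l, D t.key ⊆ D par) (σ : State N k)
    (hunv : ∀ u ∈ l.flatMap subtrees, σ.visited u.key = false) (hσ : BoundsValid x c D σ)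
    (halive : Dead σ par ∨ ∀ p ∈ D par, y p ∈ R.flatMap leaves) :
    Progress {a | a ∈ (l.flatMap subtrees).map key} σ (traverseList x c par l R σ).1 ∧
    BoundsValid x c D (traverseList x c par l R σ).1 ∧
    ((traverseList x c par l R σ).2 : ℝ) ≤
      (l.map fun t => traverseShare b m Ψ (z, t) + traverseTotal b m Ψ t).sum := by
  induction l generalizing σ with
  | nil =>
    rw [traverseList]
    exact ⟨.refl _ _, hσ, by simp⟩
  | cons t ts iht =>
    rw [traverseList]
    simp only
    have hv := visit_spec hy (par := some par) (hq t (by simp)) R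
      (fun u hu => hTc.of_mem (hs.top u hu).mem) hσ
    set v := visit x c (some par) t R σ
    have htu : σ.visited t.key = false :=
      hunv t (List.mem_flatMap.2 ⟨t, by simp, self_mem_subtrees t⟩)
    simp only [List.flatMap_cons, List.map_append, List.nodup_append, List.mem_append,
      not_or] at hnd hpar hunv
    have hdisj : ∀ u ∈ ts.flatMap subtrees, u.key ∉ t.subtrees.map key := fun u hu hk =>
      hnd.2.2 _ hk _ (List.mem_map_of_mem hu) rfl
    -- An unvisited child of a dead parent inherits the full counter and keeps nothing; otherwise it
    -- stands for fewer points than its parent, so all their owners are still in `R`.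
    have hready : v.kept ≠ [] → Ready x c D y t v.kept v.state := fun hne =>
      Ready.after_visit hv hne (by
        rcases halive with h1 | h1
        · left; rw [inherit_pruned htu]; exact h1.2
        · right; exact fun p hp => h1 p (hsub t (by simp) hp))
    have hlen : v.kept.length ≤ R.length := hv.sublist.length_le
    have hchild := visited_children hnd.1 hv.progress fun w hw u hu => hunv u (Or.inl (by
      cases t with
      | leaf p => simp at hw
      | node p s cs =>
        rw [subtrees_node]
        exact List.mem_cons_of_mem _ (List.mem_flatMap.2 ⟨w, hw, hu⟩)))
    have hT := ih t (by simp) (Ψ t) (some par) s v.kept v.state (hΨ t (by simp))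
      (hq t (by simp)) hnd.1 (hlinks t (by simp)) hchild hv.valid hready
      (hs.sublist hv.sublist) (le_trans (by exact_mod_cast hlen) hm)
    set r := traverse x c (some par) t v.kept v.state
    have hpr : Progress {a | a ∈ t.subtrees.map key} σ r.1 := by
      refine (hv.progress.mono ?_).trans hT.progress
      intro a ha
      rw [Set.mem_singleton_iff] at ha
      rw [ha]
      exact List.mem_map_of_mem (self_mem_subtrees t)
    obtain ⟨h1, h2, h3⟩ := iht (fun u hu => ih u (List.mem_cons_of_mem _ hu))
      (fun u hu => hΨ u (List.mem_cons_of_mem _ hu))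
      (fun u hu => hq u (List.mem_cons_of_mem _ hu)) hnd.2.1 hpar.2
      (fun u hu => hlinks u (List.mem_cons_of_mem _ hu))
      (fun u hu => hsub u (List.mem_cons_of_mem _ hu)) r.1
      (fun u hu => by rw [hpr.frame _ (hdisj u hu)]; exact hunv u (Or.inr hu)) hT.valid
      (halive.imp_left fun h => hpr.dead_of_dead h)
    refine ⟨(hpr.mono ?_).trans (h1.mono ?_), h2, ?_⟩
    · intro a ha
      simp only [List.flatMap_cons, List.map_append, List.mem_append, Set.mem_ofPred_eq] at ha ⊢
      exact Or.inl ha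
    · intro a ha
      simp only [List.flatMap_cons, List.map_append, List.mem_append, Set.mem_ofPred_eq] at ha ⊢
      exact Or.inr ha
    · have h4 := hT.time z (maxScale_le fun u hu =>
        (scale_le_maxScale (hv.sublist.subset hu)).trans hz)
      have h5 : (v.time : ℝ) ≤ 2 * R.length := by exact_mod_cast hv.time_le
      rw [List.map_cons, List.sum_cons]
      unfold traverseShare at h3 ⊢
      push_cast
      linarith

/-- Inner induction on the size of the reference set. A recursion leaves a set that is near at scale
`z`, so the sharper bound `time_near` applies from then on. If the initial set is not known to be
near, its first recursion is paid by `5 * b * m` instead of the potential. -/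
theorem traverse_bound_of_children (hy : ∀ p j, dist (x p) (c (y p)) ≤ dist (x p) (c j))
    (hTc : Loc c Tc) (hb : 1 ≤ b) (hm0 : 0 ≤ m)
    (hch : ∀ t ∈ Tc.subtrees, (t.children.length : ℝ) ≤ b)
    (hpack : ∀ p s R, LevelSet Tc s R → Near x c y p s R → (R.length : ℝ) ≤ m)
    {tq : CTree (Fin N)} (ih : ∀ t ∈ tq.children, TraverseBound x c D y Tc b m Ψ t) :
    TraverseBound x c D y Tc b m Ψ tq := by
  intro ψ par s R σ hψ hq hnd hlinks hunv hσ hready hs hm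
  induction hn : numNodesList R using Nat.strong_induction_on generalizing s R σ with
  | _ n ihn =>
  have htot := traverseTotal_nonneg (b := b) (by linarith) hm0 hlinks
  by_cases hR : R = []
  · rw [traverse, if_pos (by simp [hR])]
    refine ⟨.refl _ _, hσ, fun _ => ?_, fun z _ => ?_⟩
    · have := hψ.nonneg s
      push_cast; linarith
    · have := hψ.nonneg z
      have : 0 ≤ 5 * b * m := by positivity
      push_cast; linarith
  have hrd := hready hR
  by_cases hlt : tq.scale < maxScale R
  · rw [traverse, if_neg (by simpa using hR), dif_pos hlt]
    obtain ⟨z, hz⟩ := WithBot.ne_bot_iff_exists.1 (ne_bot_of_gt hlt)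
    have hz : maxScale R = z := hz.symm
    have hE := hs.expand hTc hz
    have hdec := numNodesList_expand_lt R (ne_bot_of_gt hlt)
    rw [hz] at hlt hdec ⊢
    have hv := visit_spec hy (par := par) hq (expand z R)
      (fun t ht => hTc.of_mem (hE.top t ht).mem) hσ
    have hkn : numNodesList (visit x c par tq (expand z R) σ).kept < n :=
      hn ▸ lt_of_le_of_lt (numNodesList_visit_le _ _ _ _ _ _) hdec
    simp only
    set v := visit x c par tq (expand z R) σ
    have hnear := hrd.near_kept hq hTc hs hz hlt hv
    have hkept := hE.sublist hv.sublist
    have hr := ihn _ hkn z v.kept v.state (visited_children hnd hv.progress hunv) hv.valid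
      (fun hne => Ready.after_visit hv hne (by
        rw [flatMap_leaves_expand]
        refine hrd.alive.imp_left fun h => ?_
        rw [inherit_of_visited h.1]; exact h.2)) hkept (hpack _ _ _ hkept hnear) rfl
    set r := traverse x c par tq v.kept v.state
    have h1 := hr.time_near hnear
    have h2 : (v.time : ℝ) ≤ 2 * (expand z R).length := by exact_mod_cast hv.time_le
    -- A recursion costs at most `3 * E.length + R.length + 1` with `E.length ≤ b * R.length`, and
    -- both `1` and `R.length` are at most `b * R.length`; hence the `5 * b` in `StepBound`.
    have h3 := expand_length_le hb (z := z) fun t ht => hch t (hs.top t ht).mem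
    have h4 : (1 : ℝ) ≤ R.length := by
      exact_mod_cast List.length_pos_iff.2 hR
    have h5 : (R.length : ℝ) ≤ b * R.length := by nlinarith
    refine ⟨(hv.progress.mono ?_).trans hr.progress, hr.valid, fun hnr => ?_, fun z' hz' => ?_⟩
    · intro a ha
      rw [Set.mem_singleton_iff] at ha
      rw [ha]
      exact List.mem_map_of_mem (self_mem_subtrees tq)
    · have h6 := hψ.step s z R hs hnr hz hlt
      push_cast
      linarith
    · have h6 := hψ.mono (show z ≤ z' by exact_mod_cast hz ▸ hz')
      have h7 : b * R.length ≤ b * m := mul_le_mul_of_nonneg_left hm (by linarith)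
      push_cast
      linarith
  · cases tq with
    | leaf p =>
      rw [traverse, if_neg (by simpa using hR), dif_neg hlt]
      refine ⟨.refl _ _, hσ, fun _ => ?_, fun z _ => ?_⟩
      · have := hψ.nonneg s
        push_cast; linarith
      · have := hψ.nonneg z
        have : 0 ≤ 5 * b * m := by positivity
        push_cast; linarith
    | node p sq cs =>
      rw [traverse, if_neg (by simpa using hR), dif_neg hlt]
      simp only
      have hnd' := hnd
      rw [subtrees_node, List.map_cons, List.nodup_cons] at hnd'
      obtain ⟨-, hsub, hqs⟩ := hq.inv
      obtain ⟨h1, h2, h3⟩ := traverseList_bound (par := (p, (sq : WithBot ℤ))) (z := sq) hy hTc hs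
        (by simpa using hlt) hm cs ih (fun t ht => hlinks (sq, t) (by
          rw [links_node]; exact List.mem_flatMap.2 ⟨t, ht, by simp⟩)) hqs hnd'.2 hnd'.1
        (fun t ht l' hl' => hlinks l' (by
          rw [links_node]; exact List.mem_flatMap.2 ⟨t, ht, by simp [hl']⟩)) hsub σ
        (fun u hu => by
          obtain ⟨w, hw, hu⟩ := List.mem_flatMap.1 hu
          exact hunv w hw u hu) hσ hrd.alive
      rw [← traverseTotal_node b m Ψ p sq cs] at h3
      refine ⟨h1.mono ?_, h2, fun _ => ?_, fun z _ => ?_⟩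
      · intro a ha
        rw [Set.mem_ofPred_eq, subtrees_node, List.map_cons]
        exact List.mem_cons_of_mem _ ha
      · have := hψ.nonneg s
        push_cast; linarith
      · have := hψ.nonneg z
        have : 0 ≤ 5 * b * m := by positivity
        push_cast; linarith

theorem traverse_bound (hy : ∀ p j, dist (x p) (c (y p)) ≤ dist (x p) (c j))
    (hTc : Loc c Tc) (hb : 1 ≤ b) (hm0 : 0 ≤ m)
    (hch : ∀ t ∈ Tc.subtrees, (t.children.length : ℝ) ≤ b)
    (hpack : ∀ p s R, LevelSet Tc s R → Near x c y p s R → (R.length : ℝ) ≤ m)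
    (tq : CTree (Fin N)) : TraverseBound x c D y Tc b m Ψ tq := by
  induction tq using induct with
  | leaf p => exact traverse_bound_of_children hy hTc hb hm0 hch hpack (by simp)
  | node p s cs ih => exact traverse_bound_of_children hy hTc hb hm0 hch hpack ih

end

end Traversal

/-! ### Potentials for the reference recursions -/

section Potentials

variable {d N k : ℕ} {x : Fin N → Pt d} {c : Fin k → Pt d} {y : Fin N → Fin k}
  {Tc : CTree (Fin k)} {e e' : ℝ}

theorem length_le_ballCount (hT : Cov c Tc) {s : ℤ} {R : List (CTree (Fin k))}
    (hs : LevelSet Tc s R) {S : Finset (Pt d)} (hS : Finset.univ.image c ⊆ S) {p : Pt d} {r : ℝ}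
    (hr : ∀ t ∈ R, dist p (c t.pt) ≤ r) : R.length ≤ ballCount S p r := by
  obtain ⟨A, hA, hcard, hmem, -⟩ := hs.exists_finset hT
  rw [← hcard]
  refine Finset.card_le_card fun a ha => ?_
  obtain ⟨t, ht, rfl⟩ := hmem a ha
  simp only [Finset.mem_filter]
  exact ⟨hS (hA ha), hr t ht⟩

/-- With `ρ = 2 ^ (s - 1)` the mutual distances are at most `(2/3 + 10) * 2 ^ s = 64/3 * ρ`, and
`64/3 + 0.7 ≤ 0.7 * 2 ^ 5`. Radius `ρ / 2` would need a sixth doubling. Only the expansion constant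
of the centroids enters. -/
theorem length_le_of_large (hT : Cov c Tc) (he : Doubling (Finset.univ.image c) e) {p : Fin N}
    {s : ℤ} {R : List (CTree (Fin k))} (hs : LevelSet Tc s R) (hn : Near x c y p s R)
    (h : 3 * dist (x p) (c (y p)) ≤ 2 ^ s) : (R.length : ℝ) ≤ 50 * e ^ 5 := by
  obtain ⟨A, hA, hcard, hmem, hsep⟩ := hs.exists_finset hT
  have h1 : (2 : ℝ) ^ s = 2 * 2 ^ (s - 1) := by rw [← two_zpow_succ]; congr 1; ring
  have h2 : (0 : ℝ) < 2 ^ (s - 1) := by positivity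
  rw [← hcard]
  refine he.card_le_fifty hA h2 5 hsep fun a ha b hb => ?_
  obtain ⟨t, ht, rfl⟩ := hmem a ha
  obtain ⟨u, hu, rfl⟩ := hmem b hb
  have h3 := hn t ht
  have h4 := hn u hu
  have h5 := dist_triangle_left (c t.pt) (c u.pt) (x p)
  linarith

variable (hy : ∀ p j, dist (x p) (c (y p)) ≤ dist (x p) (c j))

include hy in
-- In the centroid set with `x p` added, no other point is closer to `x p` than its nearest
-- centroid.
theorem ballCount_insert_le {p : Fin N}
    (he' : Doubling (insert (x p) (Finset.univ.image c)) e') {r : ℝ} (i : ℕ)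
    (hr : r < 2 ^ i * dist (x p) (c (y p))) :
    (ballCount (insert (x p) (Finset.univ.image c)) (x p) r : ℝ) ≤ e' ^ i := by
  refine he'.ballCount_le (Finset.mem_insert_self _ _) i (fun z hz hne => ?_) hr
  rcases Finset.mem_insert.1 hz with h | h
  · exact absurd h hne
  · obtain ⟨j, -, rfl⟩ := Finset.mem_image.1 h
    exact hy p j

include hy in
theorem length_le_of_small (hT : Cov c Tc) {p : Fin N}
    (he' : Doubling (insert (x p) (Finset.univ.image c)) e') {s : ℤ}
    {R : List (CTree (Fin k))} (hs : LevelSet Tc s R) (hn : Near x c y p s R) (i : ℕ)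
    (h : dist (x p) (c (y p)) + 5 * 2 ^ s < 2 ^ i * dist (x p) (c (y p))) :
    (R.length : ℝ) ≤ e' ^ i := by
  refine le_trans ?_ (ballCount_insert_le hy he' i h)
  exact_mod_cast length_le_ballCount hT hs (Finset.subset_insert _ _) hn

include hy in
-- In the case not covered by packing, `2 ^ s < 3 * δ`, so the set lies within `δ + 5 * 2 ^ s < 2 ^
-- 4 * δ`.
theorem length_le_of_near (hT : Cov c Tc) (he : Doubling (Finset.univ.image c) e)
    (hee : e ≤ e') {p : Fin N} (he' : Doubling (insert (x p) (Finset.univ.image c)) e') {s : ℤ}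
    {R : List (CTree (Fin k))} (hs : LevelSet Tc s R) (hn : Near x c y p s R) :
    (R.length : ℝ) ≤ 50 * e' ^ 5 := by
  have h2 := he.two_le
  have h2' := he'.two_le
  by_cases h : 3 * dist (x p) (c (y p)) ≤ 2 ^ s
  · refine (length_le_of_large hT he hs hn h).trans ?_
    gcongr
  · refine (length_le_of_small hy hT he' hs hn 4 (by linarith)).trans ?_
    have h3 : e' ^ 4 ≤ e' ^ 5 := pow_le_pow_right₀ (by linarith) (by norm_num)
    have h4 : 0 ≤ e' ^ 5 := by positivity
    linarith

/-- The number of nodes with a property, among those below a given scale. -/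
noncomputable def countBelow (T : CTree (Fin k)) (F : CTree (Fin k) → Bool) (s : ℤ) : ℕ :=
  T.subtrees.countP fun t => F t && decide (t.scale < (s : WithBot ℤ))

theorem countBelow_mono (T : CTree (Fin k)) (F : CTree (Fin k) → Bool) :
    Monotone (countBelow T F) := by
  intro s s' h
  refine List.countP_mono_left ?_
  simp only [Bool.and_eq_true, decide_eq_true_eq]
  exact fun t _ ht => ⟨ht.1, ht.2.trans_le (by exact_mod_cast h)⟩

theorem countBelow_lt {T t : CTree (Fin k)} {F : CTree (Fin k) → Bool} {s z : ℤ}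
    (ht : t ∈ T.subtrees) (hF : F t = true) (hz : t.scale = z) (hzs : z < s) :
    countBelow T F z + 1 ≤ countBelow T F s := by
  refine countP_lt_countP ?_ ht ?_ ?_
  · simp only [Bool.and_eq_true, decide_eq_true_eq]
    exact fun t _ ht => ⟨ht.1, ht.2.trans (by exact_mod_cast hzs)⟩
  · simp [hF, hz, hzs]
  · simp [hz]

theorem countBelow_le (T : CTree (Fin k)) (F : CTree (Fin k) → Bool) (s : ℤ) :
    countBelow T F s ≤ T.subtrees.countP F := by
  refine List.countP_mono_left ?_
  simp only [Bool.and_eq_true]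
  exact fun t _ ht => ht.1

/-- The scales that are comparable with a distance, up to a given one. -/
noncomputable def countScales (δ : ℝ) (s : ℤ) : ℕ :=
  ((Finset.Icc (Int.log 2 δ - 2) (Int.log 2 δ + 2)).filter (· ≤ s)).card

theorem countScales_mono (δ : ℝ) : Monotone (countScales δ) := by
  intro s s' h
  refine Finset.card_le_card fun i hi => ?_
  rw [Finset.mem_filter] at hi ⊢
  exact ⟨hi.1, hi.2.trans h⟩

theorem countScales_le (δ : ℝ) (s : ℤ) : countScales δ s ≤ 5 := by
  refine (Finset.card_filter_le _ _).trans ?_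
  rw [Int.card_Icc]
  omega

/-- The two inequalities on `δ` force `s` to be within two of its binary logarithm, and `s` is
counted up to `s` but not up to `z`. -/
theorem countScales_lt {δ : ℝ} {s z : ℤ} (h1 : δ < 8 * 2 ^ s) (h2 : 2 ^ s < 3 * δ) (hzs : z < s) :
    countScales δ z + 1 ≤ countScales δ s := by
  have hpos : (0 : ℝ) < 2 ^ s := by positivity
  have hδ : 0 < δ := by linarith
  have h3 : (2 : ℝ) ^ (Int.log 2 δ) ≤ δ := Int.zpow_log_le_self (by norm_num) hδ
  have h4 : δ < (2 : ℝ) ^ (Int.log 2 δ + 1) := Int.lt_zpow_succ_log_self (by norm_num) δ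
  have h5 : Int.log 2 δ < s + 3 := by
    refine (zpow_lt_zpow_iff_right₀ (a := (2 : ℝ)) (by norm_num)).1 (h3.trans_lt ?_)
    rw [zpow_add₀ (by norm_num)]
    norm_num; linarith
  have h6 : s < Int.log 2 δ + 3 := by
    refine (zpow_lt_zpow_iff_right₀ (a := (2 : ℝ)) (by norm_num)).1 (h2.trans ?_)
    have : (2 : ℝ) ^ (Int.log 2 δ + 3) = 4 * 2 ^ (Int.log 2 δ + 1) := by
      rw [show Int.log 2 δ + 3 = Int.log 2 δ + 1 + 1 + 1 by ring, two_zpow_succ, two_zpow_succ]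
      ring
    linarith
  refine Nat.succ_le_of_lt (Finset.card_lt_card ?_)
  rw [Finset.ssubset_iff_of_subset (fun i hi => by
    rw [Finset.mem_filter] at hi ⊢; exact ⟨hi.1, hi.2.trans hzs.le⟩)]
  exact ⟨s, by simp only [Finset.mem_filter, Finset.mem_Icc]; omega, by simp [hzs]⟩

/-- A potential that charges recursions at large scales to nodes of the reference tree. -/
noncomputable def amortized (c : Fin k → Pt d) (Tc : CTree (Fin k)) (e e' : ℝ) (δ : ℝ) (q : Pt d)
    (θ : ℤ → ℝ) (F : CTree (Fin k) → Bool) (s : ℤ) : ℝ :=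
  θ s + 250 * e ^ 4 * e' ^ 5 * countScales δ s +
    5 * e ^ 4 * e' * countBelow Tc (closeNode c q (2 * δ)) s +
    250 * e ^ 9 * countBelow Tc F s

include hy in
-- Three regimes. For `3 * δ ≤ 2 ^ s` the hypothesis `hF` pays, through `θ` or through a node in
-- `F`; in the latter case only at the rate `e ^ 9`. For `8 * 2 ^ s ≤ δ` the set lies within `2 *
-- δ`, has at most `e'` nodes, and the expanded node is close in the sense of `closeNode`. In
-- between, one of the five scales comparable with `δ` is used up.
theorem stepBound_amortized (hT : Cov c Tc) (he : Doubling (Finset.univ.image c) e)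
    (hee : e ≤ e') {tq : CTree (Fin N)}
    (he' : Doubling (insert (x tq.pt) (Finset.univ.image c)) e') {θ : ℤ → ℝ}
    (h0 : ∀ s, 0 ≤ θ s) (hθ : Monotone θ) {F : CTree (Fin k) → Bool}
    (hF : ∀ (s z : ℤ) (p : Fin k) (cs : List (CTree (Fin k))), z < s →
      3 * dist (x tq.pt) (c (y tq.pt)) ≤ 2 ^ s → node p z cs ∈ Tc.subtrees →
      dist (x tq.pt) (c p) ≤ dist (x tq.pt) (c (y tq.pt)) + 5 * 2 ^ s →
      250 * e ^ 4 * e' ^ 5 ≤ θ s - θ z ∨ F (node p z cs) = true) :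
    StepBound x c y Tc (e ^ 4) tq
      (amortized c Tc e e' (dist (x tq.pt) (c (y tq.pt))) (x tq.pt) θ F) := by
  have h2 := he.two_le
  have h2' := he'.two_le
  set δ := dist (x tq.pt) (c (y tq.pt)) with hδ
  have hmono : ∀ {s z : ℤ}, z ≤ s → θ z ≤ θ s ∧
      250 * e ^ 4 * e' ^ 5 * countScales δ z ≤ 250 * e ^ 4 * e' ^ 5 * countScales δ s ∧
      5 * e ^ 4 * e' * countBelow Tc (closeNode c (x tq.pt) (2 * δ)) z ≤
        5 * e ^ 4 * e' * countBelow Tc (closeNode c (x tq.pt) (2 * δ)) s ∧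
      250 * e ^ 9 * countBelow Tc F z ≤ 250 * e ^ 9 * countBelow Tc F s := by
    intro s z h
    refine ⟨hθ h, ?_, ?_, ?_⟩
    · have := countScales_mono δ h
      gcongr
    · have := countBelow_mono Tc (closeNode c (x tq.pt) (2 * δ)) h
      gcongr
    · have := countBelow_mono Tc F h
      gcongr
  refine ⟨fun s => ?_, fun z s h => ?_, fun s z R hs hn hz htq => ?_⟩
  · have := h0 s
    unfold amortized
    positivity
  · obtain ⟨a1, a2, a3, a4⟩ := hmono h
    unfold amortized
    linarith
  · obtain ⟨p, cs, hp⟩ := exists_node_of_maxScale hz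
    have hzs : z < s := by simpa using hs.scale_lt _ hp
    have hmem := (hs.top _ hp).mem
    have hdist := hn _ hp
    rw [pt_node, ← hδ] at hdist
    obtain ⟨a1, a2, a3, a4⟩ := hmono hzs.le
    have hlen := length_le_of_near hy hT he hee he' hs hn
    have hlen' : 5 * e ^ 4 * R.length ≤ 250 * e ^ 4 * e' ^ 5 := by
      calc 5 * e ^ 4 * (R.length : ℝ) ≤ 5 * e ^ 4 * (50 * e' ^ 5) := by gcongr
        _ = _ := by ring
    unfold amortized
    by_cases hC : 3 * δ ≤ 2 ^ s
    · rcases hF s z p cs hzs hC hmem hdist with h | h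
      · linarith
      · have h3 : (countBelow Tc F z : ℝ) + 1 ≤ countBelow Tc F s := by
          exact_mod_cast countBelow_lt hmem h rfl hzs
        have h4 := length_le_of_large hT he hs hn hC
        have h5 : 5 * e ^ 4 * (R.length : ℝ) ≤ 5 * e ^ 4 * (50 * e ^ 5) := by gcongr
        have h6 : 250 * e ^ 9 * ((countBelow Tc F z : ℝ) + 1) ≤
            250 * e ^ 9 * countBelow Tc F s := by gcongr
        have h7 : 5 * e ^ 4 * (50 * e ^ 5) = 250 * e ^ 9 := by ring
        linarith
    · by_cases hA : 8 * 2 ^ s ≤ δ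
      · have hpos : (0 : ℝ) < 2 ^ s := by positivity
        have hzs' : (2 : ℝ) ^ z ≤ 2 ^ s := zpow_le_zpow_right₀ (by norm_num) hzs.le
        have h3 : (countBelow Tc (closeNode c (x tq.pt) (2 * δ)) z : ℝ) + 1 ≤
            countBelow Tc (closeNode c (x tq.pt) (2 * δ)) s := by
          exact_mod_cast countBelow_lt hmem
            (closeNode_of_le hT.loc hmem (by linarith)) rfl hzs
        have h4 := length_le_of_small hy hT he' hs hn 1 (by rw [← hδ]; linarith)
        rw [pow_one] at h4
        have h5 : 5 * e ^ 4 * (R.length : ℝ) ≤ 5 * e ^ 4 * e' := by gcongr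
        have h6 : 5 * e ^ 4 * e' * ((countBelow Tc (closeNode c (x tq.pt) (2 * δ)) z : ℝ) + 1) ≤
            5 * e ^ 4 * e' * countBelow Tc (closeNode c (x tq.pt) (2 * δ)) s := by gcongr
        linarith
      · have h3 : (countScales δ z : ℝ) + 1 ≤ countScales δ s := by
          exact_mod_cast countScales_lt (not_le.1 hA) (not_le.1 hC) hzs
        have h6 : 250 * e ^ 4 * e' ^ 5 * ((countScales δ z : ℝ) + 1) ≤
            250 * e ^ 4 * e' ^ 5 * countScales δ s := by gcongr
        linarith

include hy in
theorem amortized_le (hc : Function.Injective c) (hT : Cov c Tc)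
    (he : Doubling (Finset.univ.image c) e) {p : Fin N}
    (he' : Doubling (insert (x p) (Finset.univ.image c)) e') (θ : ℤ → ℝ)
    (F : CTree (Fin k) → Bool) (s : ℤ) :
    amortized c Tc e e' (dist (x p) (c (y p))) (x p) θ F s ≤
      θ s + 1255 * e ^ 4 * e' ^ 5 + 250 * e ^ 9 * Tc.subtrees.countP F := by
  have h2 := he.two_le
  have h2' := he'.two_le
  set δ := dist (x p) (c (y p)) with hδ
  have h3 : (countScales δ s : ℝ) ≤ 5 := by exact_mod_cast countScales_le δ s
  have h4 : (countBelow Tc F s : ℝ) ≤ Tc.subtrees.countP F := by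
    exact_mod_cast countBelow_le Tc F s
  have h5 : (countBelow Tc (closeNode c (x p) (2 * δ)) s : ℝ) ≤ e' ^ 2 := by
    have h6 := (countBelow_le Tc (closeNode c (x p) (2 * δ)) s).trans
      (countP_internal_le hT fun j => decide (dist (x p) (c j) ≤ 2 * δ))
    have h7 : (Finset.univ.filter fun j => decide (dist (x p) (c j) ≤ 2 * δ) = true).card ≤
        ballCount (insert (x p) (Finset.univ.image c)) (x p) (2 * δ) := by
      rw [← Finset.card_image_of_injective _ hc]
      refine Finset.card_le_card fun a ha => ?_
      obtain ⟨j, hj, rfl⟩ := Finset.mem_image.1 ha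
      simp only [decide_eq_true_eq, Finset.mem_filter, Finset.mem_univ, true_and] at hj
      simp only [Finset.mem_filter]
      exact ⟨Finset.mem_insert_of_mem (Finset.mem_image_of_mem _ (Finset.mem_univ _)), hj⟩
    -- If the data point is itself a centroid, doubling from radius `δ = 0` says nothing, but by
    -- injectivity the ball holds a single centroid.
    rcases (dist_nonneg (x := x p) (y := c (y p))).eq_or_lt with h0 | h0
    · rw [← hδ] at h0
      have h8 : (Finset.univ.filter fun j => decide (dist (x p) (c j) ≤ 2 * δ) = true).card ≤ 1 := by
        refine Finset.card_le_one.2 fun a ha b hb => ?_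
        simp only [decide_eq_true_eq, Finset.mem_filter, Finset.mem_univ, true_and, ← h0,
          mul_zero, dist_le_zero] at ha hb
        exact hc (ha.symm.trans hb)
      have h9 : ((countBelow Tc (closeNode c (x p) (2 * δ)) s : ℕ) : ℝ) ≤ 1 := by
        exact_mod_cast h6.trans h8
      nlinarith
    · refine le_trans ?_ (ballCount_insert_le hy he' (r := 2 * δ) 2 (by rw [← hδ]; linarith))
      exact_mod_cast h6.trans h7
  have h6 : e' ^ 3 ≤ e' ^ 5 := pow_le_pow_right₀ (by linarith) (by norm_num)
  have h7 : 250 * e ^ 4 * e' ^ 5 * (countScales δ s : ℝ) ≤ 250 * e ^ 4 * e' ^ 5 * 5 := by gcongr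
  have h8 : 5 * e ^ 4 * e' * (countBelow Tc (closeNode c (x p) (2 * δ)) s : ℝ) ≤
      5 * e ^ 4 * e' * e' ^ 2 := by gcongr
  have h9 : 5 * e ^ 4 * e' * e' ^ 2 ≤ 5 * e ^ 4 * e' ^ 5 := by
    rw [show 5 * e ^ 4 * e' * e' ^ 2 = 5 * e ^ 4 * e' ^ 3 by ring]
    gcongr
  have h10 : 250 * e ^ 9 * (countBelow Tc F s : ℝ) ≤ 250 * e ^ 9 * Tc.subtrees.countP F := by
    gcongr
  unfold amortized
  linarith

/-- The part of a potential that grows with the number of levels. -/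
noncomputable def levelCost (e e' : ℝ) (q s : ℤ) : ℝ :=
  250 * e ^ 4 * e' ^ 5 * ((s - q).toNat : ℝ)

theorem levelCost_nonneg (he : 2 ≤ e) (he' : 2 ≤ e') (q s : ℤ) : 0 ≤ levelCost e e' q s := by
  unfold levelCost; positivity

theorem levelCost_mono (he : 2 ≤ e) (he' : 2 ≤ e') (q : ℤ) : Monotone (levelCost e e' q) := by
  intro s s' h
  unfold levelCost
  have : (s - q).toNat ≤ (s' - q).toNat := by omega
  gcongr

theorem le_levelCost_sub (he : 2 ≤ e) (he' : 2 ≤ e') {q s z : ℤ} (hzs : z < s) (hqs : q < s) :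
    250 * e ^ 4 * e' ^ 5 ≤ levelCost e e' q s - levelCost e e' q z := by
  have h : ((z - q).toNat : ℝ) + 1 ≤ ((s - q).toNat : ℝ) := by
    have : (z - q).toNat + 1 ≤ (s - q).toNat := by omega
    exact_mod_cast this
  have h1 : 250 * e ^ 4 * e' ^ 5 * (((z - q).toNat : ℝ) + 1) ≤
      250 * e ^ 4 * e' ^ 5 * ((s - q).toNat : ℝ) := by gcongr
  unfold levelCost
  linarith

/-- The internal nodes of the reference tree that are close to `q` in comparison with `2 ^ s`. -/
noncomputable def closeInternal (c : Fin k → Pt d) (q : Pt d) (s : ℤ) (t : CTree (Fin k)) : Bool :=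
  decide (t.children ≠ []) && decide (dist q (c t.pt) ≤ 2 ^ s)

/-- The potential at a query node that is not the root; `s₀` is the smallest scale of an internal
  node. -/
noncomputable def potential (x : Fin N → Pt d) (c : Fin k → Pt d) (y : Fin N → Fin k)
    (Tc : CTree (Fin k)) (e e' : ℝ) (s₀ : ℤ) : CTree (Fin N) → ℤ → ℝ
  | leaf p => amortized c Tc e e' (dist (x p) (c (y p))) (x p) (levelCost e e' (s₀ - 6))
      (closeInternal c (x p) (s₀ - 3))
  | node _ q _ => levelCost e e' q

theorem children_ne_nil (hT : Loc c Tc) {p : Fin k} {s : ℤ} {cs : List (CTree (Fin k))}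
    (h : node p s cs ∈ Tc.subtrees) : (node p s cs).children ≠ [] := by
  rintro (rfl : cs = [])
  simpa using (hT.of_mem h).two_le

include hy in
-- At an internal query node the scale drops by at least one per recursion and stays above `q`. At a
-- leaf this works down to `s₀ - 6`; below that, on scales large against `δ`, the expanded node is
-- within `2 ^ (s₀ - 3)` of the data point.
theorem stepBound_potential (hT : Cov c Tc) (he : Doubling (Finset.univ.image c) e)
    (hee : e ≤ e') (he' : ∀ p, Doubling (insert (x p) (Finset.univ.image c)) e') (s₀ : ℤ)
    (tq : CTree (Fin N)) :
    StepBound x c y Tc (e ^ 4) tq (potential x c y Tc e e' s₀ tq) := by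
  have h2 := he.two_le
  have h2' := h2.trans hee
  cases tq with
  | leaf p =>
    refine stepBound_amortized hy hT he hee (tq := leaf p) (he' p)
      (levelCost_nonneg h2 h2' _) (levelCost_mono h2 h2' _) fun s z p' cs hzs hC hn hd => ?_
    simp only [pt_leaf] at hC hd
    by_cases hs : s₀ - 6 < s
    · exact Or.inl (le_levelCost_sub h2 h2' hzs hs)
    · right
      simp only [closeInternal, Bool.and_eq_true, decide_eq_true_eq]
      refine ⟨children_ne_nil hT.loc hn, hd.trans ?_⟩
      -- With `s ≤ s₀ - 6` and `3 * δ ≤ 2 ^ s`, one has `δ + 5 * 2 ^ s ≤ 8 * 2 ^ s ≤ 2 ^ (s₀ - 3)`.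
      have h3 : (2 : ℝ) ^ (s + 3) ≤ 2 ^ (s₀ - 3) := zpow_le_zpow_right₀ (by norm_num) (by omega)
      have h4 : (2 : ℝ) ^ (s + 3) = 8 * 2 ^ s := by
        rw [zpow_add₀ (by norm_num)]; norm_num; ring
      have h5 : (0 : ℝ) < 2 ^ s := by positivity
      linarith
  | node p q cs =>
    refine ⟨levelCost_nonneg h2 h2' _, levelCost_mono h2 h2' _, fun s z R hs hn hz htq => ?_⟩
    obtain ⟨a, ds, hp⟩ := exists_node_of_maxScale hz
    have hzs : z < s := by simpa using hs.scale_lt _ hp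
    have hqz : q < z := by simpa using htq
    have h3 := le_levelCost_sub h2 h2' hzs (hqz.trans hzs)
    have h4 := length_le_of_near hy hT he hee (he' _) hs hn
    have h5 : 5 * e ^ 4 * (R.length : ℝ) ≤ 5 * e ^ 4 * (50 * e' ^ 5) := by gcongr
    have h6 : 5 * e ^ 4 * (50 * e' ^ 5) = 250 * e ^ 4 * e' ^ 5 := by ring
    simp only [potential]
    linarith

/-- The number of internal reference nodes that a query node is charged for. -/
noncomputable def closeCount (x : Fin N → Pt d) (c : Fin k → Pt d) (Tc : CTree (Fin k)) (s₀ : ℤ) :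
    CTree (Fin N) → ℕ
  | leaf p => Tc.subtrees.countP (closeInternal c (x p) (s₀ - 3))
  | node _ _ _ => 0

include hy in
theorem traverseShare_le (hc : Function.Injective c) (hT : Cov c Tc)
    (he : Doubling (Finset.univ.image c) e) (hee : e ≤ e')
    (he' : ∀ p, Doubling (insert (x p) (Finset.univ.image c)) e') (T : CTree (Fin N))
    (l : ℤ × CTree (Fin N)) :
    traverseShare (e ^ 4) (50 * e' ^ 5) (potential x c y Tc e e' T.minScale) l ≤
      4000 * (e ^ 4 * e' ^ 5) * linkCost T l +
        250 * e ^ 9 * closeCount x c Tc T.minScale l.2 := by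
  have h2 := he.two_le
  have h2' := h2.trans hee
  obtain ⟨s, t⟩ := l
  have h3 : e' ^ 5 ≤ e ^ 4 * e' ^ 5 := by
    have : 1 ≤ e ^ 4 := one_le_pow₀ (by linarith)
    have : 0 ≤ e' ^ 5 := by positivity
    nlinarith
  have h4 : 1 ≤ e' ^ 5 := one_le_pow₀ (by linarith)
  have h5 : (1 : ℝ) ≤ linkCost T (s, t) := by
    have : 1 ≤ linkCost T (s, t) := by unfold linkCost; omega
    exact_mod_cast this
  have hP : 0 ≤ e ^ 4 * e' ^ 5 := by positivity
  unfold traverseShare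
  cases t with
  | leaf p =>
    have h6 := amortized_le hy hc hT he (he' p) (levelCost e e' (T.minScale - 6))
      (closeInternal c (x p) (T.minScale - 3)) s
    have h7 : ((s - (T.minScale - 6)).toNat : ℝ) ≤ linkCost T (s, leaf p) + 6 := by
      have : (s - (T.minScale - 6)).toNat ≤ linkCost T (s, leaf p) + 6 := by
        unfold linkCost; simp only [nodeImbalance]; omega
      exact_mod_cast this
    have h8 : levelCost e e' (T.minScale - 6) s ≤
        250 * (e ^ 4 * e' ^ 5) * (linkCost T (s, leaf p) + 6) := by
      unfold levelCost
      rw [mul_assoc 250]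
      gcongr
    simp only [potential, closeCount]
    nlinarith
  | node p q cs =>
    have h7 : ((s - q).toNat : ℝ) ≤ linkCost T (s, node p q cs) := by
      have : (s - q).toNat ≤ linkCost T (s, node p q cs) := by
        unfold linkCost; simp only [nodeImbalance]; omega
      exact_mod_cast this
    have h8 : levelCost e e' q s ≤ 250 * (e ^ 4 * e' ^ 5) * linkCost T (s, node p q cs) := by
      unfold levelCost
      rw [mul_assoc 250]
      gcongr
    simp only [potential, closeCount, Nat.cast_zero, mul_zero, add_zero]
    nlinarith

-- Charging each internal reference node to at most one data point.

theorem sum_countP_le {ι β : Type*} [Fintype ι] {f : ι → β → Bool} {g : β → Bool}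
    (h : ∀ i b, f i b = true → g b = true)
    (hd : ∀ i j b, f i b = true → f j b = true → i = j) (l : List β) :
    ∑ i, l.countP (f i) ≤ l.countP g := by
  classical
  induction l with
  | nil => simp
  | cons b l ih =>
    simp only [List.countP_cons, Finset.sum_add_distrib]
    refine Nat.add_le_add ih ?_
    rw [← Finset.card_filter]
    split_ifs with hg
    · refine Finset.card_le_one.2 fun i hi j hj => ?_
      simp only [Finset.mem_filter, Finset.mem_univ, true_and] at hi hj
      exact hd i j b hi hj
    · rw [Nat.le_zero, Finset.card_eq_zero, Finset.filter_eq_empty_iff]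
      exact fun i _ hi => hg (h i b hi)

theorem sum_closeCount_links (s₀ : ℤ) (t : CTree (Fin N)) :
    (t.links.map fun l => closeCount x c Tc s₀ l.2).sum + closeCount x c Tc s₀ t ≤
      (t.leaves.map fun p => Tc.subtrees.countP (closeInternal c (x p) (s₀ - 3))).sum := by
  induction t using induct with
  | leaf p => simp [closeCount]
  | node p s cs ih =>
    rw [links_node, leaves_node]
    rw [show closeCount x c Tc s₀ (node p s cs) = 0 from rfl, add_zero]
    induction cs with
    | nil => simp
    | cons t ts iht =>
      have h1 := ih t (by simp)
      have h2 := iht fun u hu => ih u (List.mem_cons_of_mem _ hu)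
      simp only [List.flatMap_cons, List.map_append, List.sum_append, List.map_cons,
        List.sum_cons]
      omega

theorem countP_internal_lt (hT : Cov c Tc) [NeZero k] :
    Tc.subtrees.countP (fun t => decide (t.children ≠ [])) + 1 ≤ k := by
  have h1 := hT.loc.countP_internal fun _ => true
  simp only [if_true, List.countP_true] at h1
  have h2 : Tc.leaves.length ≤ k := by
    simpa using hT.nodup.length_le_card
  have h3 : (fun u : CTree (Fin k) => decide (u.children ≠ []) && u.children.all fun _ => true) =
      fun u => decide (u.children ≠ []) := by
    funext u; simp
  rw [h3] at h1
  omega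

theorem IsCoverTree.dist_lt' {T : CTree (Fin N)} (h : T.IsCoverTree x) {p q : Fin N}
    (hpq : p ≠ q) : (2 : ℝ) ^ (T.minScale - 1) < dist (x p) (x q) := by
  refine IsCoverTree.dist_lt h ?_ hpq
  intro h0
  have h1 := h.mem_leaves p
  have h2 := h.mem_leaves q
  cases T with
  | leaf a => simp at h1 h2; exact hpq (h1.trans h2.symm)
  | node a s cs =>
    obtain ⟨t, ht, -⟩ := h.nesting a s cs (self_mem_subtrees _)
    rw [links_node, List.flatMap_eq_nil_iff] at h0
    simpa using h0 t ht

/-- Distinct data points are more than `2 ^ (minScale - 1) = 4 * 2 ^ (minScale - 3)` apart, so the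
balls of radius `2 ^ (minScale - 3)` around them are disjoint. The internal reference nodes in them
add up to at most `k - 1`. -/
theorem sum_closeCount_le [NeZero k] (hT : Cov c Tc) {T T' : CTree (Fin N)}
    (h : T.IsCoverTree x) (hn : T'.leaves.Nodup) :
    (T'.links.map fun l => closeCount x c Tc T.minScale l.2).sum + 1 ≤ k := by
  have h1 := sum_closeCount_links (x := x) (c := c) (Tc := Tc) T.minScale T'
  have h2 : (T'.leaves.map fun p =>
      Tc.subtrees.countP (closeInternal c (x p) (T.minScale - 3))).sum ≤
      ∑ p, Tc.subtrees.countP (closeInternal c (x p) (T.minScale - 3)) := by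
    rw [← List.sum_toFinset _ hn]
    exact Finset.sum_le_sum_of_subset (Finset.subset_univ _)
  have h3 := sum_countP_le (f := fun p : Fin N => closeInternal c (x p) (T.minScale - 3))
    (g := fun t => decide (t.children ≠ [])) (fun p t ht => by
      simp only [closeInternal, Bool.and_eq_true] at ht; exact ht.1) (fun p q t hp hq => by
      by_contra hpq
      have h4 := IsCoverTree.dist_lt' h hpq
      simp only [closeInternal, Bool.and_eq_true, decide_eq_true_eq] at hp hq
      have h5 := dist_triangle_right (x p) (x q) (c t.pt)
      have h6 : (2 : ℝ) ^ (T.minScale - 1) = 4 * 2 ^ (T.minScale - 3) := by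
        rw [show T.minScale - 1 = T.minScale - 3 + 1 + 1 by ring, two_zpow_succ, two_zpow_succ]
        ring
      have h7 : (0 : ℝ) < 2 ^ (T.minScale - 3) := by positivity
      linarith [hp.2, hq.2]) Tc.subtrees
  have h4 := countP_internal_lt hT
  omega

end Potentials

/-! ### The running time of an iteration -/

section Iteration

variable {d N k : ℕ} {x : Fin N → Pt d} {c : Fin k → Pt d}

theorem Doubling.mono {S : Finset (Pt d)} {e e' : ℝ} (h : Doubling S e) (hee : e ≤ e') :
    Doubling S e' :=
  ⟨h.two_le.trans hee, fun p hp Δ hΔ => (h.ball_le p hp Δ hΔ).trans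
    (mul_le_mul_of_nonneg_right hee (Nat.cast_nonneg _))⟩

/-- The root has no imbalance to pay with. Its recursions on large scales are charged to all
internal reference nodes, which is affordable for a single query node. -/
theorem stepBound_root {y : Fin N → Fin k} (hy : ∀ p j, dist (x p) (c (y p)) ≤ dist (x p) (c j))
    {Tc : CTree (Fin k)} {e e' : ℝ} (hT : Cov c Tc) (he : Doubling (Finset.univ.image c) e)
    (hee : e ≤ e') {tq : CTree (Fin N)}
    (he' : Doubling (insert (x tq.pt) (Finset.univ.image c)) e') :
    StepBound x c y Tc (e ^ 4) tq (amortized c Tc e e' (dist (x tq.pt) (c (y tq.pt))) (x tq.pt)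
      (fun _ => 0) fun t => decide (t.children ≠ [])) :=
  stepBound_amortized hy hT he hee he' (fun _ => le_rfl) monotone_const
    fun _ _ _ _ _ _ hn _ => Or.inr (decide_eq_true (children_ne_nil hT.loc hn))

theorem exists_level (t : CTree (Fin k)) : ∃ s : ℤ, t.scale < (s : WithBot ℤ) := by
  cases t with
  | leaf p => exact ⟨0, WithBot.bot_lt_coe 0⟩
  | node p s cs => exact ⟨s + 1, WithBot.coe_lt_coe.2 (lt_add_one s)⟩

/-- The root's share is a constant times `e ^ 4 * e' ^ 5` plus `250 * e ^ 9 * (k - 1)`; the leaves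
together add a second `250 * e ^ 9 * (k - 1)`, and all else is proportional to the link costs. -/
theorem dualTree_time [NeZero k] (hc : Function.Injective c) {Tc : CTree (Fin k)}
    (hT : Cov c Tc) (hall : ∀ j, j ∈ Tc.leaves) {e e' : ℝ}
    (he : Doubling (Finset.univ.image c) e) (hee : e ≤ e')
    (he' : ∀ p, Doubling (insert (x p) (Finset.univ.image c)) e') {T : CTree (Fin N)}
    (hTq : T.IsCoverTree x) {T' : CTree (Fin N)} (hq : QTree x (below T) T')
    (hkeys : (T'.subtrees.map key).Nodup) (hleaves : T'.leaves.Nodup) {σ : State N k}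
    (hσ : UpperBoundsValid x c T σ) :
    ((dualTree x c T' Tc σ).2 : ℝ) ≤
      1600 * (e ^ 4 * e' ^ 5) + 4000 * (e ^ 4 * e' ^ 5) * (T'.links.map (linkCost T)).sum +
        500 * e ^ 9 * ((k : ℝ) - 1) + T'.numNodes := by
  have h2 := he.two_le
  have h2' := h2.trans hee
  choose y hy using fun p : Fin N => Finite.exists_min fun j : Fin k => dist (x p) (c j)
  set σ₀ : State N k := { σ with visited := fun _ => false } with hσ₀
  have hval : BoundsValid x c (below T) σ₀ := by
    rintro a p ⟨t, ht, rfl, hp⟩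
    exact hσ t ht p hp
  have hv := visit_spec (y := y) hy (par := none) hq [Tc]
    (by simpa using hT.loc) hval
  obtain ⟨s, hs⟩ := exists_level Tc
  have hlev : LevelSet Tc s [Tc] :=
    ⟨fun t ht => Or.inl (by simpa using ht), fun t ht => by
      rw [List.mem_singleton.1 ht]; exact hs, by simpa using hT.nodup⟩
  have htr := traverse_bound (x := x) (D := below T) (m := 50 * e' ^ 5)
    (Ψ := potential x c y Tc e e' T.minScale) hy hT.loc
    (b := e ^ 4) (one_le_pow₀ (by linarith)) (by positivity)
    (fun t ht => children_length_le hT he ht)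
    (fun p s R hs hn => length_le_of_near hy hT he hee (he' p) hs hn) T'
    _ none s (visit x c none T' [Tc] σ₀).kept (visit x c none T' [Tc] σ₀).state
    (stepBound_root hy hT he hee (he' _)) hq hkeys
    (fun l _ => stepBound_potential hy hT he hee he' _ _)
    (visited_children hkeys hv.progress fun _ _ _ _ => rfl) hv.valid
    (fun hne => Ready.after_visit hv hne (Or.inr fun p _ => by simpa using hall (y p)))
    (hlev.sublist hv.sublist) (by
      have h3 : ((visit x c none T' [Tc] σ₀).kept.length : ℝ) ≤ 1 := by
        exact_mod_cast hv.sublist.length_le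
      have h4 : 1 ≤ e' ^ 5 := one_le_pow₀ (by linarith)
      linarith)
  have htime := htr.time s (maxScale_le fun t ht => by
    rw [List.mem_singleton.1 (hv.sublist.subset ht)]; exact hs.le)
  have hψ := amortized_le hy hc hT he (he' T'.pt) (fun _ => 0)
    (fun t => decide (t.children ≠ [])) s
  have hint : (Tc.subtrees.countP (fun t => decide (t.children ≠ [])) : ℝ) ≤ k - 1 := by
    have : (Tc.subtrees.countP (fun t => decide (t.children ≠ [])) : ℝ) + 1 ≤ k := by
      exact_mod_cast countP_internal_lt hT
    linarith
  have hclose : ((T'.links.map fun l => closeCount x c Tc T.minScale l.2).sum : ℝ) ≤ k - 1 := by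
    have : ((T'.links.map fun l => closeCount x c Tc T.minScale l.2).sum : ℝ) + 1 ≤ k := by
      exact_mod_cast sum_closeCount_le hT hTq hleaves
    linarith
  have htot : traverseTotal (e ^ 4) (50 * e' ^ 5) (potential x c y Tc e e' T.minScale) T' ≤
      4000 * (e ^ 4 * e' ^ 5) * ((T'.links.map (linkCost T)).sum : ℝ) +
        250 * e ^ 9 * ((T'.links.map fun l => closeCount x c Tc T.minScale l.2).sum : ℝ) := by
    unfold traverseTotal
    induction T'.links with
    | nil => simp
    | cons l ls ih =>
      have := traverseShare_le hy hc hT he hee he' T l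
      simp only [List.map_cons, List.sum_cons]
      push_cast at ih ⊢
      linarith
  have h3 : (50 * e' ^ 5 : ℝ) ≤ 50 * (e ^ 4 * e' ^ 5) := by
    have : 1 ≤ e ^ 4 := one_le_pow₀ (by linarith)
    have : 0 ≤ e' ^ 5 := by positivity
    nlinarith
  have h4 : 1 ≤ e ^ 4 * e' ^ 5 :=
    one_le_mul_of_one_le_of_one_le (one_le_pow₀ (by linarith)) (one_le_pow₀ (by linarith))
  have h5 : ((visit x c none T' [Tc] σ₀).time : ℝ) ≤ 2 := by exact_mod_cast hv.time_le
  have h6 : 250 * e ^ 9 * (Tc.subtrees.countP (fun t => decide (t.children ≠ [])) : ℝ) ≤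
      250 * e ^ 9 * (k - 1) := by gcongr
  have h7 : 250 * e ^ 9 *
      ((T'.links.map fun l => closeCount x c Tc T.minScale l.2).sum : ℝ) ≤
      250 * e ^ 9 * (k - 1) := by gcongr
  simp only [dualTree]
  rw [← hσ₀]
  push_cast at htime hψ h7 htot ⊢
  linarith

-- Linear passes over the query tree, and the sum of all phases.

theorem gatherList_time (σ : State N k) (l : List (CTree (Fin N)))
    (h : ∀ t ∈ l, ∀ S : Sums d k, (gather x σ t S).2 + 1 ≤ 2 * t.numNodes) (S : Sums d k) :
    (gatherList x σ l S).2 ≤ 2 * (l.map numNodes).sum := by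
  induction l generalizing S with
  | nil => simp [gatherList]
  | cons t ts ih =>
    have h1 := h t (by simp) S
    have h2 := ih (fun u hu => h u (List.mem_cons_of_mem _ hu)) (gather x σ t S).1
    simp only [gatherList, List.map_cons, List.sum_cons]
    omega

theorem gather_time (σ : State N k) (t : CTree (Fin N)) (S : Sums d k) :
    (gather x σ t S).2 + 1 ≤ 2 * t.numNodes := by
  induction t using induct generalizing S with
  | leaf p => rw [gather]; split_ifs <;> simp
  | node p s cs ih =>
    have h1 := gatherList_time σ cs ih S
    rw [gather]
    simp only [numNodes_node]
    split_ifs <;> simp only <;> omega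

theorem updateBoundsList_time (M : Moves d k) (par : Option (Key N)) (l : List (CTree (Fin N)))
    (h : ∀ t ∈ l, ∀ (par : Option (Key N)) (σ : State N k),
      (updateBounds x M par t σ).2 + 2 ≤ 4 * t.numNodes) (σ : State N k) :
    (updateBoundsList x M par l σ).2 + l.length ≤ 4 * (l.map numNodes).sum := by
  induction l generalizing σ with
  | nil => simp [updateBoundsList]
  | cons t ts ih =>
    have h1 := h t (by simp) par σ
    have h2 := ih (fun u hu => h u (List.mem_cons_of_mem _ hu)) (updateBounds x M par t σ).1
    simp only [updateBoundsList, List.map_cons, List.sum_cons, List.length_cons]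
    omega

theorem updateBounds_time (M : Moves d k) (par : Option (Key N)) (t : CTree (Fin N))
    (σ : State N k) : (updateBounds x M par t σ).2 + 2 ≤ 4 * t.numNodes := by
  induction t using induct generalizing par σ with
  | leaf p => simp [updateBounds]
  | node p s cs ih =>
    have h1 := updateBoundsList_time M (some (p, (s : WithBot ℤ))) cs ih
      (updatePre x M par (node p s cs) σ)
    simp only [updateBounds, numNodes_node]
    omega

theorem expansion_le_joint (x : Fin N → Pt d) (c : Fin k → Pt d) :
    centroidExpansion c ≤ jointExpansion x c := le_max_right _ _

theorem doubling_centroids (c : Fin k → Pt d) :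
    Doubling (Finset.univ.image c) (centroidExpansion c) := by
  unfold centroidExpansion
  convert doubling_expansionConstant (Finset.univ.image c)

theorem doubling_insert (x : Fin N → Pt d) (c : Fin k → Pt d) (p : Fin N) :
    Doubling (insert (x p) (Finset.univ.image c)) (jointExpansion x c) := by
  refine Doubling.mono (doubling_expansionConstant _) (le_max_of_le_left ?_)
  refine le_trans (le_of_eq ?_) (le_ciSup (Set.finite_range _).bddAbove p)
  congr!

/-- Most of the constant `10000` comes from up to `2 * N` links at `4000` each and `1600` for the
root; the linear passes cost at most `22 * N`. -/
theorem iteration_time [NeZero N] [NeZero k] (hc : Function.Injective c) {T : CTree (Fin N)}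
    (hT : T.IsCoverTree x) {σ : State N k} (hσ : UpperBoundsValid x c T σ) :
    ((iteration x T c σ).time : ℝ) ≤
      10000 * (centroidExpansion c ^ 4 * jointExpansion x c ^ 5 *
          ((N : ℝ) + (T.imbalance : ℝ)) +
        max (centroidExpansion c) (centroidExpansion (iteration x T c σ).cen) ^ 9 *
          ((k : ℝ) * Real.log k)) := by
  have he := doubling_centroids c
  have he₁ := doubling_centroids (iteration x T c σ).cen
  have hee := expansion_le_joint x c
  have he' := doubling_insert x c
  set e := centroidExpansion c
  set e₁ := centroidExpansion (iteration x T c σ).cen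
  set e' := jointExpansion x c
  have h2 := he.two_le
  have h2' := h2.trans hee
  obtain ⟨W, -, hW⟩ := exists_nearLinks_bound c he
  obtain ⟨hTc, htwin, -⟩ := buildTree_spec hW
  have hall : ∀ j, j ∈ (buildTree c).1.tree.leaves := fun j => by
    rcases htwin j with h | ⟨-, q, hq, hqj⟩
    · exact h
    · exact hc hqj ▸ hq
  obtain ⟨hkeys, hleaves, hcost, hq, hsmall, -⟩ := coalesceTree_spec hT.cov σ
  have hpass := dualTree_time hc hTc hall he hee he' hT hq
    ((hT.cov.loc.keys_nodup hT.leaves_nodup).sublist hkeys) (hT.leaves_nodup.sublist hleaves) hσ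
  have hbuild := buildTree_time c he
  have hnn := allNearest_time _ he₁
  have hn : (T.numNodes : ℝ) ≤ 2 * N := by
    have := IsCoverTree.numNodes_le hT
    exact_mod_cast (by omega : T.numNodes ≤ 2 * N)
  have hn' : ((coalesceTree σ T).1.numNodes : ℝ) ≤ T.numNodes := by
    have := hkeys.length_le
    rw [List.length_map, List.length_map, CTree.length_subtrees, CTree.length_subtrees] at this
    exact_mod_cast this
  have hcost' : (((coalesceTree σ T).1.links.map (linkCost T)).sum : ℝ) ≤
      T.imbalance + 2 * N := by
    have h3 := sum_linkCost T
    have h4 := IsCoverTree.numNodes_le hT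
    rw [numNodes_eq_links] at h4
    have h5 : ((coalesceTree σ T).1.links.map (linkCost T)).sum ≤ T.imbalance + 2 * N := by
      omega
    exact_mod_cast h5
  have hsmall' : ((coalesceTree σ T).2 : ℝ) ≤ 2 * T.numNodes := by exact_mod_cast hsmall
  set pass := dualTree x c (coalesceTree σ T).1 (buildTree c).1.tree σ with hpassdef
  have hcen : ((updateCentroids x T pass.1).2 : ℝ) ≤ 2 * T.numNodes + 2 * k := by
    have h3 := gather_time (x := x) pass.1 T { sum := fun _ => 0, num := fun _ => 0 }
    have h4 : (updateCentroids x T pass.1).2 ≤ 2 * T.numNodes + 2 * k := by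
      simp only [updateCentroids]; omega
    exact_mod_cast h4
  have hupd : ((updateTree x T c (updateCentroids x T pass.1).1 pass.1).2 : ℝ) ≤
      160 * e₁ ^ 9 * (k * Real.log k) + 4 + 3 * k + 4 * T.numNodes := by
    have h3 : (updateTree x T c (updateCentroids x T pass.1).1 pass.1).2 ≤
        (allNearest (iteration x T c σ).cen).2 + 3 * k + 4 * T.numNodes := by
      simp only [updateTree]
      exact Nat.add_le_add (le_refl _) ((Nat.le_add_right _ 2).trans (updateBounds_time _ _ _ _))
    have h4 : ((updateTree x T c (updateCentroids x T pass.1).1 pass.1).2 : ℝ) ≤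
        (allNearest (iteration x T c σ).cen).2 + 3 * k + 4 * T.numNodes := by
      exact_mod_cast h3
    linarith
  have htime : ((iteration x T c σ).time : ℝ) = T.numNodes + (coalesceTree σ T).2 +
      (buildTree c).2 + pass.2 + T.numNodes + (updateCentroids x T pass.1).2 +
      (updateTree x T c (updateCentroids x T pass.1).1 pass.1).2 := by
    simp only [iteration]
    push_cast
    rfl
  rw [htime]
  set P := e ^ 4 * e' ^ 5 with hPdef
  set M := max e e₁ ^ 9
  set κ : ℝ := k * Real.log k
  have hκ : 0 ≤ κ := mul_nonneg (Nat.cast_nonneg _) (log_natCast_nonneg k)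
  have hk : (k : ℝ) - 1 ≤ κ := natCast_sub_one_le k
  have hP : 1 ≤ P :=
    one_le_mul_of_one_le_of_one_le (one_le_pow₀ (by linarith)) (one_le_pow₀ (by linarith))
  have hM1 : e ^ 9 ≤ M := pow_le_pow_left₀ (by linarith) (le_max_left _ _) 9
  have hM2 : e₁ ^ 9 ≤ M := pow_le_pow_left₀ (by linarith [he₁.two_le]) (le_max_right _ _) 9
  have hM0 : 1 ≤ e ^ 9 := one_le_pow₀ (by linarith)
  have hN : (1 : ℝ) ≤ N := by exact_mod_cast NeZero.one_le
  have hI : (0 : ℝ) ≤ T.imbalance := Nat.cast_nonneg _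
  have a1 : 4000 * P * (((coalesceTree σ T).1.links.map (linkCost T)).sum : ℝ) ≤
      4000 * P * (T.imbalance + 2 * N) := by gcongr
  have a2 : 500 * e ^ 9 * ((k : ℝ) - 1) ≤ 500 * M * κ := by
    refine (mul_le_mul_of_nonneg_left hk (by positivity)).trans ?_
    gcongr
  have a3 : 80 * e ^ 9 * κ ≤ 80 * M * κ := by gcongr
  have a4 : 160 * e₁ ^ 9 * κ ≤ 160 * M * κ := by gcongr
  have a5 : (k : ℝ) ≤ M * κ + 1 := by nlinarith
  have a6 : (N : ℝ) ≤ P * N := le_mul_of_one_le_left (by linarith) hP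
  have a7 : P ≤ P * N := le_mul_of_one_le_right (by linarith) hN
  have a8 : 0 ≤ P * T.imbalance := by positivity
  have a9 : 0 ≤ M * κ := mul_nonneg (by linarith) hκ
  linarith

end Iteration

end DualTree

theorem theorem2 :
    ∃ K : ℝ, 0 < K ∧
      ∀ (d N k : ℕ) [NeZero N] [NeZero k]
        (x : Fin N → DualTree.Pt d) (c : Fin k → DualTree.Pt d),
        Function.Injective x → Function.Injective c →
        ∀ (T : DualTree.CTree (Fin N)), T.IsCoverTree x →
        ∀ (σ : DualTree.State N k), DualTree.UpperBoundsValid x c T σ →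
          ((DualTree.iteration x T c σ).time : ℝ) ≤
            K * (DualTree.centroidExpansion c ^ 4 * DualTree.jointExpansion x c ^ 5 *
                  ((N : ℝ) + (T.imbalance : ℝ)) +
                max (DualTree.centroidExpansion c)
                  (DualTree.centroidExpansion (DualTree.iteration x T c σ).cen) ^ 9 *
                  ((k : ℝ) * Real.log k)) :=
  ⟨10000, by norm_num, fun _ _ _ _ _ _ _ _ hc _ hT _ hσ => DualTree.iteration_time hc hT hσ⟩
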